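/- **Theorem 6.5.** Work over $\mathbf{C}$, let $x_0,\dots,x_7$ (indices in $\mathbf{Z}/8$) be homogeneous coordinates on $\mathbf{P}^7$, and put $\xi=e^{2\pi i/8}$. Let $\mathbf{H}_8\subset \mathrm{GL}_8(\mathbf{C})$ be the Heisenberg group generated by $\sigma$ and $\tau$, where $\sigma(x_i)=x_{i-1}$ and $\tau(x_i)=\xi^{-i}x_i$, and let $\mathbf{H}'\subset\mathbf{H}_8$ be the subgroup generated by $\sigma^4$ and $\tau^4$. Let $\mathbf{P}^2_-\subset\mathbf{P}^7$ be the projectivised $(-1)$-eigenspace of the involution $x_i\mapsto x_{-i}$, that is, the set of points $(0:y_1:y_2:y_3:0:-y_3:-y_2:-y_1)$. For $y\in\mathbf{P}^2_-$ let $V_{8,y}\subset\mathbf{P}^7$ be the closed subscheme defined by the homogeneous ideal generated by all $\mathbf{H}'$-invariant quadratic forms that vanish on the $\mathbf{H}_8$-orbit of $y$. Then there is a non-empty Zariski-open subset of $\mathbf{P}^2_-$ such that for every $y$ in it: 1. $V_{8,y}$ is a complete intersection of type $(2,2,2,2)$, i.e. its defining ideal is generated by four quadratic forms and $\dim V_{8,y}=3$;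 2. the $\mathbf{H}_8$-orbit of $y$ consists of exactly $64$ points, and the singular locus of $V_{8,y}$ (the set of points whose local ring is not regular) is precisely this orbit; 3. each of these singular points is an ordinary double point, i.e. the completed local ring of $V_{8,y}$ there is isomorphic to $\mathbf{C}[[t_0,t_1,t_2,t_3]]/(t_0^2+t_1^2+t_2^2+t_3^2)$. -/

import Mathlib

open scoped LinearAlgebra.Projectivization

attribute [instance] MvPolynomial.gradedAlgebra

noncomputable section

namespace HeisenbergEight

open MvPolynomial AlgebraicGeometry

/-! ### Projective space `P^7` and its closed subschemes -/

/-- The vector space `ℂ^8`, with coordinates indexed by `ℤ/8`. -/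
abbrev Vec : Type := ZMod 8 → ℂ

/-- The homogeneous coordinate ring `ℂ[x_0, …, x_7]` of `P^7`. -/
abbrev Ring8 : Type := MvPolynomial (ZMod 8) ℂ

/-- The grading of `ℂ[x_0, …, x_7]` by degree. -/
abbrev deg : ℕ → Submodule ℂ Ring8 := homogeneousSubmodule (ZMod 8) ℂ

/-- Projective space `P^7` over `ℂ`, as a scheme. -/
abbrev P7 : Scheme := Proj deg

/-- The ideal of all polynomials that vanish on the line `p ⊆ ℂ^8`. -/
def pointIdeal (p : ℙ ℂ Vec) : Ideal Ring8 where
  carrier := {f | ∀ v ∈ p.submodule, eval v f = 0}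
  zero_mem' := fun v _ => by simp
  add_mem' := fun hf hg v hv => by simp [hf v hv, hg v hv]
  smul_mem' := fun c f hf v hv => by simp [hf v hv]

/-- Restriction of a polynomial to the line `p`, parametrised by a coordinate `T`. -/
def restrictLine (p : ℙ ℂ Vec) : Ring8 →ₐ[ℂ] Polynomial ℂ :=
  aeval fun i => Polynomial.C (p.rep i) * Polynomial.X

lemma eval_restrictLine (p : ℙ ℂ Vec) (f : Ring8) (t : ℂ) :
    (restrictLine p f).eval t = eval (t • p.rep) f := by
  have h : ((Polynomial.aeval t).comp (restrictLine p) : Ring8 →ₐ[ℂ] ℂ) =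
      aeval (t • p.rep) := by
    ext i
    simp only [restrictLine, AlgHom.comp_apply, aeval_X, map_mul, Polynomial.aeval_C,
      Polynomial.aeval_X, Pi.smul_apply, smul_eq_mul]
    exact mul_comm _ _
  have h2 := DFunLike.congr_fun h f
  simpa [Polynomial.aeval_def, Polynomial.eval₂_eq_eval_map, MvPolynomial.aeval_eq_eval] using h2

lemma mem_pointIdeal_iff (p : ℙ ℂ Vec) (f : Ring8) :
    f ∈ pointIdeal p ↔ restrictLine p f = 0 := by
  constructor
  · intro hf
    refine Polynomial.funext fun t => ?_
    rw [eval_restrictLine, Polynomial.eval_zero]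
    refine hf _ (Submodule.smul_mem _ _ ?_)
    rw [Projectivization.submodule_eq]
    exact Submodule.mem_span_singleton_self _
  · intro hf v hv
    rw [Projectivization.submodule_eq, Submodule.mem_span_singleton] at hv
    obtain ⟨t, rfl⟩ := hv
    rw [← eval_restrictLine, hf, Polynomial.eval_zero]

lemma restrictLine_of_mem_deg (p : ℙ ℂ Vec) {n : ℕ} {f : Ring8} (hf : f ∈ deg n) :
    restrictLine p f = Polynomial.monomial n (eval p.rep f) := by
  refine Polynomial.funext fun t => ?_
  rw [eval_restrictLine, Polynomial.eval_monomial, eval_eq', eval_eq', Finset.sum_mul]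
  refine Finset.sum_congr rfl fun d hd => ?_
  have h : d.degree = n := by
    rw [Finsupp.degree_eq_weight_one]
    exact hf (mem_support_iff.mp hd)
  have h2 : ∑ i : ZMod 8, d i = n := by
    rw [← h, Finsupp.degree_eq_sum]
  simp only [Pi.smul_apply, smul_eq_mul, mul_pow, Finset.prod_mul_distrib,
    Finset.prod_pow_eq_pow_sum, h2]
  ring

lemma coeff_restrictLine (p : ℙ ℂ Vec) (n : ℕ) (f : Ring8) :
    (restrictLine p f).coeff n = eval p.rep (homogeneousComponent n f) := by
  conv_lhs => rw [← sum_homogeneousComponent f]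
  rw [map_sum, Polynomial.finsetSum_coeff]
  simp_rw [restrictLine_of_mem_deg p (homogeneousComponent_mem _ f), Polynomial.coeff_monomial]
  rw [Finset.sum_ite_eq']
  split_ifs with h
  · rfl
  · rw [homogeneousComponent_eq_zero, map_zero]
    simpa using h

lemma pointIdeal_isHomogeneous (p : ℙ ℂ Vec) : (pointIdeal p).IsHomogeneous deg := by
  intro n f hf
  rw [mem_pointIdeal_iff] at hf ⊢
  have h : ((DirectSum.decompose deg f n : deg n) : Ring8) = homogeneousComponent n f :=
    decomposition.decompose'_apply f n
  rw [h, restrictLine_of_mem_deg p (homogeneousComponent_mem n f), ← coeff_restrictLine, hf]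
  simp

lemma pointIdeal_isPrime (p : ℙ ℂ Vec) : (pointIdeal p).IsPrime := by
  have h : pointIdeal p = RingHom.ker (restrictLine p) :=
    Ideal.ext fun f => mem_pointIdeal_iff p f
  rw [h]
  exact RingHom.ker_isPrime _

/-- The closed point of the scheme `P^7` given by a line in `ℂ^8`: its homogeneous prime ideal
consists of the polynomials that vanish on the line. -/
def toP7 (p : ℙ ℂ Vec) : P7 where
  asHomogeneousIdeal := ⟨pointIdeal p, pointIdeal_isHomogeneous p⟩
  isPrime := pointIdeal_isPrime p
  not_irrelevant_le := by
    intro h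
    apply p.rep_nonzero
    funext i
    have hX : (X i : Ring8) ∈ pointIdeal p :=
      h (HomogeneousIdeal.mem_irrelevant_of_mem deg Nat.one_pos (isHomogeneous_X ℂ i))
    have := hX p.rep (by
      rw [Projectivization.submodule_eq]
      exact Submodule.mem_span_singleton_self _)
    simpa using this

/-- The grading of `ℂ[x_0, …, x_7] / I` induced by the degree, for a homogeneous ideal `I`. -/
def quotDeg (I : HomogeneousIdeal deg) (n : ℕ) : Submodule ℂ (Ring8 ⧸ I.toIdeal) :=
  (deg n).map (Ideal.Quotient.mkₐ ℂ I.toIdeal).toLinearMap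

/-- The map that reduces the homogeneous components of a polynomial modulo `I`. -/
def quotComponents (I : HomogeneousIdeal deg) :
    Ring8 →ₗ[ℂ] DirectSum ℕ fun n => quotDeg I n :=
  (DirectSum.lmap fun n =>
    (Ideal.Quotient.mkₐ ℂ I.toIdeal).toLinearMap.restrict (p := deg n) (q := quotDeg I n)
      (fun _ hf => Submodule.mem_map_of_mem hf)) ∘ₗ
    (DirectSum.decomposeLinearEquiv deg).toLinearMap

lemma coe_quotComponents (I : HomogeneousIdeal deg) (f : Ring8) (n : ℕ) :
    (quotComponents I f n : Ring8 ⧸ I.toIdeal) =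
      Ideal.Quotient.mk I.toIdeal (DirectSum.decompose deg f n : Ring8) := by
  simp only [quotComponents, LinearMap.comp_apply, DirectSum.lmap_apply]
  rfl

lemma quotComponents_eq_zero (I : HomogeneousIdeal deg) (f : Ring8) (hf : f ∈ I.toIdeal) :
    quotComponents I f = 0 := by
  refine DFinsupp.ext fun n => Subtype.ext ?_
  rw [coe_quotComponents]
  exact Ideal.Quotient.eq_zero_iff_mem.mpr (I.isHomogeneous n hf)

lemma sum_quotComponents (I : HomogeneousIdeal deg) (f : Ring8) :
    DirectSum.coeAddMonoidHom (quotDeg I) (quotComponents I f) =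
      Ideal.Quotient.mk I.toIdeal f := by
  have h : (DirectSum.coeLinearMap (quotDeg I)) ∘ₗ quotComponents I ∘ₗ
      (DirectSum.decomposeLinearEquiv deg).symm.toLinearMap =
      (Ideal.Quotient.mkₐ ℂ I.toIdeal).toLinearMap ∘ₗ
        (DirectSum.decomposeLinearEquiv deg).symm.toLinearMap := by
    refine DirectSum.linearMap_ext _ fun n => ?_
    ext f
    simp [quotComponents, DirectSum.lmap_lof]
    rfl
  simpa using! LinearMap.congr_fun h (DirectSum.decomposeLinearEquiv deg f)

instance quotDegGradedAlgebra (I : HomogeneousIdeal deg) : GradedAlgebra (quotDeg I) where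
  one_mem := ⟨1, SetLike.GradedOne.one_mem, rfl⟩
  mul_mem := by
    rintro m n _ _ ⟨f, hf, rfl⟩ ⟨g, hg, rfl⟩
    exact ⟨f * g, SetLike.GradedMul.mul_mem hf hg, rfl⟩
  decompose' x := quotComponents I (Function.surjInv Ideal.Quotient.mk_surjective x)
  left_inv x := by
    rw [sum_quotComponents]
    exact Function.surjInv_eq Ideal.Quotient.mk_surjective x
  right_inv := by
    have key : ∀ f g : Ring8, Ideal.Quotient.mk I.toIdeal f = Ideal.Quotient.mk I.toIdeal g →
        quotComponents I f = quotComponents I g := by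
      intro f g h
      have h2 := quotComponents_eq_zero I (f - g) (Ideal.Quotient.eq.mp h)
      rw [← sub_add_cancel f g, map_add, h2, zero_add]
    have surj : Function.Surjective (quotComponents I) := by
      unfold quotComponents
      rw [LinearMap.coe_comp]
      refine Function.Surjective.comp ((DirectSum.lmap_surjective _).mpr fun n => ?_)
        (DirectSum.decomposeLinearEquiv deg).surjective
      rintro ⟨_, f, hf, rfl⟩
      exact ⟨⟨f, hf⟩, rfl⟩
    intro d
    obtain ⟨f, rfl⟩ := surj d
    apply key
    rw [sum_quotComponents]
    exact Function.surjInv_eq Ideal.Quotient.mk_surjective _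

/-- The graded quotient map `ℂ[x_0, …, x_7] → ℂ[x_0, …, x_7] / I`. -/
def quotMap (I : HomogeneousIdeal deg) : deg →+*ᵍ quotDeg I where
  toRingHom := Ideal.Quotient.mk I.toIdeal
  map_mem := fun hf => Submodule.mem_map_of_mem hf

lemma irrelevant_le_map_quotMap (I : HomogeneousIdeal deg) :
    HomogeneousIdeal.irrelevant (quotDeg I) ≤
      (HomogeneousIdeal.irrelevant deg).map (quotMap I) := by
  rw [HomogeneousIdeal.irrelevant_le]
  rintro n hn _ ⟨f, hf, rfl⟩
  exact Ideal.mem_map_of_mem (quotMap I)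
    (HomogeneousIdeal.mem_irrelevant_of_mem deg hn hf)

/-- The closed subscheme `Proj (ℂ[x_0, …, x_7] / I)` of `P^7` defined by a homogeneous ideal. -/
abbrev subscheme (I : HomogeneousIdeal deg) : Scheme := Proj (quotDeg I)

/-- The closed immersion of the subscheme defined by `I` into `P^7`. -/
def immersion (I : HomogeneousIdeal deg) : subscheme I ⟶ P7 :=
  Proj.map (quotMap I) (irrelevant_le_map_quotMap I)

/-- The subscheme of `P^7` defined by `I` is a complete intersection of type `(d_1, …, d_r)`:
`I` is generated by forms of degrees `d_1, …, d_r` and the subscheme has codimension `r`. -/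
def IsCompleteIntersection (I : HomogeneousIdeal deg) {r : ℕ} (d : Fin r → ℕ) : Prop :=
  (∃ F : Fin r → Ring8, (∀ i, F i ∈ deg (d i)) ∧ I.toIdeal = Ideal.span (Set.range F)) ∧
    topologicalKrullDim (subscheme I) + r = 7

/-! ### Singular points -/

/-- The singular locus of a scheme: the points whose local ring is not regular. -/
def singularLocus (X : Scheme) : Set X :=
  {x | ¬ IsRegularLocalRing (X.presheaf.stalk x)}

/-- A point of an `n`-dimensional scheme over `ℂ` is an ordinary double point if its completed
local ring is isomorphic to `ℂ⟦t_0, …, t_n⟧ / (t_0 ^ 2 + ⋯ + t_n ^ 2)`. -/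
def IsOrdinaryDoublePoint (n : ℕ) {X : Scheme} (x : X) : Prop :=
  Nonempty (AdicCompletion (IsLocalRing.maximalIdeal (X.presheaf.stalk x)) (X.presheaf.stalk x) ≃+*
    (MvPowerSeries (Fin (n + 1)) ℂ ⧸
      Ideal.span {∑ i, (MvPowerSeries.X i : MvPowerSeries (Fin (n + 1)) ℂ) ^ 2}))

/-! ### The Heisenberg group and the scheme `V_{8,y}` -/

/-- The primitive eighth root of unity `ξ = exp (2πi / 8)`. -/
def xi : ℂ := Complex.exp (2 * Real.pi * Complex.I / 8)

/-- The generator `σ` of the Heisenberg group; it pulls the coordinate `x_i` back to `x_{i-1}`. -/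
def sigma : Vec ≃ₗ[ℂ] Vec :=
  LinearEquiv.funCongrLeft ℂ ℂ (Equiv.subRight (1 : ZMod 8))

/-- The generator `τ` of the Heisenberg group; it pulls the coordinate `x_i` back to
`ξ^{-i} x_i`. -/
def tau : Vec ≃ₗ[ℂ] Vec :=
  LinearEquiv.piCongrRight fun i : ZMod 8 =>
    LinearEquiv.smulOfNeZero ℂ ℂ (xi⁻¹ ^ i.val)
      (pow_ne_zero _ (inv_ne_zero (Complex.exp_ne_zero _)))

lemma sigma_apply (v : Vec) (i : ZMod 8) : sigma v i = v (i - 1) := rfl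

lemma tau_apply (v : Vec) (i : ZMod 8) : tau v i = xi⁻¹ ^ i.val * v i := rfl

/-- The Heisenberg group `H_8`, in its Schrödinger representation. -/
def H8 : Subgroup (Vec ≃ₗ[ℂ] Vec) := Subgroup.closure {sigma, tau}

/-- The subgroup `H'` of `H_8` generated by `σ^4` and `τ^4`. -/
def Hprime : Subgroup (Vec ≃ₗ[ℂ] Vec) := Subgroup.closure {sigma ^ 4, tau ^ 4}

/-- The orbit of a point of `P^7` under `H_8`. -/
def orbit (y : ℙ ℂ Vec) : Set (ℙ ℂ Vec) := MulAction.orbit H8 y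

/-- The plane `P^2_-`, the projectivised `(-1)`-eigenspace of the involution `x_i ↦ x_{-i}`. -/
def P2minus : Set (ℙ ℂ Vec) := {p | ∀ v ∈ p.submodule, ∀ i, v (-i) = -v i}

/-- The `H'`-invariant quadrics that vanish on the `H_8`-orbit of `y`. -/
def orbitQuadrics (y : ℙ ℂ Vec) : Set Ring8 :=
  {f | f ∈ deg 2 ∧ (∀ g ∈ Hprime, ∀ v, eval (g v) f = eval v f) ∧
    ∀ p ∈ orbit y, f ∈ pointIdeal p}

/-- The homogeneous ideal generated by the `H'`-invariant quadrics that vanish on the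
`H_8`-orbit of `y`. -/
def idealV8 (y : ℙ ℂ Vec) : HomogeneousIdeal deg :=
  ⟨Ideal.span (orbitQuadrics y), Ideal.homogeneous_span deg _ fun _ hf => ⟨2, hf.1⟩⟩

/-- The scheme `V_{8,y}` in `P^7` defined by the `H'`-invariant quadrics vanishing on the
`H_8`-orbit of `y`. -/
abbrev V8 (y : ℙ ℂ Vec) : Scheme := subscheme (idealV8 y)

end HeisenbergEight

end

/-! ### Regular quotients of regular local rings -/

section RegularQuotient

open IsLocalRing

/-! Equations. The action of `τ` splits a quadratic form into pieces supported on the monomials `x_i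
x_j` with `i + j` fixed. Invariance under `τ⁴` kills the odd sums, and invariance under `σ⁴` makes
the coefficient of `x_{t+d} x_{t-d}` depend only on `d` modulo 4, so the piece of weight `2t` has
the shape `qf A B C t`. Vanishing on the orbit means, after separating weights, that `qf A B C s`
vanishes at `y` for every `s`; when `y₁ y₃ ≠ 0` this fixes the ratio `A : B : C`. Hence the ideal is
generated by four quadrics `f_0, …, f_3`, which the Heisenberg group permutes up to scalars
(`toIdeal_idealV8`).

Blocks. Put `m = (y₁ + y₃)/2`, `n = (y₁ - y₃)/2`, `k = y₂`, and use the coordinates `U_i = x_i +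
x_{i+4}`, `V_i = x_i - x_{i+4}`. Every linear combination of `f_0 ± f_2`, `f_1 ± f_3` is then a sum
of four binary forms, in `(U_0, U_2)`, `(U_1, U_3)`, `(V_0, V_2)` and `(V_1, V_3)`.

Singular points. Where the gradients are dependent, some member of the system has all four blocks
killing the components of the point. If no component vanishes, all four blocks are degenerate; their
determinants are linear in the squares of the coefficients and cannot all vanish for general `y`. So
some component is zero. A translation makes it `(U_0, U_2)`, and the equations then leave only
points of the orbit (`IsSing.inOrbit`). This is carried out over the residue field of an arbitrary
prime, so non-closed points are covered, and the Jacobian criterion gives regularity off the orbit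
(`Admissible.isRegularLocalRing_or`).

Nodes. A local ring of the scheme is a local ring of affine 8-space modulo the quadrics and `ℓ = 1`,
with `ℓ` a linear form non-zero at the point (`exists_stalk_presentation`). At an orbit point three
quadrics and `ℓ = 1` cut out a four-dimensional ring whose maximal ideal is generated by `U_0, U_2,
U_1 + U_3, V_1 - V_3`, and the last quadric becomes a sum of two binary forms in these with unit
discriminants. In the completion units have square roots, so it is a sum of four squares in a power
series ring (`node_of_coordinates`, `nonempty_adicCompletion_ringEquiv_node`).

Dimension. The four forms `V_i` meet the cone over the scheme only in its vertex, so the dimension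
is at most 3; the local ring at an orbit point, cut from dimension 8 by five equations, gives at
least 3. -/

lemma IsLocalRing.linearIndependent_toCotangent {O ι : Type*} [CommRing O] [IsLocalRing O]
    [Fintype ι] (F : ι → O) (hF : ∀ i, F i ∈ maximalIdeal O)
    (hind : ∀ a : ι → O, ∑ i, a i * F i ∈ maximalIdeal O ^ 2 → ∀ i, a i ∈ maximalIdeal O) :
    LinearIndependent (ResidueField O)
      fun i => ((maximalIdeal O).toCotangent ⟨F i, hF i⟩ : CotangentSpace O) := by
  rw [Fintype.linearIndependent_iff]
  intro g hg i
  choose a ha using fun i => residue_surjective (R := O) (g i)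
  have h1 : (maximalIdeal O).toCotangent (∑ i, a i • ⟨F i, hF i⟩) = 0 := by
    rw [map_sum, ← hg]
    refine Finset.sum_congr rfl fun i _ => ?_
    rw [map_smul, ← ha i]
    exact (algebraMap_smul (ResidueField O) (a i) _).symm
  rw [Ideal.toCotangent_eq_zero] at h1
  have h2 := hind a (by simpa using h1) i
  rw [← ha i]
  exact (residue_eq_zero_iff _).mpr h2

/-- A quotient of a regular local ring by elements that are linearly independent modulo the square
of the maximal ideal is regular. -/
theorem IsRegularLocalRing.of_surjective_of_independent {O R : Type*} [CommRing O]
    [IsRegularLocalRing O] [CommRing R] (π : O →+* R) (hπ : Function.Surjective π)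
    {r : ℕ} (F : Fin r → O) (hF : ∀ i, F i ∈ maximalIdeal O)
    (hker : RingHom.ker π = Ideal.span (Set.range F))
    (hind : ∀ a : Fin r → O, ∑ i, a i * F i ∈ maximalIdeal O ^ 2 → ∀ i, a i ∈ maximalIdeal O) :
    IsRegularLocalRing R := by
  classical
  have hle : RingHom.ker π ≤ maximalIdeal O := by
    rw [hker, Ideal.span_le]
    rintro _ ⟨i, rfl⟩
    exact hF i
  have hnt : Nontrivial R := by
    refine ⟨⟨0, 1, fun h => ?_⟩⟩
    have h1 : (1 : O) ∈ RingHom.ker π := by rw [RingHom.mem_ker, map_one, h]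
    exact (Ideal.ne_top_iff_one _).mp (IsLocalRing.maximalIdeal.isMaximal O).ne_top (hle h1)
  have hloc : IsLocalRing R := IsLocalRing.of_surjective' π hπ
  have hnoe : IsNoetherianRing R := isNoetherianRing_of_surjective O R π hπ
  let c : Fin r → CotangentSpace O := fun i => (maximalIdeal O).toCotangent ⟨F i, hF i⟩
  have hc : LinearIndependent (ResidueField O) c := linearIndependent_toCotangent F hF hind
  let W : Submodule (ResidueField O) (CotangentSpace O) :=
    Submodule.span (ResidueField O) (Set.range c)
  let b := Module.finBasis (ResidueField O) (CotangentSpace O ⧸ W)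
  have hcard : r + Module.finrank (ResidueField O) (CotangentSpace O ⧸ W) =
      (maximalIdeal O).spanFinrank := by
    rw [spanFinrank_maximalIdeal_eq_finrank_cotangentSpace, ← W.finrank_quotient_add_finrank,
      finrank_span_eq_card hc, Fintype.card_fin, add_comm]
  choose v hv using fun j => W.mkQ_surjective (b j)
  choose e he using fun j => (maximalIdeal O).toCotangent_surjective (v j)
  have hspan : Ideal.span (Set.range F ∪ Set.range fun j => (e j : O)) = maximalIdeal O := by
    have h1 : Submodule.span O (Set.range (fun i => (⟨F i, hF i⟩ : maximalIdeal O)) ∪ Set.range e)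
        = ⊤ := by
      rw [← CotangentSpace.span_image_eq_top_iff, Set.image_union, Submodule.span_union,
        ← Set.range_comp, ← Set.range_comp]
      have h2 : (Submodule.span (ResidueField O) (Set.range v)).map W.mkQ = ⊤ := by
        rw [Submodule.map_span, ← Set.range_comp, ← b.span_eq]
        congr 2
        funext j
        exact hv j
      have h3 := congrArg (Submodule.comap W.mkQ) h2
      rw [Submodule.comap_map_eq, Submodule.ker_mkQ, Submodule.comap_top, sup_comm] at h3
      have h4 : ((maximalIdeal O).toCotangent ∘ e) = v := funext he
      rw [h4]
      exact h3
    have h2 := congrArg (Submodule.map (maximalIdeal O).subtype) h1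
    rw [Submodule.map_span, Submodule.map_top, Submodule.range_subtype, Set.image_union,
      ← Set.range_comp, ← Set.range_comp] at h2
    exact h2
  have hmax : maximalIdeal R = Ideal.span (Set.range fun j => π (e j)) := by
    have h1 : (maximalIdeal O).map π = maximalIdeal R :=
      IsLocalRing.eq_maximalIdeal (Ideal.IsMaximal.map_of_surjective_of_ker_le hπ hle)
    refine h1.symm.trans ((congrArg (Ideal.map π) hspan.symm).trans ?_)
    rw [Ideal.map_span, Set.image_union, Ideal.span_union, ← Set.range_comp, ← Set.range_comp]
    refine sup_eq_right.mpr ?_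
    rw [Ideal.span_le]
    rintro _ ⟨i, rfl⟩
    have : F i ∈ RingHom.ker π := hker ▸ Ideal.subset_span ⟨i, rfl⟩
    rw [RingHom.mem_ker] at this
    simp [this]
  have h1 : (maximalIdeal R).spanFinrank ≤ Module.finrank (ResidueField O) (CotangentSpace O ⧸ W) := by
    rw [hmax]
    refine (Submodule.spanFinrank_span_le_ncard_of_finite (Set.finite_range _)).trans ?_
    rw [← Set.image_univ]
    refine (Set.ncard_image_le Set.finite_univ).trans ?_
    rw [Set.ncard_univ, Nat.card_eq_fintype_card, Fintype.card_fin]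
  -- Dividing by `r` elements lowers the dimension by at most `r`, while the number of generators of
  -- the maximal ideal has dropped by exactly that many; the two bounds meet.
  have h2 : ringKrullDim O ≤ ringKrullDim R + r := by
    rw [← ringKrullDim_eq_of_ringEquiv (RingHom.quotientKerEquivOfSurjective hπ), hker]
    have := ringKrullDim_le_ringKrullDim_quotient_add_card (Finset.univ.image F) (by
      rw [IsLocalRing.ringJacobson_eq_maximalIdeal]
      simpa [Set.range_subset_iff] using hF)
    rw [Finset.coe_image, Finset.coe_univ, Set.image_univ] at this
    refine this.trans (add_le_add le_rfl ?_)
    have h3 := Finset.card_image_le (s := Finset.univ) (f := F)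
    rw [Finset.card_univ, Fintype.card_fin] at h3
    exact_mod_cast h3
  refine IsRegularLocalRing.of_spanFinrank_maximalIdeal_le R ?_
  rw [← IsRegularLocalRing.spanFinrank_maximalIdeal, ← hcard] at h2
  obtain ⟨d, hd⟩ : ∃ d : ℕ, ringKrullDim R = d := by
    obtain ⟨d, hd⟩ := WithBot.ne_bot_iff_exists.mp (ringKrullDim_ne_bot (R := R))
    have hd' : d ≠ ⊤ := by
      rintro rfl
      exact ringKrullDim_ne_top (R := R) hd.symm
    obtain ⟨d, rfl⟩ := ENat.ne_top_iff_exists.mp hd'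
    exact ⟨d, hd.symm⟩
  rw [hd] at h2 ⊢
  have h3 : r + Module.finrank (ResidueField O) (CotangentSpace O ⧸ W) ≤ d + r := by exact_mod_cast h2
  have h4 : (maximalIdeal R).spanFinrank ≤ d := by omega
  exact_mod_cast h4

end RegularQuotient

/-! ### The Jacobian criterion at a prime of a polynomial ring -/

section Jacobian

open IsLocalRing MvPolynomial

variable {σ k : Type*} [Field k]

lemma MvPolynomial.pderiv_mem_of_mem_sq (P : Ideal (MvPolynomial σ k)) (j : σ)
    {f : MvPolynomial σ k} (hf : f ∈ P ^ 2) : pderiv j f ∈ P := by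
  rw [pow_two] at hf
  refine Submodule.mul_induction_on hf (fun a ha b hb => ?_) fun a b ha hb => ?_
  · rw [Derivation.leibniz]
    exact P.add_mem (P.mul_mem_right _ ha) (P.mul_mem_right _ hb)
  · rw [map_add]
    exact P.add_mem ha hb

/-- The Jacobian criterion: polynomials in a prime `P` whose gradients are linearly independent
modulo `P` are linearly independent in the cotangent space of the localization at `P`. -/
lemma MvPolynomial.independent_of_jacobian (P : Ideal (MvPolynomial σ k)) [P.IsPrime] {ι : Type*} [Fintype ι]
    (F : ι → MvPolynomial σ k)
    (hJ : ∀ b : ι → MvPolynomial σ k, (∀ j, ∑ i, b i * pderiv j (F i) ∈ P) → ∀ i, b i ∈ P)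
    (hF : ∀ i, F i ∈ P) (a : ι → Localization.AtPrime P)
    (ha : ∑ i, a i * algebraMap _ (Localization.AtPrime P) (F i) ∈
      maximalIdeal (Localization.AtPrime P) ^ 2) (i : ι) :
    a i ∈ maximalIdeal (Localization.AtPrime P) := by
  -- Denominators are cleared twice, by `s` for the coefficients and by `t` for membership in `P ^
  -- 2`, so that derivatives can be taken in the polynomial ring.
  obtain ⟨s, hs⟩ := IsLocalization.exist_integer_multiples_of_finite P.primeCompl a
  choose b hb using hs
  have h1 : algebraMap _ (Localization.AtPrime P) (∑ i, b i * F i) ∈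
      (P ^ 2).map (algebraMap _ (Localization.AtPrime P)) := by
    rw [Ideal.map_pow, Localization.AtPrime.map_eq_maximalIdeal, map_sum]
    have h2 : ∑ i, algebraMap _ (Localization.AtPrime P) (b i * F i) =
        (s : MvPolynomial σ k) • ∑ i, a i * algebraMap _ (Localization.AtPrime P) (F i) := by
      rw [Finset.smul_sum]
      refine Finset.sum_congr rfl fun i _ => ?_
      rw [map_mul, hb i, smul_mul_assoc]
    rw [h2, Algebra.smul_def]
    exact Ideal.mul_mem_left _ _ ha
  rw [IsLocalization.mem_map_algebraMap_iff P.primeCompl] at h1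
  obtain ⟨⟨x, t⟩, hx⟩ := h1
  rw [← map_mul] at hx
  have h3 := IsLocalization.injective (Localization.AtPrime P) P.primeCompl_le_nonZeroDivisors hx
  have h4 : ∀ i, (t : MvPolynomial σ k) * b i ∈ P := by
    refine hJ _ fun j => ?_
    -- Derivatives of elements of `P ^ 2` lie in `P`. In the Leibniz rule the terms containing `F i`
    -- itself are in `P`, leaving a relation among the gradients.
    have h5 : pderiv j (∑ i, (t : MvPolynomial σ k) * b i * F i) ∈ P := by
      refine pderiv_mem_of_mem_sq P j ?_
      have : ∑ i, (t : MvPolynomial σ k) * b i * F i = x := by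
        rw [← h3, mul_comm, Finset.mul_sum]
        simp only [mul_assoc]
      rw [this]
      exact x.2
    rw [map_sum] at h5
    have h6 : ∀ i, pderiv j ((t : MvPolynomial σ k) * b i * F i) =
        (t : MvPolynomial σ k) * b i * pderiv j (F i) +
          F i * pderiv j ((t : MvPolynomial σ k) * b i) := fun i => by
      rw [Derivation.leibniz]
      rfl
    simp only [h6, Finset.sum_add_distrib] at h5
    exact (P.add_mem_iff_left (P.sum_mem fun i _ => P.mul_mem_right _ (hF i))).mp h5
  have h7 : b i ∈ P := ((inferInstance : P.IsPrime).mem_or_mem (h4 i)).resolve_left t.2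
  have h8 : algebraMap _ (Localization.AtPrime P) (b i) ∈ maximalIdeal (Localization.AtPrime P) := by
    rw [← Localization.AtPrime.map_eq_maximalIdeal]
    exact Ideal.mem_map_of_mem _ h7
  rw [hb i, Algebra.smul_def] at h8
  exact ((maximalIdeal.isMaximal _).isPrime.mem_or_mem h8).resolve_left fun h =>
    (mem_maximalIdeal _).mp h (IsLocalization.map_units _ s)

/-- The localization is regular, so its dimension is that of its cotangent space, and the elements
`X i - w i` are independent there because their Jacobian matrix is the identity. -/
lemma MvPolynomial.card_le_ringKrullDim_localization [Fintype σ] (w : σ → k)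
    (P : Ideal (MvPolynomial σ k)) [P.IsPrime] (hP : P = RingHom.ker (eval w)) :
    (Fintype.card σ : WithBot ℕ∞) ≤ ringKrullDim (Localization.AtPrime P) := by
  classical
  let F : σ → MvPolynomial σ k := fun i => X i - C (w i)
  have hF : ∀ i, F i ∈ P := fun i => by simp [hP, F, RingHom.mem_ker]
  have hF' : ∀ i, algebraMap _ (Localization.AtPrime P) (F i) ∈
      maximalIdeal (Localization.AtPrime P) := fun i => by
    rw [← Localization.AtPrime.map_eq_maximalIdeal]
    exact Ideal.mem_map_of_mem _ (hF i)
  have h1 := linearIndependent_toCotangent _ hF' fun a ha =>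
    independent_of_jacobian P F (fun b hb i => ?_) hF a ha
  · rw [← IsRegularLocalRing.spanFinrank_maximalIdeal,
      spanFinrank_maximalIdeal_eq_finrank_cotangentSpace]
    exact_mod_cast h1.fintype_card_le_finrank
  · simpa [F, pderiv_X, Pi.single_apply] using hb i

end Jacobian

/-! ### Completions and power series rings -/

section PowerSeriesParametrization

open IsLocalRing

/-- Evaluation of power series at elements of an ideal for which the target ring is complete. -/
lemma MvPowerSeries.exists_ringHom_of_isAdicComplete {σ k A : Type*} [Finite σ] [CommRing k]
    [CommRing A] [Algebra k A] (J : Ideal A) [IsAdicComplete J A] (z : σ → A) (hz : ∀ i, z i ∈ J) :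
    ∃ Φ : MvPowerSeries σ k →+* A, (∀ i, Φ (X i) = z i) ∧ ∀ a, Φ (C a) = algebraMap k A a := by
  have hle : ∀ n, MvPolynomial.idealOfVars σ k ^ n ≤
      (J ^ n).comap (MvPolynomial.aeval z : MvPolynomial σ k →ₐ[k] A).toRingHom := by
    intro n
    have h1 : MvPolynomial.idealOfVars σ k ≤
        J.comap (MvPolynomial.aeval z : MvPolynomial σ k →ₐ[k] A).toRingHom := by
      rw [MvPolynomial.idealOfVars, Ideal.span_le]
      rintro _ ⟨i, rfl⟩
      simpa using hz i
    exact (Ideal.pow_right_mono h1 n).trans (Ideal.le_comap_pow _ n)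
  -- At level `n` a series is truncated and evaluated. The levels agree because two truncations
  -- differ by an element of a power of the ideal of variables, which lands in the corresponding
  -- power of `J`.
  let f : (n : ℕ) → MvPowerSeries σ k →+* A ⧸ J ^ n := fun n =>
    (Ideal.quotientMap (J ^ n) _ (hle n)).comp (truncTotalAlgHom σ k n).toRingHom
  have hf : ∀ {m n : ℕ} (h : m ≤ n), (Ideal.Quotient.factorPow J h).comp (f n) = f m := by
    intro m n h
    ext p
    simp only [f, RingHom.comp_apply]
    change Ideal.Quotient.mk (J ^ m) (MvPolynomial.aeval z (truncTotal n p)) =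
      Ideal.Quotient.mk (J ^ m) (MvPolynomial.aeval z (truncTotal m p))
    rw [Ideal.Quotient.eq, ← map_sub]
    exact hle m (truncTotal_sub_truncTotal_mem_pow_idealOfVars h le_rfl p)
  have hpoly : ∀ p : MvPolynomial σ k, IsAdicComplete.liftRingHom J f hf (p : MvPowerSeries σ k) =
      MvPolynomial.aeval z p := by
    intro p
    refine (IsHausdorff.eq_iff_smodEq (I := J)).mpr fun n => ?_
    rw [SModEq.sub_mem]
    have h1 := IsAdicComplete.mk_liftRingHom J f hf n (p : MvPowerSeries σ k)
    have h2 : f n p = Ideal.Quotient.mk (J ^ n) (MvPolynomial.aeval z p) := by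
      have h3 : truncTotalAlgHom σ k n (p : MvPowerSeries σ k) = Ideal.Quotient.mk _ p :=
        (truncTotalAlgHom σ k n).commutes p
      change Ideal.quotientMap (J ^ n) _ (hle n) (truncTotalAlgHom σ k n (p : MvPowerSeries σ k)) = _
      rw [h3]
      rfl
    rw [h2, Ideal.Quotient.eq] at h1
    simpa using h1
  refine ⟨IsAdicComplete.liftRingHom J f hf, fun i => ?_, fun a => ?_⟩
  · rw [← MvPolynomial.coe_X, hpoly, MvPolynomial.aeval_X]
  · rw [← MvPolynomial.coe_C, hpoly, MvPolynomial.aeval_C]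

/-- Power series form the completion of the polynomial ring at the ideal of variables. This ideal is
finitely generated, so its extension is the kernel of reduction modulo it; a series without constant
term lies in that kernel. -/
lemma MvPowerSeries.maximalIdeal_eq_span_X (σ k : Type*) [Finite σ] [Field k] :
    maximalIdeal (MvPowerSeries σ k) = Ideal.span (Set.range X) := by
  refine le_antisymm (fun f hf => ?_) ?_
  · have h0 : constantCoeff f = 0 := by
      by_contra h
      exact (mem_maximalIdeal _).mp hf (MvPowerSeries.isUnit_iff_constantCoeff.mpr
        (isUnit_iff_ne_zero.mpr h))
    let e := (toAdicCompletionAlgEquiv σ k).toRingEquiv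
    have h1 : Ideal.map e (Ideal.span (Set.range X)) =
        (MvPolynomial.idealOfVars σ k).map (algebraMap _ _) := by
      simp_rw [Ideal.map_span, ← Set.range_comp]
      congr 2
      ext1
      simp [e, AdicCompletion.algebraMap_apply, ← MvPolynomial.coe_X, toAdicCompletion_coe]
    have htr : ∀ {m n : ℕ} (hle : m ≤ n), (Ideal.Quotient.factorPow
        (MvPolynomial.idealOfVars σ k) hle).comp (truncTotalAlgHom σ k n).toRingHom =
          (truncTotalAlgHom σ k m).toRingHom := by
      intro m n hle
      ext p
      exact Ideal.Quotient.eq.mpr (truncTotal_sub_truncTotal_mem_pow_idealOfVars hle le_rfl p)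
    have h2 : truncTotal 1 f = 0 := by
      ext d
      rcases Nat.eq_zero_or_pos d.degree with hd | hd
      · rw [coeff_truncTotal _ (by omega), (Finsupp.degree_eq_zero_iff d).mp hd]
        simpa using h0
      · rw [coeff_truncTotal_eq_zero _ (by omega)]
        simp
    have h3 : e f ∈ (MvPolynomial.idealOfVars σ k).map
        (algebraMap _ (AdicCompletion (MvPolynomial.idealOfVars σ k) (MvPolynomial σ k))) := by
      rw [← AdicCompletion.ker_evalOneₐ_eq_map _ (MvPolynomial.idealOfVars_fg σ k)]
      have h4 : AdicCompletion.evalₐ (MvPolynomial.idealOfVars σ k) 1 (e f) = 0 := by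
        have h5 : AdicCompletion.evalₐ (MvPolynomial.idealOfVars σ k) 1 (e f) =
            Ideal.Quotient.mk _ (truncTotal 1 f) := by
          simp only [e, toAdicCompletion, AdicCompletion.liftAlgHom,
            AlgEquiv.coe_ringEquiv, toAdicCompletionAlgEquiv_apply]
          exact AdicCompletion.evalₐ_liftRingHom _ _ htr 1 f
        rw [h5, h2, map_zero]
      change AdicCompletion.evalOneₐ _ (e f) = 0
      rw [← AdicCompletion.factorₐ_evalₐ_one, h4, map_zero]
    rw [← h1, Ideal.mem_map_of_equiv] at h3
    obtain ⟨x, hx, hxf⟩ := h3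
    rwa [← e.injective hxf]
  · rw [Ideal.span_le]
    rintro _ ⟨i, rfl⟩
    rw [SetLike.mem_coe, mem_maximalIdeal, mem_nonunits_iff, MvPowerSeries.isUnit_iff_constantCoeff]
    simp

/-- Going-down holds for the completion, so the height of its maximal ideal is the height of the
maximal ideal of `T` plus a fibre term, which is dropped. -/
lemma IsLocalRing.ringKrullDim_le_adicCompletion (T : Type*) [CommRing T] [IsLocalRing T] [IsNoetherianRing T]
    [IsNoetherianRing (AdicCompletion (maximalIdeal T) T)] :
    ringKrullDim T ≤ ringKrullDim (AdicCompletion (maximalIdeal T) T) := by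
  rw [← maximalIdeal_height_eq_ringKrullDim, ← maximalIdeal_height_eq_ringKrullDim]
  have : (maximalIdeal (AdicCompletion (maximalIdeal T) T)).LiesOver (maximalIdeal T) := by
    refine ⟨?_⟩
    exact (IsLocalRing.maximalIdeal_comap _).symm
  rw [Ideal.height_eq_height_add_of_liesOver_of_hasGoingDown (maximalIdeal T)
    (maximalIdeal (AdicCompletion (maximalIdeal T) T))]
  exact_mod_cast le_self_add

/-- A Noetherian local ring of dimension at least `n` whose completion has `n` generators of its
maximal ideal has a power series ring as its completion. -/
lemma IsLocalRing.exists_bijective_mvPowerSeries {k T : Type*} [Field k] [CommRing T]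
    [IsLocalRing T] [IsNoetherianRing T] [Algebra k T] {n : ℕ} (hdim : n ≤ ringKrullDim T)
    (hres : Function.Surjective (algebraMap k (ResidueField T)))
    (z : Fin n → AdicCompletion (maximalIdeal T) T)
    (hz : maximalIdeal (AdicCompletion (maximalIdeal T) T) = Ideal.span (Set.range z)) :
    ∃ Φ : MvPowerSeries (Fin n) k →+* AdicCompletion (maximalIdeal T) T,
      Function.Bijective Φ ∧ (∀ i, Φ (MvPowerSeries.X i) = z i) := by
  let That := AdicCompletion (maximalIdeal T) T
  obtain ⟨Φ, hX, hC⟩ := MvPowerSeries.exists_ringHom_of_isAdicComplete (k := k)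
    (maximalIdeal That) z fun i => hz ▸ Ideal.subset_span ⟨i, rfl⟩
  have hmap : (Ideal.span (Set.range (MvPowerSeries.X : Fin n → MvPowerSeries (Fin n) k))).map Φ =
      maximalIdeal That := by
    rw [Ideal.map_span, ← Set.range_comp, hz]
    congr 2
    funext i
    exact hX i
  -- The source is complete and the target separated, so surjectivity may be tested modulo the
  -- maximal ideal, where constants suffice by `hres`.
  have hsurj : Function.Surjective Φ := by
    have : IsHausdorff ((Ideal.span (Set.range
        (MvPowerSeries.X : Fin n → MvPowerSeries (Fin n) k))).map Φ) That := by
      rw [hmap]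
      infer_instance
    refine surjective_of_mk_map_comp_surjective Φ
      (I := Ideal.span (Set.range (MvPowerSeries.X : Fin n → MvPowerSeries (Fin n) k))) fun x => ?_
    obtain ⟨x, rfl⟩ := Ideal.Quotient.mk_surjective x
    obtain ⟨r, hr⟩ := (AdicCompletion.residueField_map_bijective (R := T)).2 (residue _ x)
    obtain ⟨a, rfl⟩ := hres r
    refine ⟨MvPowerSeries.C a, ?_⟩
    rw [RingHom.comp_apply, hC, Ideal.Quotient.eq, hmap, ← residue_eq_zero_iff, map_sub, ← hr,
      sub_eq_zero]
    rfl
  refine ⟨Φ, ⟨?_, hsurj⟩, hX⟩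
  have hnoe : IsNoetherianRing That := isNoetherianRing_of_surjective _ _ Φ hsurj
  rw [injective_iff_map_eq_zero]
  intro f hf
  by_contra hne
  -- A non-zero element of the kernel is a non-zero-divisor and would make the dimension of the
  -- completion smaller than `n`, whereas `T` already has dimension at least `n`.
  have h1 := ringKrullDim_succ_le_of_surjective Φ hsurj (mem_nonZeroDivisors_of_ne_zero hne) hf
  have h2 : ringKrullDim (MvPowerSeries (Fin n) k) ≤ n := by
    refine (ringKrullDim_le_spanFinrank_maximalIdeal _).trans ?_
    rw [MvPowerSeries.maximalIdeal_eq_span_X]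
    have h3 := Submodule.spanFinrank_span_le_ncard_of_finite
      (R := MvPowerSeries (Fin n) k)
      (Set.finite_range (MvPowerSeries.X : Fin n → MvPowerSeries (Fin n) k))
    have h4 := Set.ncard_image_le (Set.finite_univ (α := Fin n))
      (f := (MvPowerSeries.X : Fin n → MvPowerSeries (Fin n) k))
    rw [Set.image_univ, Set.ncard_univ, Nat.card_eq_fintype_card, Fintype.card_fin] at h4
    exact_mod_cast h3.trans h4
  have h5 : ringKrullDim That + 1 ≤ ringKrullDim That :=
    (h1.trans h2).trans (hdim.trans (IsLocalRing.ringKrullDim_le_adicCompletion T))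
  obtain ⟨d, hd⟩ := WithBot.ne_bot_iff_exists.mp (ringKrullDim_ne_bot (R := That))
  have hd' : d ≠ ⊤ := by
    rintro rfl
    exact ringKrullDim_ne_top (R := That) hd.symm
  obtain ⟨d, rfl⟩ := ENat.ne_top_iff_exists.mp hd'
  rw [← hd] at h5
  have : d + 1 ≤ d := by exact_mod_cast h5
  omega

/-- The completion of a hypersurface in a ring whose completion is a power series ring. -/
lemma IsLocalRing.nonempty_adicCompletion_ringEquiv_quotient {B T R : Type*} [CommRing B] [IsLocalRing B]
    [IsNoetherianRing B] [IsAdicComplete (maximalIdeal B) B] [CommRing T] [IsLocalRing T]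
    [IsNoetherianRing T] [CommRing R] [IsLocalRing R] [IsNoetherianRing R] (π : T →+* R)
    (hπ : Function.Surjective π) (g : T) (hker : RingHom.ker π = Ideal.span {g})
    (Φ : B →+* AdicCompletion (maximalIdeal T) T) (hΦ : Function.Bijective Φ) (G : B)
    (hG : Φ G = algebraMap T _ g) :
    Nonempty (AdicCompletion (maximalIdeal R) R ≃+* (B ⧸ Ideal.span {G})) := by
  have hker_le : RingHom.ker π ≤ maximalIdeal T := IsLocalRing.le_maximalIdeal
    (RingHom.ker_ne_top π)
  have hmπ : (maximalIdeal T).map π = maximalIdeal R :=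
    IsLocalRing.eq_maximalIdeal (Ideal.IsMaximal.map_of_surjective_of_ker_le hπ hker_le)
  have hmΦ : (maximalIdeal B).map Φ = maximalIdeal (AdicCompletion (maximalIdeal T) T) :=
    map_ringEquiv_maximalIdeal (RingEquiv.ofBijective Φ hΦ)
  have hle : ∀ n, maximalIdeal T ^ n ≤ (maximalIdeal R ^ n).comap π := fun n => by
    rw [← Ideal.map_le_iff_le_comap, Ideal.map_pow, hmπ]
  let f : (n : ℕ) → AdicCompletion (maximalIdeal T) T →+* R ⧸ maximalIdeal R ^ n := fun n =>
    (Ideal.quotientMap _ π (hle n)).comp (AdicCompletion.evalₐ (maximalIdeal T) n).toRingHom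
  -- An element of the completion agrees with an element of `T` to order `n`; every later
  -- computation with `f` is reduced to such approximations.
  have hval : ∀ (n : ℕ) (x : AdicCompletion (maximalIdeal T) T), ∃ t : T,
      AdicCompletion.evalₐ (maximalIdeal T) n x = Ideal.Quotient.mk _ t ∧
        ∀ m ≤ n, f m x = Ideal.Quotient.mk _ (π t) := by
    intro n x
    induction x using AdicCompletion.induction_on with
    | h a =>
      refine ⟨a.val n, AdicCompletion.evalₐ_mk _ _ _, fun m hm => ?_⟩
      have h1 : AdicCompletion.evalₐ (maximalIdeal T) m (AdicCompletion.mk _ _ a) =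
          Ideal.Quotient.mk _ (a.val n) := by
        rw [AdicCompletion.evalₐ_mk, Ideal.Quotient.eq]
        have h2 := a.property hm
        rw [SModEq.sub_mem] at h2
        simpa using h2
      change Ideal.quotientMap _ π (hle m)
        (AdicCompletion.evalₐ (maximalIdeal T) m (AdicCompletion.mk _ _ a)) = _
      rw [h1]
      rfl
  have hf : ∀ {m n : ℕ} (h : m ≤ n),
      (Ideal.Quotient.factorPow (maximalIdeal R) h).comp (f n) = f m := by
    intro m n h
    ext x
    obtain ⟨t, -, ht⟩ := hval n x
    rw [RingHom.comp_apply, ht n le_rfl, ht m h]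
    rfl
  let ρ : AdicCompletion (maximalIdeal T) T →+* AdicCompletion (maximalIdeal R) R :=
    AdicCompletion.liftRingHom (maximalIdeal R) f hf
  have hρ : ∀ t : T, ρ (algebraMap T _ t) = algebraMap R _ (π t) := by
    intro t
    refine AdicCompletion.ext_evalₐ fun n => ?_
    rw [AdicCompletion.evalₐ_liftRingHom]
    rfl
  let Ψ := ρ.comp Φ
  have hmΨ : (maximalIdeal B).map Ψ = maximalIdeal (AdicCompletion (maximalIdeal R) R) := by
    rw [← Ideal.map_map, hmΦ, AdicCompletion.maximalIdeal_eq_map,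
      AdicCompletion.maximalIdeal_eq_map, Ideal.map_map]
    refine Eq.trans ?_ (congrArg (Ideal.map (algebraMap R _)) hmπ)
    rw [Ideal.map_map]
    exact congrArg (fun h => Ideal.map h (maximalIdeal T)) (RingHom.ext hρ)
  have hsurj : Function.Surjective Ψ := by
    have : IsHausdorff ((maximalIdeal B).map Ψ) (AdicCompletion (maximalIdeal R) R) := by
      rw [hmΨ]
      infer_instance
    refine surjective_of_mk_map_comp_surjective Ψ (I := maximalIdeal B) fun x => ?_
    obtain ⟨x, rfl⟩ := Ideal.Quotient.mk_surjective x
    obtain ⟨r, hr⟩ := (AdicCompletion.residueField_map_bijective (R := R)).2 (residue _ x)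
    obtain ⟨r, rfl⟩ := residue_surjective r
    obtain ⟨t, rfl⟩ := hπ r
    obtain ⟨b, hb⟩ := hΦ.2 (algebraMap T _ t)
    refine ⟨b, ?_⟩
    rw [RingHom.comp_apply, Ideal.Quotient.eq, hmΨ, ← residue_eq_zero_iff, map_sub, ← hr,
      sub_eq_zero, RingHom.comp_apply, hb, hρ]
    rfl
  have hkerΨ : RingHom.ker Ψ = Ideal.span {G} := by
    refine le_antisymm (fun b hb => ?_) ?_
    -- Approximation puts a kernel element in `(G) + 𝔪 ^ n` for every `n`. Since `B ⧸ (G)` is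
    -- separated, it lies in `(G)`.
    · have h1 : ∀ n, b ∈ Ideal.span {G} ⊔ maximalIdeal B ^ n := by
        intro n
        obtain ⟨t, ht, htn⟩ := hval n (Φ b)
        have h2 : f n (Φ b) = 0 := by
          rw [← AdicCompletion.evalₐ_liftRingHom (maximalIdeal R) f hf]
          change AdicCompletion.evalₐ _ n (Ψ b) = 0
          rw [(RingHom.mem_ker).mp hb, map_zero]
        rw [htn n le_rfl, Ideal.Quotient.eq_zero_iff_mem, ← hmπ, ← Ideal.map_pow,
          Ideal.mem_map_iff_of_surjective π hπ] at h2
        obtain ⟨t', ht', htt⟩ := h2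
        have h3 : t - t' ∈ Ideal.span {g} := by
          rw [← hker, RingHom.mem_ker, map_sub, htt, sub_self]
        obtain ⟨c, hc⟩ := Ideal.mem_span_singleton'.mp h3
        obtain ⟨c', hc'⟩ := hΦ.2 (algebraMap T _ c)
        have h4 : Φ (b - c' * G) ∈ maximalIdeal (AdicCompletion (maximalIdeal T) T) ^ n := by
          rw [AdicCompletion.maximalIdeal_eq_map, ← Ideal.map_pow]
          have h5 : Φ (b - c' * G) - algebraMap T _ t' ∈
              (maximalIdeal T ^ n).map (algebraMap T (AdicCompletion (maximalIdeal T) T)) := by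
            have h6 : Φ (b - c' * G) - algebraMap T _ t' ∈
                (AdicCompletion.eval (maximalIdeal T) T n).ker := by
              rw [LinearMap.mem_ker, ← AdicCompletion.factor_evalₐ_eq_eval _ _
                (le_of_eq (Ideal.mul_top _).symm)]
              have : AdicCompletion.evalₐ (maximalIdeal T) n
                  (Φ (b - c' * G) - algebraMap T _ t') = 0 := by
                rw [map_sub, map_sub, map_mul, hG, hc', ← map_mul, hc, map_sub, map_sub, map_sub, ht,
                  AdicCompletion.algebraMap_apply, AdicCompletion.algebraMap_apply,
                  AdicCompletion.evalₐ_of, AdicCompletion.evalₐ_of]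
                simp
              rw [this, map_zero]
            rw [← AdicCompletion.pow_smul_top_eq_ker_eval
              (maximalIdeal T).fg_of_isNoetherianRing, Ideal.smul_top_eq_map] at h6
            exact h6
          have h7 := Ideal.add_mem _ h5 (Ideal.mem_map_of_mem _ ht')
          simpa using h7
        rw [← hmΦ, ← Ideal.map_pow] at h4
        obtain ⟨x, hx, hxe⟩ := (Ideal.mem_map_iff_of_surjective Φ hΦ.2).mp h4
        rw [hΦ.1 hxe] at hx
        have h8 := Ideal.add_mem _ (Ideal.mem_sup_right (S := Ideal.span {G}) hx)
          (Ideal.mem_sup_left (Ideal.mul_mem_left _ c' (Ideal.mem_span_singleton_self G)))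
        simpa using h8
      have hH : IsHausdorff (maximalIdeal B) (B ⧸ Ideal.span {G}) := inferInstance
      rw [← Ideal.Quotient.eq_zero_iff_mem]
      refine hH.haus _ fun n => ?_
      rw [SModEq.zero]
      obtain ⟨x, hx, y, hy, hxy⟩ := Submodule.mem_sup.mp (h1 n)
      have h9 : Ideal.Quotient.mk (Ideal.span {G}) b = y • (1 : B ⧸ Ideal.span {G}) := by
        rw [← hxy, map_add, Ideal.Quotient.eq_zero_iff_mem.mpr hx, zero_add, Algebra.smul_def,
          mul_one]
        rfl
      rw [h9]
      exact Submodule.smul_mem_smul hy trivial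
    · rw [Ideal.span_singleton_le_iff_mem, RingHom.mem_ker, RingHom.comp_apply, hG, hρ]
      have : g ∈ RingHom.ker π := hker ▸ Ideal.mem_span_singleton_self g
      rw [(RingHom.mem_ker).mp this, map_zero]
  exact ⟨((Ideal.quotEquivOfEq hkerΨ.symm).trans
    (RingHom.quotientKerEquivOfSurjective hsurj)).symm⟩

end PowerSeriesParametrization

/-! ### Recognising an ordinary double point -/

section OrdinaryDoublePoint

open IsLocalRing

/-- In a Henselian local ring whose residue field is covered by an algebraically closed field of
characteristic different from two, every unit is a square. -/
lemma HenselianLocalRing.exists_sq_eq_of_isUnit {k A : Type*} [Field k] [IsAlgClosed k] [CommRing A]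
    [HenselianLocalRing A] [Algebra k A] (h2 : IsUnit (2 : A))
    (hres : Function.Surjective (algebraMap k (ResidueField A))) (a : A) (ha : IsUnit a) :
    ∃ b : A, IsUnit b ∧ b ^ 2 = a := by
  obtain ⟨c, hc⟩ := hres (residue A a)
  obtain ⟨d, rfl⟩ := IsAlgClosed.exists_pow_nat_eq c (n := 2) two_pos
  have hd : a - (algebraMap k A d) ^ 2 ∈ maximalIdeal A := by
    rw [← residue_eq_zero_iff, map_sub, ← hc, ← map_pow, sub_eq_zero]
    rfl
  have hdu : IsUnit (algebraMap k A d) := by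
    by_contra h
    have h1 := Ideal.add_mem _ hd (Ideal.pow_mem_of_mem _ ((mem_maximalIdeal _).mpr h) 2 two_pos)
    rw [sub_add_cancel] at h1
    exact (mem_maximalIdeal _).mp h1 ha
  -- Modulo the maximal ideal `d` is a root of `X ^ 2 - a`, simple because its derivative `2 d` is a
  -- unit.
  obtain ⟨b, hb, hbd⟩ := HenselianLocalRing.is_henselian (Polynomial.X ^ 2 - Polynomial.C a)
    (Polynomial.monic_X_pow_sub_C a two_ne_zero) (algebraMap k A d)
    (by simpa using (neg_mem hd)) (by simpa [one_add_one_eq_two] using And.intro h2 hdu)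
  have hb2 : b ^ 2 = a := by simpa [sub_eq_zero, Polynomial.IsRoot] using hb
  refine ⟨b, ?_, hb2⟩
  rw [← hb2] at ha
  exact (isUnit_pow_iff two_ne_zero).mp ha

/-- Diagonalisation of a nondegenerate binary quadratic form over a ring in which units are
squares. -/
lemma exists_sq_add_sq_of_isUnit {A : Type*} [CommRing A] (h2 : IsUnit (2 : A))
    (hsq : ∀ a : A, IsUnit a → ∃ b : A, IsUnit b ∧ b ^ 2 = a) (E F G p s : A) (hE : IsUnit E)
    (hdisc : IsUnit (4 * E * G - F ^ 2)) :
    ∃ z w : A, E * p ^ 2 + F * p * s + G * s ^ 2 = z ^ 2 + w ^ 2 ∧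
      Ideal.span {z, w} = Ideal.span {p, s} := by
  obtain ⟨i2, hi2⟩ := h2.exists_right_inv
  obtain ⟨iE, hiE⟩ := hE.exists_right_inv
  obtain ⟨e, ⟨e, rfl⟩, he2⟩ := hsq E hE
  have hW : IsUnit (i2 ^ 2 * iE * (4 * E * G - F ^ 2)) := by
    refine IsUnit.mul (IsUnit.mul (IsUnit.pow _ ?_) ?_) hdisc
    · exact .of_mul_eq_one 2 (by rw [mul_comm, hi2])
    · exact .of_mul_eq_one E (by rw [mul_comm, hiE])
  obtain ⟨w, ⟨w, rfl⟩, hw2⟩ := hsq _ hW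
  -- Completing the square: `E (p + F s / (2E))² + (4EG - F²) / (4E) · s²`, with `e² = E` and `w²`
  -- the second coefficient. As `e` and `w` are units, the two linear forms generate the same ideal
  -- as `p, s`.
  refine ⟨e * (p + i2 * iE * F * s), w * s, ?_, ?_⟩
  · rw [mul_pow, mul_pow, he2, hw2]
    linear_combination (-F * p * s - G * s ^ 2 * (2 * i2 + 1) * E * iE ) * hi2 +
      (- F * p * s * (2 * i2) - G * s ^ 2 - F ^ 2 * s ^ 2 * i2 ^ 2 * iE) * hiE
  · apply le_antisymm
    · rw [Ideal.span_le]
      rintro _ (rfl | rfl)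
      · exact Ideal.mem_span_pair.mpr ⟨e, e * (i2 * iE * F), by ring⟩
      · exact Ideal.mem_span_pair.mpr ⟨0, w, by ring⟩
    · rw [Ideal.span_le]
      rintro t (ht | ht)
      · rw [ht]
        refine Ideal.mem_span_pair.mpr ⟨(e⁻¹ : Aˣ), -(i2 * iE * F) * (w⁻¹ : Aˣ), ?_⟩
        linear_combination (p + i2 * iE * F * s) * e.inv_mul - i2 * iE * F * s * w.inv_mul
      · rw [ht]
        refine Ideal.mem_span_pair.mpr ⟨0, (w⁻¹ : Aˣ), ?_⟩
        linear_combination s * w.inv_mul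

lemma AdicCompletion.algebraMap_residueField_surjective {k T : Type*} [Field k] [CommRing T]
    [IsLocalRing T] [IsNoetherianRing T] [Algebra k T]
    (hres : Function.Surjective (algebraMap k (ResidueField T))) :
    Function.Surjective (algebraMap k (ResidueField (AdicCompletion (maximalIdeal T) T))) := by
  intro x
  obtain ⟨r, rfl⟩ := (AdicCompletion.residueField_map_bijective (R := T)).2 x
  obtain ⟨a, rfl⟩ := hres r
  exact ⟨a, rfl⟩

lemma MvPowerSeries.sum_X_sq_ne_zero (n : ℕ) :
    (∑ i, (MvPowerSeries.X i : MvPowerSeries (Fin (n + 1)) ℂ) ^ 2) ≠ 0 := by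
  intro h
  have h1 := congrArg (MvPowerSeries.coeff (Finsupp.single (0 : Fin (n + 1)) 2)) h
  rw [map_sum, map_zero] at h1
  simp_rw [MvPowerSeries.coeff_X_pow] at h1
  rw [Finset.sum_eq_single 0] at h1
  · simp at h1
  · intro i _ hi
    rw [if_neg]
    intro h2
    rw [Finsupp.single_eq_single_iff] at h2
    simp at h2
    exact hi h2.symm
  · simp

/-- Killing an element of the square of the maximal ideal does not lower the embedding
dimension. -/
lemma IsRegularLocalRing.ringKrullDim_le_of_mem_sq {T R : Type*} [CommRing T] [IsLocalRing T]
    [IsNoetherianRing T] [CommRing R] [IsRegularLocalRing R] (π : T →+* R)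
    (hπ : Function.Surjective π) (g : T) (hker : RingHom.ker π = Ideal.span {g})
    (hg : g ∈ maximalIdeal T ^ 2) : ringKrullDim T ≤ ringKrullDim R := by
  have hker_le : RingHom.ker π ≤ maximalIdeal T :=
    IsLocalRing.le_maximalIdeal (RingHom.ker_ne_top π)
  have hmπ : (maximalIdeal T).map π = maximalIdeal R :=
    IsLocalRing.eq_maximalIdeal (Ideal.IsMaximal.map_of_surjective_of_ker_le hπ hker_le)
  rw [← IsRegularLocalRing.spanFinrank_maximalIdeal (R := R)]
  refine (ringKrullDim_le_spanFinrank_maximalIdeal T).trans ?_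
  obtain ⟨s, hs, hsp⟩ := Submodule.FG.exists_span_set_encard_eq_spanFinrank
    (maximalIdeal R).fg_of_isNoetherianRing
  have hsfin : s.Finite := Set.finite_of_encard_eq_coe hs
  let t : Set T := Function.surjInv hπ '' s
  have ht : π '' t = s := by
    rw [← Set.image_comp]
    simp [Function.surjInv_eq hπ]
  -- Nakayama: lifts of generators of the maximal ideal of `R` generate that of `T` up to multiples
  -- of `g`, and `g` lies in the square of the maximal ideal.
  have htm : maximalIdeal T ≤ Ideal.span t := by
    refine Submodule.le_of_le_smul_of_le_jacobson_bot (I := maximalIdeal T)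
      (maximalIdeal T).fg_of_isNoetherianRing (IsLocalRing.maximalIdeal_le_jacobson _) ?_
    intro x hx
    have h1 : π x ∈ (Ideal.span t).map π := by
      rw [Ideal.map_span, ht]
      change π x ∈ Submodule.span R s
      rw [hsp, ← hmπ]
      exact Ideal.mem_map_of_mem _ hx
    obtain ⟨x', hx', hxx⟩ := (Ideal.mem_map_iff_of_surjective π hπ).mp h1
    have h2 : x - x' ∈ Ideal.span {g} := by
      rw [← hker, RingHom.mem_ker, map_sub, hxx, sub_self]
    have h3 : x - x' ∈ maximalIdeal T • maximalIdeal T := by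
      rw [smul_eq_mul, ← sq]
      exact (Ideal.span_singleton_le_iff_mem _).mpr hg h2
    exact Submodule.mem_sup.mpr ⟨x', hx', x - x', h3, by ring⟩
  have htm' : Ideal.span t = maximalIdeal T := by
    refine le_antisymm (Ideal.span_le.mpr fun x hx => ?_) htm
    have h1 : π x ∈ maximalIdeal R := by
      rw [← hsp]
      exact Submodule.subset_span (ht ▸ Set.mem_image_of_mem π hx)
    rw [← hmπ, Ideal.mem_map_iff_of_surjective π hπ] at h1
    obtain ⟨x', hx', hxx⟩ := h1
    have h2 : x - x' ∈ RingHom.ker π := by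
      rw [RingHom.mem_ker, map_sub, hxx, sub_self]
    simpa using add_mem (hker_le h2) hx'
  have h5 := Submodule.spanFinrank_span_le_ncard_of_finite (R := T) (hsfin.image (Function.surjInv hπ))
  have h6 : t.ncard ≤ s.ncard := Set.ncard_image_le hsfin
  have h7 : s.ncard = (maximalIdeal R).spanFinrank := by
    rw [Set.ncard, hs]
    rfl
  change (Ideal.span t).spanFinrank ≤ t.ncard at h5
  rw [htm'] at h5
  exact_mod_cast h5.trans (h6.trans h7.le)

universe u_1 u_2
variable {T : Type u_1} {R : Type u_2} [CommRing T] [IsLocalRing T] [IsNoetherianRing T] [CommRing R]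
  [IsLocalRing R] [IsNoetherianRing R] [Algebra ℂ T]

/-- A hypersurface singularity with nondegenerate quadratic part in a four-dimensional regular
local ring is an ordinary double point. -/
theorem nonempty_adicCompletion_ringEquiv_node (π : T →+* R)
    (hπ : Function.Surjective π) (g : T) (hker : RingHom.ker π = Ideal.span {g})
    (hdim : (4 : ℕ) ≤ ringKrullDim T) (hres : Function.Surjective (algebraMap ℂ (ResidueField T)))
    (a b c E F G x₀ x₁ x₂ x₃ : T) (hm : maximalIdeal T = Ideal.span {x₀, x₁, x₂, x₃})
    (ha : IsUnit a) (habc : IsUnit (4 * a * c - b ^ 2)) (hE : IsUnit E)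
    (hEFG : IsUnit (4 * E * G - F ^ 2))
    (hg : g = a * x₀ ^ 2 + b * x₀ * x₁ + c * x₁ ^ 2 + (E * x₂ ^ 2 + F * x₂ * x₃ + G * x₃ ^ 2)) :
    Nonempty (AdicCompletion (maximalIdeal R) R ≃+* (MvPowerSeries (Fin (3 + 1)) ℂ ⧸
      Ideal.span {∑ i, (MvPowerSeries.X i : MvPowerSeries (Fin (3 + 1)) ℂ) ^ 2})) ∧
    ¬ IsRegularLocalRing R := by
  set That := AdicCompletion (maximalIdeal T) T
  let ι : T →+* That := algebraMap T That
  have h2 : IsUnit (2 : That) := by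
    have := (isUnit_iff_ne_zero.mpr (two_ne_zero (α := ℂ))).map (algebraMap ℂ That)
    rwa [map_ofNat] at this
  have : HenselianLocalRing That :=
    { is_henselian := fun f hf a₀ h₁ h₂ =>
        (IsAdicComplete.henselianRing That (maximalIdeal That)).is_henselian f hf a₀ h₁
          (h₂.map _) }
  have hsq := HenselianLocalRing.exists_sq_eq_of_isUnit (k := ℂ) (A := That) h2
    (AdicCompletion.algebraMap_residueField_surjective hres)
  obtain ⟨z₀, z₁, h01, hs01⟩ := exists_sq_add_sq_of_isUnit h2 hsq (ι a) (ι b) (ι c) (ι x₀) (ι x₁)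
    (ha.map ι) (by simpa only [map_sub, map_mul, map_pow, map_ofNat] using habc.map ι)
  obtain ⟨z₂, z₃, h23, hs23⟩ := exists_sq_add_sq_of_isUnit h2 hsq (ι E) (ι F) (ι G) (ι x₂) (ι x₃)
    (hE.map ι) (by simpa only [map_sub, map_mul, map_pow, map_ofNat] using hEFG.map ι)
  have hspan : ∀ {A : Type u_1} [CommRing A] (x y z w : A),
      Ideal.span {x, y, z, w} = Ideal.span {x, y} ⊔ Ideal.span {z, w} := by
    intro A _ x y z w
    rw [← Ideal.span_union]
    congr 1
    ext t
    simp only [Set.mem_insert_iff, Set.mem_singleton_iff, Set.mem_union, or_assoc]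
  have hz : maximalIdeal That = Ideal.span (Set.range ![z₀, z₁, z₂, z₃]) := by
    have h1 := congrArg (Ideal.map ι) hm
    rw [← AdicCompletion.maximalIdeal_eq_map, Ideal.map_span] at h1
    rw [h1]
    simp only [Matrix.range_cons, Matrix.range_empty, Set.union_empty, Set.image_insert_eq,
      Set.image_singleton, Set.singleton_union]
    rw [hspan, hspan, hs01, hs23]
  obtain ⟨Φ, hΦ, hX⟩ := IsLocalRing.exists_bijective_mvPowerSeries (k := ℂ) (n := 3 + 1)
    (T := T) hdim hres _ hz
  -- The power series parameters are sent to the diagonalising coordinates, so the sum of their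
  -- squares goes to the image of `g`.
  have hG : Φ (∑ i, (MvPowerSeries.X i : MvPowerSeries (Fin (3 + 1)) ℂ) ^ 2) = ι g := by
    rw [map_sum]
    simp_rw [map_pow, hX]
    rw [Fin.sum_univ_four, hg]
    simp only [map_add, map_mul, map_pow, h01, h23]
    simp
    ring
  have hB : IsAdicComplete (maximalIdeal (MvPowerSeries (Fin (3 + 1)) ℂ))
      (MvPowerSeries (Fin (3 + 1)) ℂ) := by
    rw [MvPowerSeries.maximalIdeal_eq_span_X]
    infer_instance
  refine ⟨IsLocalRing.nonempty_adicCompletion_ringEquiv_quotient π hπ g hker Φ hΦ _ hG,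
    fun hR => ?_⟩
  have hinj : Function.Injective ι := AdicCompletion.of_injective (maximalIdeal T) T
  have : IsDomain (MvPowerSeries (Fin (3 + 1)) ℂ) := NoZeroDivisors.to_isDomain _
  have hdomThat : IsDomain That :=
    (RingEquiv.ofBijective Φ hΦ).symm.injective.isDomain (RingEquiv.ofBijective Φ hΦ).symm.toRingHom
  have hdomT : IsDomain T := hinj.isDomain ι
  have hg0 : g ≠ 0 := by
    rintro rfl
    rw [map_zero, map_eq_zero_iff Φ hΦ.1] at hG
    exact MvPowerSeries.sum_X_sq_ne_zero 3 hG
  have hmem : ∀ i ∈ ({x₀, x₁, x₂, x₃} : Set T), i ∈ maximalIdeal T := by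
    intro i hi
    rw [hm]
    exact Ideal.subset_span hi
  have hg2 : g ∈ maximalIdeal T ^ 2 := by
    have e : ∀ (t x y : T), x ∈ maximalIdeal T → y ∈ maximalIdeal T →
        t * x * y ∈ maximalIdeal T ^ 2 := by
      intro t x y hx hy
      rw [mul_assoc, sq]
      exact Ideal.mul_mem_left _ _ (Ideal.mul_mem_mul hx hy)
    have e' : ∀ (t x : T), x ∈ maximalIdeal T → t * x ^ 2 ∈ maximalIdeal T ^ 2 := fun t x hx => by
      rw [sq x, ← mul_assoc]
      exact e t x x hx hx
    rw [hg]
    have m0 := hmem x₀ (by simp)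
    have m1 := hmem x₁ (by simp)
    have m2 := hmem x₂ (by simp)
    have m3 := hmem x₃ (by simp)
    exact add_mem (add_mem (add_mem (e' _ _ m0) (e _ _ _ m0 m1)) (e' _ _ m1))
      (add_mem (add_mem (e' _ _ m2) (e _ _ _ m2 m3)) (e' _ _ m3))
  have hdimT : ringKrullDim T ≤ (4 : ℕ) := by
    refine (ringKrullDim_le_spanFinrank_maximalIdeal T).trans ?_
    rw [hm]
    have h3 := Submodule.spanFinrank_span_le_ncard_of_finite (R := T)
      (Set.toFinite ({x₀, x₁, x₂, x₃} : Set T))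
    have h4 : ({x₀, x₁, x₂, x₃} : Set T).ncard ≤ 4 := by
      refine (Set.ncard_insert_le _ _).trans (Nat.succ_le_succ ?_)
      refine (Set.ncard_insert_le _ _).trans (Nat.succ_le_succ ?_)
      refine (Set.ncard_insert_le _ _).trans (Nat.succ_le_succ ?_)
      exact (Set.ncard_singleton _).le
    exact_mod_cast h3.trans h4
  have hdimR : ringKrullDim R ≤ (3 : ℕ) := by
    have h1 := ringKrullDim_succ_le_of_surjective π hπ (mem_nonZeroDivisors_of_ne_zero hg0)
      (show π g = 0 from (RingHom.mem_ker).mp (hker ▸ Ideal.mem_span_singleton_self g))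
    have h5 := h1.trans hdimT
    obtain ⟨d, hd⟩ := WithBot.ne_bot_iff_exists.mp (ringKrullDim_ne_bot (R := R))
    have hd' : d ≠ ⊤ := by
      rintro rfl
      exact ringKrullDim_ne_top (R := R) hd.symm
    obtain ⟨d, rfl⟩ := ENat.ne_top_iff_exists.mp hd'
    rw [← hd] at h5 ⊢
    have h6 : ((d + 1 : ℕ) : ℕ∞) ≤ (4 : ℕ) := WithBot.coe_le_coe.mp h5
    have h7 : d + 1 ≤ 4 := Nat.cast_le.mp h6
    exact WithBot.coe_le_coe.mpr (Nat.cast_le.mpr (by omega : d ≤ 3))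
  -- If `R` were regular, its dimension would be at least that of `T`, hence at least 4; but
  -- dividing the domain `T` by the non-zero `g` brings the dimension down to at most 3.
  refine IsRegularLocalRing.ringKrullDim_le_of_mem_sq π hπ g hker hg2 |>.not_gt ?_
  exact hdimR.trans_lt (lt_of_lt_of_le (by exact_mod_cast (by norm_num : 3 < 4)) hdim)

end OrdinaryDoublePoint

namespace HeisenbergEight

open MvPolynomial AlgebraicGeometry

/-! ### Local rings of a closed subscheme of projective space as quotients of local rings of affine
8-space -/

section StalkPresentation

/-- Substituting the multiples of the variables by `w` scales a form by a power of `w`. -/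
lemma aeval_mul_of_mem_deg {L : Type*} [CommRing L] [Algebra ℂ L] (w : L) (z : ZMod 8 → L) {n : ℕ}
    {f : Ring8} (hf : f ∈ deg n) :
    aeval (fun i => w * z i) f = w ^ n * aeval z f := by
  rw [aeval_def, aeval_def, eval₂_eq', eval₂_eq', Finset.mul_sum]
  refine Finset.sum_congr rfl fun d hd => ?_
  have h : d.degree = n := by
    rw [Finsupp.degree_eq_weight_one]
    exact hf (mem_support_iff.mp hd)
  have h2 : ∑ i : ZMod 8, d i = n := by
    rw [← h, Finsupp.degree_eq_sum]
  simp only [mul_pow, Finset.prod_mul_distrib, Finset.prod_pow_eq_pow_sum, h2]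
  ring

/-- Homogenisation with respect to a linear form. -/
lemma exists_homogenization (ℓ : Ring8) (hℓ : ℓ ∈ deg 1) (f : Ring8) :
    ∃ (n : ℕ) (h : Ring8), h ∈ deg n ∧ h - f ∈ Ideal.span {ℓ - 1} := by
  refine ⟨f.totalDegree, ∑ i ∈ Finset.range (f.totalDegree + 1),
    homogeneousComponent i f * ℓ ^ (f.totalDegree - i), ?_, ?_⟩
  · refine sum_mem fun i hi => ?_
    have h1 := SetLike.GradedMul.mul_mem (A := deg) (homogeneousComponent_mem i f)
      (SetLike.pow_mem_graded (f.totalDegree - i) hℓ)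
    have h2 : i + (f.totalDegree - i) • 1 = f.totalDegree := by
      have := Finset.mem_range.mp hi
      simp
      omega
    rwa [h2] at h1
  · have h0 : ∀ h : Ring8, h - f = h - ∑ i ∈ Finset.range (f.totalDegree + 1),
        homogeneousComponent i f := fun h => by rw [sum_homogeneousComponent f]
    rw [h0, ← Finset.sum_sub_distrib]
    refine sum_mem fun i _ => ?_
    have h3 : ℓ ^ (f.totalDegree - i) - 1 ∈ Ideal.span {ℓ - 1} := by
      rw [Ideal.mem_span_singleton]
      simpa using sub_dvd_pow_sub_pow ℓ 1 (f.totalDegree - i)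
    have := Ideal.mul_mem_left _ (homogeneousComponent i f) h3
    rwa [mul_sub, mul_one] at this

variable (I : HomogeneousIdeal deg)

/-- The local ring of `Proj (S / I)` at a point is the quotient of a local ring of the affine cone
by the equation `ℓ = 1`, where `ℓ` is a linear form that does not vanish at the point. -/
theorem exists_ringHom_atPrime (J : Ideal (Ring8 ⧸ I.toIdeal)) [J.IsPrime]
    (ℓ : Ring8) (hℓ : ℓ ∈ deg 1)
    (hℓJ : Ideal.Quotient.mk I.toIdeal ℓ ∉ J) :
    ∃ θ : Ring8 →+* HomogeneousLocalization.AtPrime (quotDeg I) J,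
      (∀ n, ∀ f ∈ deg n, (IsUnit (θ f) ↔ Ideal.Quotient.mk I.toIdeal f ∉ J)) ∧ θ ℓ = 1 ∧
      (∀ f ∈ I.toIdeal, θ f = 0) ∧
      (∀ r, ∃ f s, IsUnit (θ s) ∧ r * θ s = θ f) ∧
      (∀ f, θ f = 0 → ∃ s, IsUnit (θ s) ∧ s * f ∈ I.toIdeal ⊔ Ideal.span {ℓ - 1}) := by
  let mk := Ideal.Quotient.mk I.toIdeal
  let L := Localization.AtPrime J
  let φ : Ring8 →ₐ[ℂ] L := (IsScalarTower.toAlgHom ℂ _ L).comp (Ideal.Quotient.mkₐ ℂ I.toIdeal)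
  have hmk : ∀ {n f}, f ∈ deg n → mk f ∈ quotDeg I n := fun hf => Submodule.mem_map_of_mem hf
  -- Dehomogenisation: `θ` sends each coordinate `X i` to the fraction `X i / ℓ`, hence a form of
  -- degree `n` to that form divided by `ℓ ^ n`.
  let z : ZMod 8 → HomogeneousLocalization.AtPrime (quotDeg I) J := fun i =>
    HomogeneousLocalization.mk ⟨1, ⟨mk (X i), hmk (isHomogeneous_X ℂ i)⟩, ⟨mk ℓ, hmk hℓ⟩, hℓJ⟩
  let c : ℂ →+* HomogeneousLocalization.AtPrime (quotDeg I) J :=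
    (HomogeneousLocalization.fromZeroRingHom (quotDeg I) _).comp (algebraMap ℂ (quotDeg I 0))
  let θ : Ring8 →+* HomogeneousLocalization.AtPrime (quotDeg I) J := eval₂Hom c z
  let w : L := IsLocalization.mk' L (1 : Ring8 ⧸ I.toIdeal) (⟨mk ℓ, hℓJ⟩ : J.primeCompl)
  have hw : w * φ ℓ = 1 := by
    simpa [w] using! IsLocalization.mk'_spec L (1 : Ring8 ⧸ I.toIdeal) (⟨mk ℓ, hℓJ⟩ : J.primeCompl)
  have hwu : IsUnit w := .of_mul_eq_one _ hw
  have hval : ∀ f, (θ f).val = aeval (fun i => w * φ (X i)) f := by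
    have : (algebraMap (HomogeneousLocalization.AtPrime (quotDeg I) J) L).comp θ =
        (aeval (fun i => w * φ (X i)) : Ring8 →ₐ[ℂ] L).toRingHom := by
      refine MvPolynomial.ringHom_ext (fun a => ?_) fun i => ?_
      · simp only [θ, c, RingHom.comp_apply, coe_eval₂Hom, eval₂_C]
        change Localization.mk (algebraMap ℂ (Ring8 ⧸ I.toIdeal) a) 1 =
          aeval (fun i => w * φ (X i)) (C a)
        rw [aeval_C, Localization.mk_one_eq_algebraMap, ← IsScalarTower.algebraMap_apply]
      · simp only [θ, z, RingHom.comp_apply, coe_eval₂Hom, eval₂_X]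
        change Localization.mk (mk (X i)) (⟨mk ℓ, hℓJ⟩ : J.primeCompl) =
          aeval (fun i => w * φ (X i)) (X i)
        rw [aeval_X, Localization.mk_eq_mk', IsLocalization.mk'_eq_mul_mk'_one, mul_comm]
        rfl
    exact fun f => RingHom.congr_fun this f
  have hval' : ∀ {n f}, f ∈ deg n → (θ f).val = w ^ n * φ f := by
    intro n f hf
    rw [hval, aeval_mul_of_mem_deg w (fun i => φ (X i)) hf]
    congr 1
    exact (DFunLike.congr_fun (MvPolynomial.aeval_unique φ) f).symm
  have hunit : ∀ n, ∀ f ∈ deg n, (IsUnit (θ f) ↔ mk f ∉ J) := by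
    intro n f hf
    rw [← HomogeneousLocalization.isUnit_iff_isUnit_val, hval' hf, IsUnit.mul_iff,
      and_iff_right (hwu.pow n)]
    exact IsLocalization.AtPrime.isUnit_to_map_iff L J (mk f)
  have hℓ1 : θ ℓ = 1 := by
    refine HomogeneousLocalization.val_injective _ ?_
    rw [hval' hℓ, pow_one, hw, HomogeneousLocalization.val_one]
  have hθI : ∀ f ∈ I.toIdeal, θ f = 0 := by
    intro f hf
    rw [← sum_homogeneousComponent f, map_sum]
    refine Finset.sum_eq_zero fun i _ => ?_
    refine HomogeneousLocalization.val_injective _ ?_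
    rw [hval' (homogeneousComponent_mem i f), HomogeneousLocalization.val_zero]
    have h1 : homogeneousComponent i f ∈ I.toIdeal := by
      have h := I.isHomogeneous i hf
      rwa [show ((DirectSum.decompose deg f i : deg i) : Ring8) = homogeneousComponent i f from
        decomposition.decompose'_apply f i] at h
    have h2 : φ (homogeneousComponent i f) = 0 := by
      change algebraMap _ L (mk _) = 0
      rw [Ideal.Quotient.eq_zero_iff_mem.mpr h1, map_zero]
    rw [h2, mul_zero]
  refine ⟨θ, hunit, hℓ1, hθI, fun r => ?_, fun f hf => ?_⟩
  · obtain ⟨⟨n, ⟨_, f, hf, rfl⟩, ⟨_, s, hs, rfl⟩, hsJ⟩, rfl⟩ := HomogeneousLocalization.mk_surjective r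
    refine ⟨f, s, (hunit n s hs).mpr hsJ, HomogeneousLocalization.val_injective _ ?_⟩
    rw [HomogeneousLocalization.val_mul, hval' hf, hval' hs, HomogeneousLocalization.val_mk,
      mul_left_comm]
    congr 1
    rw [Localization.mk_eq_mk']
    exact IsLocalization.mk'_spec L (mk f) (⟨mk s, hsJ⟩ : J.primeCompl)
  -- Modulo `ℓ - 1`, `f` may be replaced by a form `h`. The vanishing of `θ h` means that some `t`
  -- outside `J` multiplies `h` into `I`, and a homogeneous component of `t` outside `J` does so as
  -- well.
  · obtain ⟨n, h, hh, hfh⟩ := exists_homogenization ℓ hℓ f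
    have h0 : θ h = 0 := by
      obtain ⟨a, ha⟩ := Ideal.mem_span_singleton'.mp hfh
      have := congrArg θ ha
      rw [map_mul, map_sub, map_sub, hℓ1, map_one, sub_self, mul_zero, hf, sub_zero] at this
      exact this.symm
    have h1 : φ h = 0 := by
      have := congrArg HomogeneousLocalization.val h0
      rw [hval' hh, HomogeneousLocalization.val_zero] at this
      exact ((hwu.pow n).mul_right_eq_zero).mp this
    obtain ⟨⟨t, htJ⟩, ht⟩ := (IsLocalization.map_eq_zero_iff J.primeCompl L (mk h)).mp h1
    obtain ⟨t, rfl⟩ := Ideal.Quotient.mk_surjective t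
    obtain ⟨j, hj⟩ : ∃ j, mk (homogeneousComponent j t) ∉ J := by
      by_contra hcon
      push Not at hcon
      refine htJ ?_
      rw [← sum_homogeneousComponent t, map_sum]
      exact sum_mem fun i _ => hcon i
    have h2 : homogeneousComponent j t * h ∈ I.toIdeal := by
      have h3 : t * h ∈ I.toIdeal := by
        rw [← Ideal.Quotient.eq_zero_iff_mem, map_mul]
        exact ht
      have h4 := I.isHomogeneous (j + n) h3
      rwa [DirectSum.coe_decompose_mul_add_of_right_mem deg hh,
        show ((DirectSum.decompose deg t j : deg j) : Ring8) = homogeneousComponent j t from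
          decomposition.decompose'_apply t j] at h4
    refine ⟨homogeneousComponent j t, (hunit j _ (homogeneousComponent_mem j t)).mpr hj, ?_⟩
    have h3 : homogeneousComponent j t * f = homogeneousComponent j t * h -
      homogeneousComponent j t * (h - f) := by ring
    rw [h3]
    exact sub_mem (Ideal.mem_sup_left h2) (Ideal.mem_sup_right (Ideal.mul_mem_left _ _ hfh))

/-- A local ring all of whose elements are fractions of elements of `S` is a quotient of a
localization of `S` at a prime ideal. -/
lemma exists_surjective_localization {S R : Type*} [CommRing S] [CommRing R] [IsLocalRing R]
    (θ : S →+* R) (K : Ideal S) (hK : ∀ f ∈ K, θ f = 0)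
    (hs : ∀ r, ∃ f s, IsUnit (θ s) ∧ r * θ s = θ f)
    (hk : ∀ f, θ f = 0 → ∃ s, IsUnit (θ s) ∧ s * f ∈ K) :
    ∃ π : Localization.AtPrime ((IsLocalRing.maximalIdeal R).comap θ) →+* R,
      Function.Surjective π ∧ RingHom.ker π = K.map (algebraMap _ _) ∧
        ∀ f, π (algebraMap _ _ f) = θ f := by
  set P := (IsLocalRing.maximalIdeal R).comap θ with hP
  have hu : ∀ s : P.primeCompl, IsUnit (θ s) := by
    intro s
    by_contra h
    exact s.2 ((IsLocalRing.mem_maximalIdeal _).mpr h)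
  have hu' : ∀ s, IsUnit (θ s) → s ∈ P.primeCompl := fun s h h' =>
    (IsLocalRing.mem_maximalIdeal _).mp (Ideal.mem_comap.mp h') h
  let π : Localization.AtPrime P →+* R := IsLocalization.lift (M := P.primeCompl) hu
  have hπ : ∀ f, π (algebraMap _ _ f) = θ f := fun f => IsLocalization.lift_eq hu f
  refine ⟨π, fun r => ?_, le_antisymm (fun x hx => ?_) ?_, hπ⟩
  · obtain ⟨f, s, hsu, hr⟩ := hs r
    refine ⟨IsLocalization.mk' _ f ⟨s, hu' s hsu⟩, ?_⟩
    rw [IsLocalization.lift_mk'_spec, mul_comm]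
    exact hr.symm
  · obtain ⟨f, t, rfl⟩ := IsLocalization.exists_mk'_eq P.primeCompl x
    have h1 : θ f = 0 := by
      rw [RingHom.mem_ker, IsLocalization.lift_mk'_spec, mul_zero] at hx
      exact hx
    obtain ⟨s, hsu, hsK⟩ := hk f h1
    rw [IsLocalization.mk'_mem_map_algebraMap_iff]
    exact ⟨s, hu' s hsu, hsK⟩
  · rw [Ideal.map_le_iff_le_comap]
    intro f hf
    rw [Ideal.mem_comap, RingHom.mem_ker, hπ, hK f hf]

/-- Presentation of the local rings of a closed subscheme of `P^7`. -/
theorem exists_stalk_presentation (x : subscheme I) (ℓ : Ring8) (hℓ : ℓ ∈ deg 1)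
    (hx : ℓ ∉ ((immersion I).base x).asHomogeneousIdeal) :
    ∃ (P : Ideal Ring8) (_ : P.IsPrime)
      (π : Localization.AtPrime P →+* (subscheme I).presheaf.stalk x),
      Function.Surjective π ∧
      RingHom.ker π = (I.toIdeal ⊔ Ideal.span {ℓ - 1}).map (algebraMap _ _) ∧
      I.toIdeal ≤ P ∧ ℓ - 1 ∈ P ∧
      ∀ n, ∀ f ∈ deg n, (f ∈ P ↔ f ∈ ((immersion I).base x).asHomogeneousIdeal) := by
  have : x.asHomogeneousIdeal.toIdeal.IsPrime := x.isPrime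
  obtain ⟨θ₀, h1, h2, h3, h4, h5⟩ := exists_ringHom_atPrime I x.asHomogeneousIdeal.toIdeal ℓ hℓ hx
  let e : HomogeneousLocalization.AtPrime (quotDeg I) x.asHomogeneousIdeal.toIdeal ≃+*
    (subscheme I).presheaf.stalk x := (Proj.stalkIso (quotDeg I) x).symm.commRingCatIsoToRingEquiv
  let θ := e.toRingHom.comp θ₀
  have hθ : ∀ f, θ f = e (θ₀ f) := fun f => rfl
  have hθu : ∀ f, IsUnit (θ f) ↔ IsUnit (θ₀ f) := fun f => MulEquiv.isUnit_map e
  have hK : ∀ f ∈ I.toIdeal ⊔ Ideal.span {ℓ - 1}, θ f = 0 := by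
    intro f hf
    have : I.toIdeal ⊔ Ideal.span {ℓ - 1} ≤ RingHom.ker θ := by
      refine sup_le (fun f hf => ?_) ?_
      · rw [RingHom.mem_ker, hθ, h3 f hf, map_zero]
      · rw [Ideal.span_singleton_le_iff_mem, RingHom.mem_ker, hθ, map_sub, h2, map_one, sub_self,
          map_zero]
    exact this hf
  obtain ⟨π, hπ, hker, -⟩ := exists_surjective_localization θ _ hK (fun r => by
      obtain ⟨f, s, hs, hr⟩ := h4 (e.symm r)
      refine ⟨f, s, (hθu s).mpr hs, ?_⟩
      rw [hθ, hθ, ← hr, map_mul, e.apply_symm_apply]) (fun f hf => by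
      obtain ⟨s, hs, hsf⟩ := h5 f (e.injective (by rw [← hθ, hf, map_zero]))
      exact ⟨s, (hθu s).mpr hs, hsf⟩)
  -- The prime is the preimage of the maximal ideal under `θ`: a point of the affine cone lying on
  -- the hyperplane `ℓ = 1`.
  refine ⟨_, inferInstance, π, hπ, hker, fun f hf => ?_, ?_, fun n f hf => ?_⟩
  · rw [Ideal.mem_comap, hK f (Ideal.mem_sup_left hf)]
    exact zero_mem _
  · rw [Ideal.mem_comap, hK _ (Ideal.mem_sup_right (Ideal.mem_span_singleton_self _))]
    exact zero_mem _
  · rw [Ideal.mem_comap, IsLocalRing.mem_maximalIdeal, mem_nonunits_iff, hθu, h1 n f hf, not_not]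
    rfl

end StalkPresentation

end HeisenbergEight

namespace HeisenbergEight

open MvPolynomial AlgebraicGeometry

/-! ### Dimension bounds from the affine cone -/

section Dimension

variable (I : HomogeneousIdeal deg)

lemma mem_ker_constantCoeff (f : Ring8) (Q : Ideal Ring8) (hQ : ∀ i, X i ∈ Q)
    (hf : constantCoeff f = 0) : f ∈ Q := by
  have h : idealOfVars (ZMod 8) ℂ ≤ Q := by
    rw [idealOfVars, Ideal.span_le]
    rintro _ ⟨i, rfl⟩
    exact hQ i
  refine h ?_
  rw [← pow_one (idealOfVars _ _), mem_pow_idealOfVars_iff]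
  intro d hd
  by_contra h0
  have : d = 0 := (Finsupp.degree_eq_zero_iff d).mp (by omega)
  subst this
  exact (mem_support_iff.mp hd) hf

/-- If the homogeneous coordinate ring has a system of parameters of `n + 1` linear forms, the
dimension of the scheme is at most `n`. -/
theorem topologicalKrullDim_subscheme_le (n : ℕ) (s : Finset Ring8) (hcard : s.card ≤ n + 1)
    (hI : ∀ f ∈ I.toIdeal, constantCoeff f = 0) (hs1 : ∀ f ∈ s, constantCoeff f = 0)
    (hs : ∀ Q : Ideal Ring8, Q.IsPrime → I.toIdeal ≤ Q → (s : Set Ring8) ⊆ Q → ∀ i, X i ∈ Q) :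
    topologicalKrullDim (subscheme I) ≤ n := by
  classical
  let mk := Ideal.Quotient.mk I.toIdeal
  let c : Ring8 ⧸ I.toIdeal →+* ℂ := Ideal.Quotient.lift I.toIdeal constantCoeff hI
  have hc : ∀ f, c (mk f) = constantCoeff f := fun f => rfl
  let M : Ideal (Ring8 ⧸ I.toIdeal) := RingHom.ker c
  have hM : M.IsPrime := RingHom.ker_isPrime c
  -- By `hs` every prime over the images of `s` contains the ideal `M` of the vertex, so Krull's
  -- height theorem bounds the height of `M` by `n + 1`.
  have hmin : M ∈ (Ideal.span ((s.image mk : Finset _) : Set (Ring8 ⧸ I.toIdeal))).minimalPrimes := by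
    refine ⟨⟨hM, ?_⟩, ?_⟩
    · rw [Ideal.span_le, Finset.coe_image]
      rintro _ ⟨f, hf, rfl⟩
      exact hs1 f hf
    · rintro Q ⟨hQ, hsQ⟩ - a ha
      obtain ⟨f, rfl⟩ := Ideal.Quotient.mk_surjective a
      have h1 := hs (Q.comap mk) (Ideal.IsPrime.comap mk) (fun f hf => by
        rw [Ideal.mem_comap, Ideal.Quotient.eq_zero_iff_mem.mpr hf]
        exact zero_mem _) (fun f hf => by
        refine hsQ (Ideal.subset_span ?_)
        rw [Finset.coe_image]
        exact ⟨f, hf, rfl⟩)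
      exact mem_ker_constantCoeff f (Q.comap mk) h1 ha
  have hMht : M.height ≤ (n + 1 : ℕ) :=
    (Ideal.height_le_card_of_mem_minimalPrimes_span_finset hmin).trans
      (Nat.cast_le.mpr (Finset.card_image_le.trans hcard))
  -- Relevant homogeneous primes lie strictly below the vertex; this strictness turns the bound `n +
  -- 1` into `n`.
  have hlt : ∀ x : subscheme I, x.asHomogeneousIdeal.toIdeal < M := by
    intro x
    refine lt_of_le_not_ge (fun a ha => ?_) fun hle => ?_
    · obtain ⟨f, rfl⟩ := Ideal.Quotient.mk_surjective a
      by_contra hcon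
      have h1 := ((immersion I).base x).asHomogeneousIdeal.isHomogeneous 0
        (show f ∈ ((immersion I).base x).asHomogeneousIdeal from ha)
      rw [show ((DirectSum.decompose deg f 0 : deg 0) : Ring8) = homogeneousComponent 0 f from
        decomposition.decompose'_apply f 0, homogeneousComponent_zero] at h1
      have h5 : mk (C (constantCoeff f)) ∈ x.asHomogeneousIdeal.toIdeal := h1
      refine x.isPrime.ne_top ((Ideal.eq_top_iff_one _).mpr ?_)
      have h6 := Ideal.mul_mem_left _ (mk (C (constantCoeff f)⁻¹)) h5
      rwa [← map_mul, ← C_mul, inv_mul_cancel₀ (show constantCoeff f ≠ 0 from hcon), C_1, map_one] at h6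
    · refine x.not_irrelevant_le ?_
      rw [HomogeneousIdeal.irrelevant_le]
      rintro m hm _ ⟨f, hf, rfl⟩
      refine hle ?_
      change constantCoeff f = 0
      by_contra hcon
      have h1 := hf hcon
      simp at h1
      omega
  have hht : ∀ x : subscheme I, x.asHomogeneousIdeal.toIdeal.height ≤ n := by
    intro x
    have : x.asHomogeneousIdeal.toIdeal.IsPrime := x.isPrime
    have h1 := (Ideal.height_add_one_le_of_lt_of_isPrime (hlt x)).trans hMht
    have h2 : x.asHomogeneousIdeal.toIdeal.height ≠ ⊤ := by
      intro h
      rw [h] at h1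
      simp at h1
    obtain ⟨d, hd⟩ := ENat.ne_top_iff_exists.mp h2
    rw [← hd] at h1 ⊢
    have h3 : d + 1 ≤ n + 1 := by exact_mod_cast h1
    exact_mod_cast (by omega : d ≤ n)
  rw [topologicalKrullDim,
    Order.krullDim_eq_of_orderIso (irreducibleSetEquivPoints (α := subscheme I)),
    Order.krullDim_eq_iSup_coheight]
  refine iSup_le fun x => ?_
  refine le_trans ?_ (WithBot.coe_le_coe.mpr (hht x))
  refine WithBot.coe_le_coe.mpr ?_
  -- Chains of generalisations of `x` become chains of primes inside its ideal, so the coheight of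
  -- the point is at most the height of the prime.
  let F : (subscheme I)ᵒᵈ → PrimeSpectrum (Ring8 ⧸ I.toIdeal) := fun z =>
    ⟨(OrderDual.ofDual z).asHomogeneousIdeal.toIdeal, (OrderDual.ofDual z).isPrime⟩
  have hF : StrictMono F := by
    have hle : ∀ z w : subscheme I, z ⤳ w ↔
        z.asHomogeneousIdeal.toIdeal ≤ w.asHomogeneousIdeal.toIdeal := by
      intro z w
      rw [specializes_iff_mem_closure]
      exact (ProjectiveSpectrum.le_iff_mem_closure (𝒜 := quotDeg I) z w).symm
    rintro z w ⟨h1, h2⟩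
    exact ⟨(hle _ _).mp h1, fun h => h2 ((hle _ _).mpr h)⟩
  have h1 := Order.height_le_height_apply_of_strictMono F hF (OrderDual.toDual x)
  rw [← PrimeSpectrum.height_eq_orderHeight] at h1
  exact h1

lemma le_ringKrullDim_stalk_le (x : subscheme I) :
    ringKrullDim ((subscheme I).presheaf.stalk x) ≤ topologicalKrullDim (subscheme I) := by
  rw [topologicalKrullDim,
    Order.krullDim_eq_of_orderIso (irreducibleSetEquivPoints (α := subscheme I)),
    ringKrullDim_stalk_eq_coheight]
  exact Order.coheight_le_krullDim x

end Dimension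

end HeisenbergEight

namespace HeisenbergEight

open MvPolynomial AlgebraicGeometry

/-! ### The Heisenberg group as monomial transformations, and the size of the orbit -/

noncomputable section HeisenbergOrbit

/-- The character `i ↦ ξ^{-i}` of `ℤ/8`. -/
def chi (i : ZMod 8) : ℂ := xi⁻¹ ^ i.val

lemma isPrimitiveRoot_xi : IsPrimitiveRoot xi 8 := by
  have := Complex.isPrimitiveRoot_exp 8 (by norm_num)
  rw [xi]
  exact_mod_cast this

lemma chi_natCast (n : ℕ) : chi (n : ZMod 8) = xi⁻¹ ^ n := by
  rw [chi, ZMod.val_natCast, ← pow_eq_pow_mod]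
  exact isPrimitiveRoot_xi.inv.pow_eq_one

lemma chi_add (i j : ZMod 8) : chi (i + j) = chi i * chi j := by
  have h : i + j = ((i.val + j.val : ℕ) : ZMod 8) := by simp
  rw [h, chi_natCast, pow_add, chi, chi]

lemma chi_zero : chi 0 = 1 := by simp [chi]

lemma chi_ne_zero (i : ZMod 8) : chi i ≠ 0 :=
  pow_ne_zero _ (inv_ne_zero (isPrimitiveRoot_xi.ne_zero (by norm_num)))

lemma chi_injective : Function.Injective chi := by
  intro i j h
  exact ZMod.val_injective 8 (isPrimitiveRoot_xi.inv.pow_inj (ZMod.val_lt i) (ZMod.val_lt j) h)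

lemma chi_four : chi 4 = -1 := by
  have h1 : chi 4 * chi 4 = 1 := by
    rw [← chi_add, show (4 + 4 : ZMod 8) = 0 by decide, chi_zero]
  rcases mul_self_eq_one_iff.mp h1 with h | h
  · exact absurd (chi_injective (h.trans chi_zero.symm)) (by decide)
  · exact h

lemma chi_two : chi 2 = -Complex.I := by
  have h : chi 2 = xi⁻¹ ^ 2 := chi_natCast 2
  have h1 : xi ^ 2 = Complex.I := by
    rw [xi, ← Complex.exp_nat_mul]
    have : ((2 : ℕ) : ℂ) * (2 * Real.pi * Complex.I / 8) = Real.pi / 2 * Complex.I := by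
      push_cast
      ring
    rw [this, Complex.exp_pi_div_two_mul_I]
  rw [h, inv_pow, h1, Complex.inv_I]

lemma chi_pow_eight (i : ZMod 8) : chi i ^ 8 = 1 := by
  rw [chi, ← pow_mul, mul_comm, pow_mul, isPrimitiveRoot_xi.inv.pow_eq_one, one_pow]

variable {K : Type*} [Field K] [Algebra ℂ K]

/-- The monomial transformation `τ^b σ^a`, on vectors with entries in an extension field. -/
def heis (a b : ZMod 8) (v : ZMod 8 → K) : ZMod 8 → K :=
  fun i => algebraMap ℂ K (chi (b * i)) * v (i - a)

lemma heis_apply (a b : ZMod 8) (v : ZMod 8 → K) (i : ZMod 8) :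
    heis a b v i = algebraMap ℂ K (chi (b * i)) * v (i - a) := rfl

lemma heis_apply_complex (a b : ZMod 8) (v : Vec) (i : ZMod 8) :
    heis a b v i = chi (b * i) * v (i - a) := rfl

lemma heis_smul (a b : ZMod 8) (c : K) (v : ZMod 8 → K) : heis a b (c • v) = c • heis a b v := by
  funext i
  simp only [heis_apply, Pi.smul_apply, smul_eq_mul]
  ring

lemma heis_heis (a b a' b' : ZMod 8) (v : ZMod 8 → K) :
    heis a b (heis a' b' v) =
      algebraMap ℂ K (chi (-(b' * a))) • heis (a + a') (b + b') v := by
  funext i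
  simp only [heis_apply, Pi.smul_apply, smul_eq_mul]
  rw [show i - (a + a') = i - a - a' by ring, show b' * (i - a) = -(b' * a) + b' * i by ring,
    add_mul, chi_add, chi_add, map_mul, map_mul]
  ring

lemma heis_zero_zero (v : ZMod 8 → K) : heis 0 0 v = v := by
  funext i
  simp [heis_apply, chi_zero]

lemma heis_ne_zero (a b : ZMod 8) {v : ZMod 8 → K} (hv : v ≠ 0) : heis a b v ≠ 0 := by
  intro h
  apply hv
  have h1 := heis_heis (-a) (-b) a b v
  rw [h] at h1
  have h2 : heis (-a) (-b) (0 : ZMod 8 → K) = 0 := by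
    funext i
    simp [heis_apply]
  rw [h2, neg_add_cancel, neg_add_cancel, heis_zero_zero] at h1
  refine (smul_eq_zero.mp h1.symm).resolve_left ?_
  exact (map_ne_zero _).mpr (chi_ne_zero _)

lemma sigma_eq_heis (v : Vec) : sigma v = heis 1 0 v := by
  funext i
  simp [heis_apply, sigma_apply, chi_zero]

lemma tau_eq_heis (v : Vec) : tau v = heis 0 1 v := by
  funext i
  simp [heis_apply, tau_apply, chi]

lemma sigma_pow_eq_heis (n : ℕ) (v : Vec) : (sigma ^ n) v = heis n 0 v := by
  induction n with
  | zero => simp [heis_zero_zero]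
  | succ n ih =>
    rw [pow_succ', LinearEquiv.mul_apply, ih, sigma_eq_heis, heis_heis]
    simp [chi_zero, add_comm]

lemma tau_pow_eq_heis (n : ℕ) (v : Vec) : (tau ^ n) v = heis 0 n v := by
  induction n with
  | zero => simp [heis_zero_zero]
  | succ n ih =>
    rw [pow_succ', LinearEquiv.mul_apply, ih, tau_eq_heis, heis_heis]
    simp [chi_zero, add_comm]

lemma exists_heis_of_mem_H8 (g : Vec ≃ₗ[ℂ] Vec) (hg : g ∈ H8) :
    ∃ (c : ℂ) (a b : ZMod 8), c ≠ 0 ∧ ∀ v, g v = c • heis a b v := by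
  induction hg using Subgroup.closure_induction with
  | mem g hg =>
    rcases hg with rfl | rfl
    · exact ⟨1, 1, 0, one_ne_zero, fun v => by rw [sigma_eq_heis, one_smul]⟩
    · exact ⟨1, 0, 1, one_ne_zero, fun v => by rw [tau_eq_heis, one_smul]⟩
  | one => exact ⟨1, 0, 0, one_ne_zero, fun v => by simp [heis_zero_zero]⟩
  | mul g h _ _ ihg ihh =>
    obtain ⟨c, a, b, hc, h1⟩ := ihg
    obtain ⟨c', a', b', hc', h2⟩ := ihh
    refine ⟨c * (c' * chi (-(b' * a))), a + a', b + b',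
      mul_ne_zero hc (mul_ne_zero hc' (chi_ne_zero _)), fun v => ?_⟩
    rw [LinearEquiv.mul_apply, h2, h1, heis_smul, heis_heis, smul_smul, smul_smul, mul_assoc]
    rfl
  | inv g _ ih =>
    obtain ⟨c, a, b, hc, h1⟩ := ih
    refine ⟨(c * chi (b * a))⁻¹, -a, -b, inv_ne_zero (mul_ne_zero hc (chi_ne_zero _)), fun v => ?_⟩
    apply g.injective
    have h2 : g (g⁻¹ v) = v := by
      rw [← LinearEquiv.mul_apply, mul_inv_cancel]
      rfl
    rw [h2, h1, heis_smul, heis_heis, smul_smul, smul_smul, add_neg_cancel, add_neg_cancel,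
      heis_zero_zero]
    have h3 : c * ((c * chi (b * a))⁻¹ * chi (-(-b * a))) = 1 := by
      rw [show -(-b * a) = b * a by ring]
      have := chi_ne_zero (b * a)
      field_simp
    exact (by rw [show (algebraMap ℂ ℂ) (chi (-(-b * a))) = chi (-(-b * a)) from rfl, mul_assoc, h3,
      one_smul])

lemma exists_mem_H8_heis (a b : ZMod 8) : ∃ g ∈ H8, ∀ v, g v = heis a b v := by
  refine ⟨tau ^ b.val * sigma ^ a.val, mul_mem (pow_mem (Subgroup.subset_closure (by simp)) _)
    (pow_mem (Subgroup.subset_closure (by simp)) _), fun v => ?_⟩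
  rw [LinearEquiv.mul_apply, sigma_pow_eq_heis, tau_pow_eq_heis, heis_heis]
  simp [chi_zero]

lemma mem_orbit_iff (v : Vec) (hv : v ≠ 0) (p : ℙ ℂ Vec) :
    p ∈ orbit (Projectivization.mk ℂ v hv) ↔
      ∃ a b : ZMod 8, p = Projectivization.mk ℂ (heis a b v) (heis_ne_zero a b hv) := by
  constructor
  · rintro ⟨⟨g, hg⟩, rfl⟩
    obtain ⟨c, a, b, hc, h⟩ := exists_heis_of_mem_H8 g hg
    refine ⟨a, b, ?_⟩
    change g • Projectivization.mk ℂ v hv = _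
    rw [Projectivization.smul_mk, Projectivization.mk_eq_mk_iff']
    exact ⟨c, (h v).symm⟩
  · rintro ⟨a, b, rfl⟩
    obtain ⟨g, hg, h⟩ := exists_mem_H8_heis a b
    refine ⟨⟨g, hg⟩, ?_⟩
    change g • Projectivization.mk ℂ v hv = _
    rw [Projectivization.smul_mk, Projectivization.mk_eq_mk_iff']
    exact ⟨1, by rw [one_smul]; exact (h v).symm⟩

lemma odd_apply_zero {v : Vec} (hodd : ∀ i, v (-i) = -v i) : v 0 = 0 := by
  have := hodd 0
  rw [neg_zero] at this
  exact self_eq_neg.mp this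

lemma odd_apply_four {v : Vec} (hodd : ∀ i, v (-i) = -v i) : v 4 = 0 := by
  have := hodd 4
  rw [show (-4 : ZMod 8) = 4 by decide] at this
  exact self_eq_neg.mp this

lemma odd_apply_five {v : Vec} (hodd : ∀ i, v (-i) = -v i) : v 5 = -v 3 := hodd 3

lemma odd_apply_six {v : Vec} (hodd : ∀ i, v (-i) = -v i) : v 6 = -v 2 := hodd 2

lemma odd_apply_seven {v : Vec} (hodd : ∀ i, v (-i) = -v i) : v 7 = -v 1 := hodd 1

/-- The stabiliser in `(ℤ/8)²` of a general point of `P^2_-` is trivial. -/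
lemma heis_mk_injective (v : Vec) (hv : v ≠ 0) (hodd : ∀ i, v (-i) = -v i) (h1 : v 1 ≠ 0)
    (h2 : v 2 ≠ 0) (h3 : v 3 ≠ 0) (h13 : v 1 ^ 8 ≠ v 3 ^ 8) :
    Function.Injective fun ab : ZMod 8 × ZMod 8 =>
      Projectivization.mk ℂ (heis ab.1 ab.2 v) (heis_ne_zero ab.1 ab.2 hv) := by
  rintro ⟨a, b⟩ ⟨a', b'⟩ h
  simp only at h
  rw [Projectivization.mk_eq_mk_iff'] at h
  obtain ⟨c, hc⟩ := h
  -- The proportionality is read at the index `a + j`, so that one side involves `v j` alone.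
  have key : ∀ j, c * (chi (b' * a) * chi (b' * j) * v (j + (a - a'))) =
      chi (b * a) * chi (b * j) * v j := by
    intro j
    have := congrFun hc (a + j)
    simp only [Pi.smul_apply, smul_eq_mul, heis_apply_complex] at this
    rw [← chi_add, ← chi_add, ← mul_add, ← mul_add, show j + (a - a') = a + j - a' by ring, this,
      add_sub_cancel_left]
  have hc0 : c ≠ 0 := by
    rintro rfl
    have := key 1
    rw [zero_mul] at this
    exact mul_ne_zero (mul_ne_zero (chi_ne_zero _) (chi_ne_zero _)) h1 this.symm
  have v0 := odd_apply_zero hodd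
  have v4 := odd_apply_four hodd
  have v5 := odd_apply_five hodd
  have v6 := odd_apply_six hodd
  have v7 := odd_apply_seven hodd
  have hz : ∀ i, v i = 0 → i = 0 ∨ i = 4 := by
    intro i hi
    fin_cases i
    · exact Or.inl rfl
    · exact absurd hi h1
    · exact absurd hi h2
    · exact absurd hi h3
    · exact Or.inr rfl
    · exact absurd (neg_eq_zero.mp (v5.symm.trans hi)) h3
    · exact absurd (neg_eq_zero.mp (v6.symm.trans hi)) h2
    · exact absurd (neg_eq_zero.mp (v7.symm.trans hi)) h1
  -- Zeros of `v` occur only at the indices 0 and 4, and index 0 must be carried to a zero, so the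
  -- shift `a - a'` is 0 or 4.
  have hshift : v (a - a') = 0 := by
    have := key 0
    rw [v0, mul_zero (chi _ * chi _), zero_add] at this
    have := (mul_eq_zero.mp this).resolve_left hc0
    exact (mul_eq_zero.mp this).resolve_left (mul_ne_zero (chi_ne_zero _) (chi_ne_zero _))
  have hp : chi (b' * a) ≠ 0 := chi_ne_zero _
  have hq : chi (b * a) ≠ 0 := chi_ne_zero _
  have hmul : ∀ e : ZMod 8, chi (e * 1) = chi e ∧ chi (e * 2) = chi e ^ 2 := by
    intro e
    rw [mul_one, mul_two, chi_add, sq]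
    exact ⟨rfl, rfl⟩
  have hb : chi b ≠ 0 := chi_ne_zero _
  have hb' : chi b' ≠ 0 := chi_ne_zero _
  have k1 := key 1
  have k2 := key 2
  rw [(hmul b).1, (hmul b').1] at k1
  rw [(hmul b).2, (hmul b').2] at k2
  rcases hz _ hshift with h | h
  · have haa : a = a' := sub_eq_zero.mp h
    rw [h, add_zero] at k1 k2
    have e1 : c * chi (b' * a) * chi b' = chi (b * a) * chi b :=
      mul_right_cancel₀ h1 (by linear_combination k1)
    have e2 : c * chi (b' * a) * chi b' ^ 2 = chi (b * a) * chi b ^ 2 :=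
      mul_right_cancel₀ h2 (by linear_combination k2)
    have e3 : chi b' = chi b :=
      mul_left_cancel₀ (mul_ne_zero hq hb) (by linear_combination e2 - chi b' * e1)
    rw [haa, chi_injective e3]
  -- A shift by 4 exchanges `v 1` and `v 3` up to sign. Comparing the relations at 1 and 2 shows
  -- that they differ by an eighth root of unity, against `h13`.
  · exfalso
    rw [h, show (1 + 4 : ZMod 8) = 5 by decide, v5] at k1
    rw [h, show (2 + 4 : ZMod 8) = 6 by decide, v6] at k2
    have e2 : -(c * chi (b' * a) * chi b' ^ 2) = chi (b * a) * chi b ^ 2 :=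
      mul_right_cancel₀ h2 (by linear_combination k2)
    have e3 : chi b * v 3 = chi b' * v 1 :=
      mul_left_cancel₀ (mul_ne_zero hq hb) (by
        linear_combination (-(v 3)) * e2 + chi b' * k1)
    apply h13
    have e4 := congrArg (· ^ 8) e3
    simp only [mul_pow, chi_pow_eight, one_mul] at e4
    exact e4.symm

lemma ncard_orbit (v : Vec) (hv : v ≠ 0) (hodd : ∀ i, v (-i) = -v i) (h1 : v 1 ≠ 0)
    (h2 : v 2 ≠ 0) (h3 : v 3 ≠ 0) (h13 : v 1 ^ 8 ≠ v 3 ^ 8) :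
    (orbit (Projectivization.mk ℂ v hv)).ncard = 64 := by
  have h : orbit (Projectivization.mk ℂ v hv) = Set.range fun ab : ZMod 8 × ZMod 8 =>
      Projectivization.mk ℂ (heis ab.1 ab.2 v) (heis_ne_zero ab.1 ab.2 hv) := by
    ext p
    rw [mem_orbit_iff]
    constructor
    · rintro ⟨a, b, rfl⟩
      exact ⟨(a, b), rfl⟩
    · rintro ⟨⟨a, b⟩, rfl⟩
      exact ⟨a, b, rfl⟩
  rw [h, ← Set.image_univ, Set.ncard_image_of_injective _ (heis_mk_injective v hv hodd h1 h2 h3 h13),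
    Set.ncard_univ]
  simp

end HeisenbergOrbit

end HeisenbergEight

namespace HeisenbergEight

open MvPolynomial AlgebraicGeometry

/-! ### The invariant quadrics through the orbit -/

noncomputable section Quadrics

open scoped Pointwise

/-- The quadratic form `A (x_t² + x_{t+4}²) + B (x_{t+1} x_{t-1} + x_{t+3} x_{t-3}) +
C x_{t+2} x_{t-2}`. -/
def qf {R : Type*} [CommRing R] (A B C : R) (t : ZMod 8) (x : ZMod 8 → R) : R :=
  A * (x t ^ 2 + x (t + 4) ^ 2) + B * (x (t + 1) * x (t + 7) + x (t + 3) * x (t + 5)) +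
    C * (x (t + 2) * x (t + 6))

lemma map_qf {R R' : Type*} [CommRing R] [CommRing R'] (φ : R →+* R') (A B C : R) (t : ZMod 8)
    (x : ZMod 8 → R) : φ (qf A B C t x) = qf (φ A) (φ B) (φ C) t (fun i => φ (x i)) := by
  simp [qf]

lemma qf_add_four {R : Type*} [CommRing R] (A B C : R) (t : ZMod 8) (x : ZMod 8 → R) :
    qf A B C (t + 4) x = qf A B C t x := by
  have h : ∀ t : ZMod 8, t + 4 + 4 = t ∧ t + 4 + 1 = t + 5 ∧ t + 4 + 7 = t + 3 ∧
    t + 4 + 3 = t + 7 ∧ t + 4 + 5 = t + 1 ∧ t + 4 + 2 = t + 6 ∧ t + 4 + 6 = t + 2 := by decide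
  obtain ⟨h1, h2, h3, h4, h5, h6, h7⟩ := h t
  simp only [qf, h1, h2, h3, h4, h5, h6, h7]
  ring

/-- Multiplying by a family that is multiplicative on pairs of given sum. -/
lemma qf_mul_shift {R : Type*} [CommRing R] (A B C e : R) (t a : ZMod 8) (x : ZMod 8 → R)
    (ψ : ZMod 8 → R) (hψ : ∀ i j, i + j = 2 * t → ψ i * ψ j = e) :
    qf A B C t (fun i => ψ i * x (i - a)) = e * qf A B C (t - a) x := by
  have hi : ∀ d : ZMod 8, t + d - a = t - a + d := fun d => by ring
  have h0 := hψ t t (by ring)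
  have h4 := hψ (t + 4) (t + 4) (by clear * -; revert t; decide)
  have h1 := hψ (t + 1) (t + 7) (by clear * -; revert t; decide)
  have h3 := hψ (t + 3) (t + 5) (by clear * -; revert t; decide)
  have h2 := hψ (t + 2) (t + 6) (by clear * -; revert t; decide)
  simp only [qf, hi]
  linear_combination A * x (t - a) ^ 2 * h0 + A * x (t - a + 4) ^ 2 * h4 +
    B * x (t - a + 1) * x (t - a + 7) * h1 + B * x (t - a + 3) * x (t - a + 5) * h3 +
    C * x (t - a + 2) * x (t - a + 6) * h2

lemma qf_heis {K : Type*} [Field K] [Algebra ℂ K] (A B C : K) (t a b : ZMod 8) (x : ZMod 8 → K) :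
    qf A B C t (heis a b x) = algebraMap ℂ K (chi (b * (2 * t))) * qf A B C (t - a) x := by
  refine qf_mul_shift A B C _ t a x (fun i => algebraMap ℂ K (chi (b * i))) fun i j hij => ?_
  rw [← map_mul, ← chi_add, ← mul_add, hij]

/-- The quadrics through the orbit of the point `v`. -/
def quadric (v : Vec) (t : ZMod 8) : Ring8 :=
  qf (C (v 1 * v 3)) (C (-v 2 ^ 2)) (C (v 1 ^ 2 + v 3 ^ 2)) t X

lemma quadric_mem_deg (v : Vec) (t : ZMod 8) : quadric v t ∈ deg 2 := by
  have h : ∀ i j : ZMod 8, (X i * X j : Ring8) ∈ deg 2 := fun i j =>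
    (isHomogeneous_X ℂ i).mul (isHomogeneous_X ℂ j)
  have hC : ∀ (c : ℂ) {f : Ring8}, f ∈ deg 2 → C c * f ∈ deg 2 := fun c f hf => by
    rw [← smul_eq_C_mul]
    exact Submodule.smul_mem _ _ hf
  simp only [quadric, qf, sq (X _)]
  exact add_mem (add_mem (hC _ (add_mem (h _ _) (h _ _))) (hC _ (add_mem (h _ _) (h _ _))))
    (hC _ (h _ _))

lemma eval_quadric (v w : Vec) (t : ZMod 8) :
    eval w (quadric v t) = qf (v 1 * v 3) (-v 2 ^ 2) (v 1 ^ 2 + v 3 ^ 2) t w := by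
  rw [quadric, map_qf]
  simp

/-- These relations dictate the coefficients of `quadric`: `t = 1` and `t = 3` both fix the ratio `C
: A`, `t = 2` fixes `B : A`, and `t = 0` is then automatic. -/
lemma qf_self {v : Vec} (hodd : ∀ i, v (-i) = -v i) (t : ZMod 8) :
    qf (v 1 * v 3) (-v 2 ^ 2) (v 1 ^ 2 + v 3 ^ 2) t v = 0 := by
  have v0 := odd_apply_zero hodd
  have v4 := odd_apply_four hodd
  have v5 := odd_apply_five hodd
  have v6 := odd_apply_six hodd
  have v7 := odd_apply_seven hodd
  have h : ∀ t : ZMod 8, t = 0 ∨ t = 1 ∨ t = 2 ∨ t = 3 ∨ t = 0 + 4 ∨ t = 1 + 4 ∨ t = 2 + 4 ∨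
    t = 3 + 4 := by decide
  have e0 : qf (v 1 * v 3) (-v 2 ^ 2) (v 1 ^ 2 + v 3 ^ 2) 0 v = 0 := by
    simp only [qf, zero_add, v0, v4, v5, v6, v7]
    ring
  have e1 : qf (v 1 * v 3) (-v 2 ^ 2) (v 1 ^ 2 + v 3 ^ 2) 1 v = 0 := by
    simp only [qf, show (1 + 4 : ZMod 8) = 5 by decide, show (1 + 1 : ZMod 8) = 2 by decide,
      show (1 + 7 : ZMod 8) = 0 by decide, show (1 + 3 : ZMod 8) = 4 by decide,
      show (1 + 5 : ZMod 8) = 6 by decide, show (1 + 2 : ZMod 8) = 3 by decide,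
      show (1 + 6 : ZMod 8) = 7 by decide, v0, v4, v5, v6, v7]
    ring
  have e2 : qf (v 1 * v 3) (-v 2 ^ 2) (v 1 ^ 2 + v 3 ^ 2) 2 v = 0 := by
    simp only [qf, show (2 + 4 : ZMod 8) = 6 by decide, show (2 + 1 : ZMod 8) = 3 by decide,
      show (2 + 7 : ZMod 8) = 1 by decide, show (2 + 3 : ZMod 8) = 5 by decide,
      show (2 + 5 : ZMod 8) = 7 by decide, show (2 + 2 : ZMod 8) = 4 by decide,
      show (2 + 6 : ZMod 8) = 0 by decide, v0, v4, v5, v6, v7]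
    ring
  have e3 : qf (v 1 * v 3) (-v 2 ^ 2) (v 1 ^ 2 + v 3 ^ 2) 3 v = 0 := by
    simp only [qf, show (3 + 4 : ZMod 8) = 7 by decide, show (3 + 1 : ZMod 8) = 4 by decide,
      show (3 + 7 : ZMod 8) = 2 by decide, show (3 + 3 : ZMod 8) = 6 by decide,
      show (3 + 5 : ZMod 8) = 0 by decide, show (3 + 2 : ZMod 8) = 5 by decide,
      show (3 + 6 : ZMod 8) = 1 by decide, v0, v4, v5, v6, v7]
    ring
  rcases h t with rfl | rfl | rfl | rfl | rfl | rfl | rfl | rfl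
  all_goals first | assumption | (rw [qf_add_four]; assumption)

lemma mem_pointIdeal_mk_iff {n : ℕ} {f : Ring8} (hf : f ∈ deg n) (v : Vec) (hv : v ≠ 0) :
    f ∈ pointIdeal (Projectivization.mk ℂ v hv) ↔ eval v f = 0 := by
  constructor
  · intro h
    refine h v ?_
    rw [Projectivization.submodule_mk]
    exact Submodule.mem_span_singleton_self _
  · intro h w hw
    rw [Projectivization.submodule_mk, Submodule.mem_span_singleton] at hw
    obtain ⟨c, rfl⟩ := hw
    have := aeval_mul_of_mem_deg c v hf
    rw [show (fun i => c * v i) = c • v from rfl, aeval_eq_eval, aeval_eq_eval] at this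
    exact this.trans (by rw [show (eval v) f = 0 from h, mul_zero])

lemma quadric_mem_orbitQuadrics {v : Vec} (hv : v ≠ 0) (hodd : ∀ i, v (-i) = -v i) (t : ZMod 8) :
    quadric v t ∈ orbitQuadrics (Projectivization.mk ℂ v hv) := by
  refine ⟨quadric_mem_deg v t, fun g hg => ?_, fun p hp => ?_⟩
  · induction hg using Subgroup.closure_induction with
    | mem g hg =>
      intro w
      rw [eval_quadric, eval_quadric]
      rcases hg with rfl | rfl
      · rw [sigma_pow_eq_heis, qf_heis, zero_mul, chi_zero, map_one, one_mul, ← qf_add_four]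
        simp
      · rw [tau_pow_eq_heis, qf_heis, sub_zero]
        have : ∀ t : ZMod 8, ((4 : ℕ) : ZMod 8) * (2 * t) = 0 := by decide
        rw [this, chi_zero, map_one, one_mul]
    | one => simp
    | mul g h _ _ ihg ihh =>
      intro w
      rw [LinearEquiv.mul_apply, ihg, ihh]
    | inv g _ ih =>
      intro w
      rw [← ih (g⁻¹ w), ← LinearEquiv.mul_apply, mul_inv_cancel]
      rfl
  · obtain ⟨a, b, rfl⟩ := (mem_orbit_iff v hv p).mp hp
    rw [mem_pointIdeal_mk_iff (quadric_mem_deg v t), eval_quadric, qf_heis, qf_self hodd, mul_zero]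

/-- A quadratic form is given by a symmetric matrix. -/
lemma exists_symm_of_mem_deg_two {f : Ring8} (hf : f ∈ deg 2) :
    ∃ Q : ZMod 8 → ZMod 8 → ℂ, (∀ i j, Q i j = Q j i) ∧
      f = ∑ i, ∑ j, C (Q i j) * (X i * X j) := by
  have h : f ∈ Submodule.span ℂ (Set.range (X : ZMod 8 → Ring8) * Set.range (X : ZMod 8 → Ring8)) := by
    rw [← Submodule.span_mul_span, ← homogeneousSubmodule_one_eq_span_X, ← sq,
      homogeneousSubmodule_one_pow]
    exact hf
  have hQ : ∃ Q : ZMod 8 → ZMod 8 → ℂ, f = ∑ i, ∑ j, C (Q i j) * (X i * X j) := by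
    clear hf
    induction h using Submodule.span_induction with
    | mem f hf =>
      obtain ⟨_, ⟨k, rfl⟩, _, ⟨l, rfl⟩, rfl⟩ := hf
      refine ⟨fun i j => if i = k then if j = l then 1 else 0 else 0, ?_⟩
      rw [Finset.sum_eq_single k (fun i _ hi => by simp [hi]) (by simp),
        Finset.sum_eq_single l (fun i _ hi => by simp [hi]) (by simp)]
      simp
    | zero => exact ⟨0, by simp⟩
    | add f g _ _ ihf ihg =>
      obtain ⟨Q, rfl⟩ := ihf
      obtain ⟨Q', rfl⟩ := ihg
      refine ⟨Q + Q', ?_⟩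
      simp only [Pi.add_apply, C_add, add_mul, Finset.sum_add_distrib]
    | smul c f _ ih =>
      obtain ⟨Q, rfl⟩ := ih
      refine ⟨c • Q, ?_⟩
      simp only [Pi.smul_apply, smul_eq_mul, C_mul, smul_eq_C_mul, Finset.mul_sum, mul_assoc]
  obtain ⟨Q, rfl⟩ := hQ
  refine ⟨fun i j => 2⁻¹ * (Q i j + Q j i), fun i j => by ring, ?_⟩
  have h1 : ∑ i, ∑ j, (C (Q j i) * (X i * X j) : Ring8) = ∑ i, ∑ j, C (Q i j) * (X i * X j) := by
    rw [Finset.sum_comm]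
    simp only [mul_comm (X _) (X _)]
  simp only [C_mul, C_add, mul_add, add_mul, Finset.sum_add_distrib, mul_assoc]
  simp only [← Finset.mul_sum]
  rw [h1, ← add_mul, ← C_add]
  norm_num

/-- A symmetric matrix is determined by its quadratic form. -/
lemma symm_eq_zero_of_forall (M : ZMod 8 → ZMod 8 → ℂ) (hM : ∀ i j, M i j = M j i)
    (h : ∀ v : Vec, ∑ i, ∑ j, M i j * (v i * v j) = 0) (i j : ZMod 8) : M i j = 0 := by
  have h1 : ∀ u w : Vec, ∑ i, ∑ j, M i j * (u i * w j) = 0 := by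
    intro u w
    have e1 : ∑ i, ∑ j, M i j * (w i * u j) = ∑ i, ∑ j, M i j * (u i * w j) := by
      rw [Finset.sum_comm]
      refine Finset.sum_congr rfl fun i _ => Finset.sum_congr rfl fun j _ => ?_
      rw [hM j i, mul_comm (w j)]
    have e2 := h (u + w)
    simp only [Pi.add_apply, add_mul, mul_add, Finset.sum_add_distrib] at e2
    have e3 := h u
    have e4 := h w
    rw [e3, e4, e1] at e2
    linear_combination e2 / 2
  have h2 := h1 (Pi.single i 1) (Pi.single j 1)
  rw [Finset.sum_eq_single i (fun k _ hk => by simp [hk]) (by simp),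
    Finset.sum_eq_single j (fun k _ hk => by simp [hk]) (by simp)] at h2
  simpa using h2

lemma sum_chi_mul (s : ZMod 8) : ∑ b : ZMod 8, chi (b * s) = if s = 0 then 8 else 0 := by
  split_ifs with hs
  · simp [hs, chi_zero]
  · have h1 : (∑ b : ZMod 8, chi (b * s)) * chi s = ∑ b : ZMod 8, chi (b * s) := by
      rw [Finset.sum_mul, ← Equiv.sum_comp (Equiv.addRight (1 : ZMod 8)) fun b => chi (b * s)]
      refine Finset.sum_congr rfl fun b _ => ?_
      rw [Equiv.coe_addRight, add_mul, one_mul, chi_add]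
    have h2 : chi s - 1 ≠ 0 := fun h => hs (chi_injective (by rw [chi_zero]; linear_combination h))
    exact (mul_eq_zero.mp (by linear_combination h1 : (∑ b : ZMod 8, chi (b * s)) * (chi s - 1) = 0)
      ).resolve_right h2

lemma sum_zmod_eight {M : Type*} [AddCommMonoid M] (f : ZMod 8 → M) :
    ∑ i, f i = f 0 + f 1 + f 2 + f 3 + f 4 + f 5 + f 6 + f 7 :=
  Fin.sum_univ_eight f

/-- A form `∑_d q_d x_{t+d} x_{t-d}` with `q_{-d} = q_d = q_{d+4}`. -/
lemma sum_eq_qf {R : Type*} [CommRing R] (q : ZMod 8 → R) (hneg : ∀ d, q (-d) = q d)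
    (hfour : ∀ d, q (d + 4) = q d) (t : ZMod 8) (x : ZMod 8 → R) :
    ∑ d, q d * (x (t + d) * x (t - d)) = qf (q 0) (2 * q 1) (2 * q 2) t x := by
  have h : ∀ t : ZMod 8, t - 1 = t + 7 ∧ t - 2 = t + 6 ∧ t - 3 = t + 5 ∧ t - 4 = t + 4 ∧
    t - 5 = t + 3 ∧ t - 6 = t + 2 ∧ t - 7 = t + 1 := by decide
  obtain ⟨h1, h2, h3, h4, h5, h6, h7⟩ := h t
  have q3 : q 3 = q 1 := (hneg 3).symm.trans (hfour 1)
  have q4 : q 4 = q 0 := hfour 0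
  have q5 : q 5 = q 1 := hfour 1
  have q6 : q 6 = q 2 := hfour 2
  have q7 : q 7 = q 1 := hneg 1
  rw [sum_zmod_eight, h1, h2, h3, h4, h5, h6, h7, q3, q4, q5, q6, q7, add_zero, sub_zero, qf]
  ring

/-- Invariance restricts the symmetric matrix of `f` to even weights with 4-periodic coefficients.
Vanishing on the orbit, separated by weight, forces each weight component to be a multiple of one
quadric. -/
lemma mem_span_quadric {v : Vec} (hv : v ≠ 0) (hodd : ∀ i, v (-i) = -v i) (h1 : v 1 ≠ 0)
    (h3 : v 3 ≠ 0) {f : Ring8}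
    (hf : f ∈ orbitQuadrics (Projectivization.mk ℂ v hv)) :
    f ∈ Ideal.span (Set.range fun k : Fin 4 => quadric v (k.val : ZMod 8)) := by
  obtain ⟨hf2, hinv, hvan⟩ := hf
  obtain ⟨Q, hQ, hfQ⟩ := exists_symm_of_mem_deg_two hf2
  have heval : ∀ w : Vec, eval w f = ∑ i, ∑ j, Q i j * (w i * w j) := by
    intro w
    rw [hfQ]
    simp
  have hQ4 : ∀ i j, Q (i + 4) (j + 4) = Q i j := by
    intro i j
    rw [← sub_eq_zero]
    refine symm_eq_zero_of_forall (fun i j => Q (i + 4) (j + 4) - Q i j)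
      (fun i j => by rw [hQ, hQ i j]) (fun w => ?_) i j
    have e1 := hinv (sigma ^ 4) (Subgroup.subset_closure (by simp)) w
    rw [heval, heval, sigma_pow_eq_heis] at e1
    simp only [sub_mul, Finset.sum_sub_distrib]
    rw [sub_eq_zero, ← e1, ← Equiv.sum_comp (Equiv.addRight (4 : ZMod 8)) fun i => ∑ j, Q i j * _]
    refine Finset.sum_congr rfl fun i _ => ?_
    rw [← Equiv.sum_comp (Equiv.addRight (4 : ZMod 8)) fun j => Q _ j * _]
    simp [heis_apply_complex, chi_zero]
  have hQodd : ∀ i j, chi (4 * (i + j)) ≠ 1 → Q i j = 0 := by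
    intro i j hij
    have e0 := symm_eq_zero_of_forall (fun i j => (chi (4 * (i + j)) - 1) * Q i j)
      (fun i j => by rw [hQ, add_comm]) (fun w => ?_) i j
    · exact (mul_eq_zero.mp e0).resolve_left (sub_ne_zero.mpr hij)
    · have e1 := hinv (tau ^ 4) (Subgroup.subset_closure (by simp)) w
      rw [heval, heval, tau_pow_eq_heis] at e1
      simp only [sub_mul, Finset.sum_sub_distrib]
      simp only [one_mul]
      rw [sub_eq_zero, ← e1]
      refine Finset.sum_congr rfl fun i _ => Finset.sum_congr rfl fun j _ => ?_
      rw [heis_apply_complex, heis_apply_complex, mul_add, chi_add, sub_zero, sub_zero]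
      push_cast
      ring
  -- Fourier inversion over the `τ`-translates: weighting the vanishing at `heis (t - s) b v` by
  -- `chi (-2tb)` and summing over `b` isolates the pairs with `i + j = 2t`, up to the factor 8.
  have hfour : ∀ t s : ZMod 8, ∑ d, Q (t + d) (t - d) * (v (s + d) * v (s - d)) = 0 := by
    intro t s
    have e1 : ∀ b : ZMod 8, ∑ i, ∑ j, Q i j * (chi (b * i) * chi (b * j) *
        (v (i - (t - s)) * v (j - (t - s)))) = 0 := by
      intro b
      have e2 := (mem_pointIdeal_mk_iff hf2 _ _).mp
        (hvan _ ((mem_orbit_iff v hv _).mpr ⟨t - s, b, rfl⟩))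
      rw [heval] at e2
      rw [← e2]
      refine Finset.sum_congr rfl fun i _ => Finset.sum_congr rfl fun j _ => ?_
      rw [heis_apply_complex, heis_apply_complex]
      ring
    have e3 : ∑ b : ZMod 8, chi (b * (-(2 * t))) * ∑ i, ∑ j, Q i j * (chi (b * i) * chi (b * j) *
        (v (i - (t - s)) * v (j - (t - s)))) = 0 := by
      simp only [e1, mul_zero, Finset.sum_const_zero]
    have e4 : ∑ i, ∑ j, Q i j * (v (i - (t - s)) * v (j - (t - s))) *
        ∑ b : ZMod 8, chi (b * (j - (2 * t - i))) = 0 := by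
      rw [← e3]
      simp only [Finset.mul_sum]
      rw [Finset.sum_comm (f := fun b i => ∑ j, chi (b * (-(2 * t))) * (Q i j * (chi (b * i) *
        chi (b * j) * (v (i - (t - s)) * v (j - (t - s))))))]
      refine Finset.sum_congr rfl fun i _ => ?_
      rw [Finset.sum_comm]
      refine Finset.sum_congr rfl fun b _ => Finset.sum_congr rfl fun j _ => ?_
      rw [show b * (j - (2 * t - i)) = b * (-(2 * t)) + b * i + b * j by ring, chi_add, chi_add]
      ring
    simp only [sum_chi_mul, sub_eq_zero] at e4
    simp only [mul_ite, mul_zero, Finset.sum_ite_eq', Finset.mem_univ, if_true] at e4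
    rw [← Equiv.sum_comp (Equiv.addLeft t)] at e4
    have e5 := congrArg (· / 8) e4
    simp only [Finset.sum_div, zero_div] at e5
    rw [← e5]
    refine Finset.sum_congr rfl fun d _ => ?_
    simp only [Equiv.coe_addLeft]
    rw [show t + d - (t - s) = s + d by ring, show 2 * t - (t + d) = t - d by ring,
      show t - d - (t - s) = s - d by ring]
    ring
  have hA : v 1 * v 3 ≠ 0 := mul_ne_zero h1 h3
  have v0 := odd_apply_zero hodd
  have v4 := odd_apply_four hodd
  have v5 := odd_apply_five hodd
  have v6 := odd_apply_six hodd
  have v7 := odd_apply_seven hodd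
  have hcomp : ∀ t : ZMod 8, ∑ d, C (Q (t + d) (t - d)) * (X (t + d) * X (t - d)) =
      C (Q t t / (v 1 * v 3)) * quadric v t := by
    intro t
    have hn : ∀ d, Q (t + -d) (t - -d) = Q (t + d) (t - d) := fun d => by
      rw [hQ, sub_neg_eq_add, ← sub_eq_add_neg]
    have hf' : ∀ d, Q (t + (d + 4)) (t - (d + 4)) = Q (t + d) (t - d) := fun d => by
      rw [← hQ4 (t + d), show t - (d + 4) = t - d + 4 by clear * -; revert t d; decide, add_assoc]
    have hsum : ∀ s, qf (Q (t + 0) (t - 0)) (2 * Q (t + 1) (t - 1)) (2 * Q (t + 2) (t - 2)) s v = 0 := by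
      intro s
      rw [← hfour t s]
      exact (sum_eq_qf (fun d => Q (t + d) (t - d)) hn hf' s v).symm
    -- Because `v` is odd, `s = 1` involves only the first and third coefficients and `s = 2` only
    -- the first two; both are solved in terms of `Q t t`, using `v 1 * v 3 ≠ 0`.
    have s1 := hsum 1
    have s2 := hsum 2
    simp only [qf, show (1 + 4 : ZMod 8) = 5 by decide, show (1 + 1 : ZMod 8) = 2 by decide,
      show (1 + 7 : ZMod 8) = 0 by decide, show (1 + 3 : ZMod 8) = 4 by decide,
      show (1 + 5 : ZMod 8) = 6 by decide, show (1 + 2 : ZMod 8) = 3 by decide,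
      show (1 + 6 : ZMod 8) = 7 by decide, v0, v4, v5, v7] at s1
    simp only [qf, show (2 + 4 : ZMod 8) = 6 by decide, show (2 + 1 : ZMod 8) = 3 by decide,
      show (2 + 7 : ZMod 8) = 1 by decide, show (2 + 3 : ZMod 8) = 5 by decide,
      show (2 + 5 : ZMod 8) = 7 by decide, show (2 + 2 : ZMod 8) = 4 by decide,
      show (2 + 6 : ZMod 8) = 0 by decide, v0, v4, v5, v6, v7] at s2
    rw [add_zero, sub_zero] at s1 s2
    have c0 : Q t t = Q t t / (v 1 * v 3) * (v 1 * v 3) := by field_simp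
    have c1 : 2 * Q (t + 1) (t - 1) = Q t t / (v 1 * v 3) * (-v 2 ^ 2) := by
      rw [div_mul_eq_mul_div, eq_div_iff hA]
      linear_combination s2 / 2
    have c2 : 2 * Q (t + 2) (t - 2) = Q t t / (v 1 * v 3) * (v 1 ^ 2 + v 3 ^ 2) := by
      rw [div_mul_eq_mul_div, eq_div_iff hA]
      linear_combination -s1
    have e1 := sum_eq_qf (fun d => (C (Q (t + d) (t - d)) : Ring8)) (fun d => by rw [hn])
      (fun d => by rw [hf']) t X
    rw [e1, quadric, add_zero, sub_zero]
    have d0 := congrArg (C : ℂ → Ring8) c0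
    have d1 := congrArg (C : ℂ → Ring8) c1
    have d2 := congrArg (C : ℂ → Ring8) c2
    rw [C_mul] at d0
    rw [C_mul, C_mul, show (C (2 : ℂ) : Ring8) = 2 from rfl] at d1 d2
    simp only [qf]
    linear_combination (X t ^ 2 + X (t + 4) ^ 2) * d0 +
      (X (t + 1) * X (t + 7) + X (t + 3) * X (t + 5)) * d1 + X (t + 2) * X (t + 6) * d2
  -- The monomials are regrouped by the weight `s = i + j`; odd weights vanish, and the even ones
  -- are indexed by `t = 0, 1, 2, 3`.
  have hfsum : f = ∑ s : ZMod 8, ∑ i, C (Q i (s - i)) * (X i * X (s - i)) := by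
    rw [hfQ, Finset.sum_comm (f := fun s i => C (Q i (s - i)) * (X i * X (s - i)))]
    refine Finset.sum_congr rfl fun i _ => ?_
    rw [← Equiv.sum_comp (Equiv.subRight i)]
    rfl
  have heven : ∀ t : ZMod 8, ∑ i, C (Q i (2 * t - i)) * (X i * X (2 * t - i)) =
      C (Q t t / (v 1 * v 3)) * quadric v t := by
    intro t
    rw [← hcomp t, ← Equiv.sum_comp (Equiv.addLeft t)]
    refine Finset.sum_congr rfl fun d _ => ?_
    simp only [Equiv.coe_addLeft]
    rw [show 2 * t - (t + d) = t - d by ring]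
  have hodd' : ∀ s : ZMod 8, 4 * s = 4 → ∑ i, C (Q i (s - i)) * (X i * X (s - i) : Ring8) = 0 := by
    intro s hs
    refine Finset.sum_eq_zero fun i _ => ?_
    rw [hQodd, C_0, zero_mul]
    rw [add_sub_cancel, hs, chi_four]
    norm_num
  have hmem : ∀ (k : Fin 4) (c : Ring8), c * quadric v (k.val : ZMod 8) ∈
      Ideal.span (Set.range fun k : Fin 4 => quadric v (k.val : ZMod 8)) := fun k c =>
    Ideal.mul_mem_left _ _ (Ideal.subset_span ⟨k, rfl⟩)
  rw [hfsum, sum_zmod_eight, hodd' 1 (by decide), hodd' 3 (by decide), hodd' 5 (by decide),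
    hodd' 7 (by decide)]
  have t0 := heven 0
  have t1 := heven 1
  have t2 := heven 2
  have t3 := heven 3
  rw [show (2 * 0 : ZMod 8) = 0 by decide] at t0
  rw [show (2 * 1 : ZMod 8) = 2 by decide] at t1
  rw [show (2 * 2 : ZMod 8) = 4 by decide] at t2
  rw [show (2 * 3 : ZMod 8) = 6 by decide] at t3
  rw [t0, t1, t2, t3]
  simp only [add_zero]
  exact add_mem (add_mem (add_mem (hmem 0 _) (hmem 1 _)) (hmem 2 _)) (hmem 3 _)

lemma toIdeal_idealV8 {v : Vec} (hv : v ≠ 0) (hodd : ∀ i, v (-i) = -v i) (h1 : v 1 ≠ 0)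
    (h3 : v 3 ≠ 0) :
    (idealV8 (Projectivization.mk ℂ v hv)).toIdeal =
      Ideal.span (Set.range fun k : Fin 4 => quadric v (k.val : ZMod 8)) := by
  refine le_antisymm (Ideal.span_le.mpr fun f hf => mem_span_quadric hv hodd h1 h3 hf) ?_
  refine Ideal.span_mono ?_
  rintro _ ⟨k, rfl⟩
  exact quadric_mem_orbitQuadrics hv hodd _

end Quadrics

end HeisenbergEight

namespace HeisenbergEight

open MvPolynomial AlgebraicGeometry

/-! ### Linear algebra of the binary blocks -/

section SingularPoints

variable {K : Type*} [Field K]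

/-- A symmetric 2 by 2 matrix with rows `(2a, c)` and `(c, 2b)` that kills a non-zero vector has
determinant zero. -/
lemma four_mul_eq_sq_of_kernel {a b c x y : K} (h1 : 2 * x * a + c * y = 0)
    (h2 : 2 * y * b + c * x = 0) (h : ¬(x = 0 ∧ y = 0)) : 4 * a * b = c ^ 2 := by
  have e1 : x * (4 * a * b - c ^ 2) = 0 := by linear_combination 2 * b * h1 - c * h2
  have e2 : y * (4 * a * b - c ^ 2) = 0 := by linear_combination 2 * a * h2 - c * h1
  by_contra hne
  have h3 : 4 * a * b - c ^ 2 ≠ 0 := sub_ne_zero.mpr hne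
  exact h ⟨(mul_eq_zero.mp e1).resolve_right h3, (mul_eq_zero.mp e2).resolve_right h3⟩

variable {al be B : K}

/-- The four nondegenerate binary blocks of a singular quadric cannot all be degenerate. -/
lemma false_of_blocks_degenerate (hB : B ≠ 0) (hgen : 16 * al ^ 4 ≠ 16 * be ^ 4 + B ^ 4)
    {L₁ L₂ L₃ L₄ : K} (hL : ¬(L₁ = 0 ∧ L₂ = 0 ∧ L₃ = 0 ∧ L₄ = 0))
    (d1 : 4 * (L₁ * al + L₂ * be) * (L₁ * al - L₂ * be) = (L₃ * B) ^ 2)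
    (d2 : 4 * (L₃ * al + L₄ * be) * (L₃ * al - L₄ * be) = (L₁ * B) ^ 2)
    (d3 : 4 * (L₁ * be + L₂ * al) * (L₁ * be - L₂ * al) = (L₄ * B) ^ 2)
    (d4 : 4 * (L₃ * be + L₄ * al) * (L₃ * be - L₄ * al) = (L₂ * B) ^ 2) : False := by
  have hg : 16 * al ^ 4 - 16 * be ^ 4 - B ^ 4 ≠ 0 := fun h => hgen (by linear_combination h)
  -- The four determinants are linear in the squares of the `L_i`; this combination eliminates all
  -- of them except `L₄²`.
  have e4 : (16 * al ^ 4 - 16 * be ^ 4 - B ^ 4) * L₄ ^ 2 = 0 := by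
    linear_combination B ^ 2 * d3 + 4 * be ^ 2 * d2 - 4 * al ^ 2 * d4
  have z4 : L₄ = 0 := by simpa [hg] using e4
  subst z4
  have e3 : (16 * al ^ 4 - 16 * be ^ 4 - B ^ 4) * L₃ ^ 2 = 0 := by
    linear_combination B ^ 2 * d1 + 4 * al ^ 2 * d2 - 4 * be ^ 2 * d4
  have z3 : L₃ = 0 := by simpa [hg] using e3
  subst z3
  have z1 : L₁ = 0 := by simpa [hB] using d2.symm
  have z2 : L₂ = 0 := by simpa [hB] using d4.symm
  exact hL ⟨z1, z2, rfl, rfl⟩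

/-- The points of the complete intersection at which one of the four blocks vanishes. -/
lemma singular_of_block_eq_zero [CharZero K] (hal : al ≠ 0) (hbe : be ≠ 0) (hB : B ≠ 0)
    (h1 : 16 * al ^ 4 ≠ B ^ 4) (h2 : al ^ 4 ≠ be ^ 4) (h3 : 16 * be ^ 4 + B ^ 4 ≠ 0)
    (hgen : 16 * al ^ 4 ≠ 16 * be ^ 4 + B ^ 4) {u₁ u₃ v₀ v₁ v₂ v₃ L₁ L₂ L₃ L₄ : K}
    (g1 : B * (u₁ * u₃) + be * (v₀ ^ 2 + v₂ ^ 2) = 0)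
    (g2 : al * (v₀ ^ 2 - v₂ ^ 2) - B * (v₁ * v₃) = 0)
    (g3 : al * (u₁ ^ 2 + u₃ ^ 2) + be * (v₁ ^ 2 + v₃ ^ 2) = 0)
    (g4 : be * (u₁ ^ 2 - u₃ ^ 2) + al * (v₁ ^ 2 - v₃ ^ 2) + B * (v₀ * v₂) = 0)
    (hx : ¬(u₁ = 0 ∧ u₃ = 0 ∧ v₀ = 0 ∧ v₁ = 0 ∧ v₂ = 0 ∧ v₃ = 0))
    (hL : ¬(L₁ = 0 ∧ L₂ = 0 ∧ L₃ = 0 ∧ L₄ = 0))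
    (b2 : 2 * u₁ * (L₃ * al + L₄ * be) + L₁ * B * u₃ = 0)
    (b2' : 2 * u₃ * (L₃ * al - L₄ * be) + L₁ * B * u₁ = 0)
    (b3 : 2 * v₀ * (L₁ * be + L₂ * al) + L₄ * B * v₂ = 0)
    (b3' : 2 * v₂ * (L₁ * be - L₂ * al) + L₄ * B * v₀ = 0)
    (b4 : 2 * v₁ * (L₃ * be + L₄ * al) + -(L₂ * B) * v₃ = 0)
    (b4' : 2 * v₃ * (L₃ * be - L₄ * al) + -(L₂ * B) * v₁ = 0) :
    v₂ = 0 ∧ v₀ ≠ 0 ∨ v₀ = 0 ∧ v₂ ≠ 0 ∧ ∃ ε : K, (ε = 1 ∨ ε = -1) ∧ v₃ = ε * v₁ ∧ u₃ = -ε * u₁ ∧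
      be * v₂ ^ 2 = ε * B * u₁ ^ 2 ∧ al * v₂ ^ 2 = -ε * B * v₁ ^ 2 := by
  -- With `u₀ = u₂ = 0`, none of the other three components vanishes: the equations would force a
  -- zero point, excluded by `h1`, `h2` and `h3` in turn. So the three remaining blocks are
  -- degenerate.
  have n2 : ¬(u₁ = 0 ∧ u₃ = 0) := by
    rintro ⟨rfl, rfl⟩
    have e1 : v₂ ^ 2 = -v₀ ^ 2 := mul_left_cancel₀ hbe (by linear_combination g1)
    have e3 : v₃ ^ 2 = -v₁ ^ 2 := mul_left_cancel₀ hbe (by linear_combination g3)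
    have e2 : 2 * al * v₀ ^ 2 = B * (v₁ * v₃) := by linear_combination g2 + al * e1
    have e4 : 2 * al * v₁ ^ 2 = -B * (v₀ * v₂) := by linear_combination g4 + al * e3
    have e5 : (16 * al ^ 4 - B ^ 4) * v₀ ^ 4 = 0 := by
      linear_combination 4 * al ^ 2 * (2 * al * v₀ ^ 2 + B * (v₁ * v₃)) * e2 +
        4 * al ^ 2 * B ^ 2 * v₁ ^ 2 * e3 - B ^ 2 * (2 * al * v₁ ^ 2 - B * (v₀ * v₂)) * e4
        - B ^ 4 * v₀ ^ 2 * e1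
    have z0 : v₀ = 0 := by simpa [sub_ne_zero.mpr h1] using e5
    subst z0
    have z2 : v₂ = 0 := by simpa using e1
    subst z2
    have z1 : v₁ = 0 := by simpa [hal] using e4
    subst z1
    have z3 : v₃ = 0 := by simpa using e3
    exact hx ⟨rfl, rfl, rfl, rfl, rfl, z3⟩
  have n3 : ¬(v₀ = 0 ∧ v₂ = 0) := by
    rintro ⟨rfl, rfl⟩
    have e1 : u₁ * u₃ = 0 := by simpa [hB] using g1
    have e2 : v₁ * v₃ = 0 := by simpa [hB] using g2
    have hd1 : al ^ 2 - be ^ 2 ≠ 0 := fun h => h2 (by linear_combination (al ^ 2 + be ^ 2) * h)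
    have hd2 : al ^ 2 + be ^ 2 ≠ 0 := fun h => h2 (by linear_combination (al ^ 2 - be ^ 2) * h)
    rcases mul_eq_zero.mp e1 with rfl | rfl <;> rcases mul_eq_zero.mp e2 with rfl | rfl
    · have f1 : (al ^ 2 - be ^ 2) * u₃ ^ 2 = 0 := by linear_combination al * g3 + be * g4
      have f2 : (al ^ 2 - be ^ 2) * v₃ ^ 2 = 0 := by linear_combination -be * g3 - al * g4
      exact hx ⟨rfl, by simpa [hd1] using f1, rfl, rfl, rfl, by simpa [hd1] using f2⟩
    · have f1 : (al ^ 2 + be ^ 2) * u₃ ^ 2 = 0 := by linear_combination al * g3 - be * g4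
      have f2 : (al ^ 2 + be ^ 2) * v₁ ^ 2 = 0 := by linear_combination be * g3 + al * g4
      exact hx ⟨rfl, by simpa [hd2] using f1, rfl, by simpa [hd2] using f2, rfl, rfl⟩
    · have f1 : (al ^ 2 + be ^ 2) * u₁ ^ 2 = 0 := by linear_combination al * g3 + be * g4
      have f2 : (al ^ 2 + be ^ 2) * v₃ ^ 2 = 0 := by linear_combination be * g3 - al * g4
      exact hx ⟨by simpa [hd2] using f1, rfl, rfl, rfl, rfl, by simpa [hd2] using f2⟩
    · have f1 : (al ^ 2 - be ^ 2) * u₁ ^ 2 = 0 := by linear_combination al * g3 - be * g4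
      have f2 : (al ^ 2 - be ^ 2) * v₁ ^ 2 = 0 := by linear_combination -be * g3 + al * g4
      exact hx ⟨by simpa [hd1] using f1, rfl, rfl, by simpa [hd1] using f2, rfl, rfl⟩
  have n4 : ¬(v₁ = 0 ∧ v₃ = 0) := by
    rintro ⟨rfl, rfl⟩
    have e2 : v₂ ^ 2 = v₀ ^ 2 := mul_left_cancel₀ hal (by linear_combination -g2)
    have e3 : u₃ ^ 2 = -u₁ ^ 2 := mul_left_cancel₀ hal (by linear_combination g3)
    have e1 : 2 * be * v₀ ^ 2 = -B * (u₁ * u₃) := by linear_combination g1 - be * e2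
    have e4 : 2 * be * u₁ ^ 2 = -B * (v₀ * v₂) := by linear_combination g4 + be * e3
    have e5 : (16 * be ^ 4 + B ^ 4) * v₀ ^ 4 = 0 := by
      linear_combination 4 * be ^ 2 * (2 * be * v₀ ^ 2 - B * (u₁ * u₃)) * e1 +
        4 * be ^ 2 * B ^ 2 * u₁ ^ 2 * e3 - B ^ 2 * (2 * be * u₁ ^ 2 - B * (v₀ * v₂)) * e4
        - B ^ 4 * v₀ ^ 2 * e2
    have z0 : v₀ = 0 := by simpa [h3] using e5
    subst z0
    have z2 : v₂ = 0 := by simpa using e2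
    exact n3 ⟨rfl, z2⟩
  have d2 := four_mul_eq_sq_of_kernel b2 b2' n2
  have d3 := four_mul_eq_sq_of_kernel b3 b3' n3
  have d4 := four_mul_eq_sq_of_kernel b4 b4' n4
  have hg : 16 * al ^ 4 - 16 * be ^ 4 - B ^ 4 ≠ 0 := fun h => hgen (by linear_combination h)
  have e4 : (16 * al ^ 4 - 16 * be ^ 4 - B ^ 4) * L₄ ^ 2 = 0 := by
    linear_combination B ^ 2 * d3 + 4 * be ^ 2 * d2 - 4 * al ^ 2 * d4
  have z4 : L₄ = 0 := by simpa [hg] using e4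
  subst z4
  have hL3 : L₃ ≠ 0 := by
    rintro rfl
    have z1 : L₁ = 0 := by simpa [hB] using d2.symm
    have z2 : L₂ = 0 := by simpa [hB] using d4.symm
    exact hL ⟨z1, z2, rfl, rfl⟩
  rcases eq_or_ne v₂ 0 with hv2 | hv2
  · exact Or.inl ⟨hv2, fun h => n3 ⟨h, hv2⟩⟩
  refine Or.inr ?_
  -- With `L₄ = 0` the block of `(v₀, v₂)` is diagonal, so `v₂ ≠ 0` kills one of its entries; the
  -- other is then non-zero and gives `v₀ = 0`.
  have f1 : L₁ * be = L₂ * al := by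
    have : v₂ * (L₁ * be - L₂ * al) = 0 := by linear_combination b3' / 2
    linear_combination (mul_eq_zero.mp this).resolve_left hv2
  have hL2 : L₂ ≠ 0 := by
    rintro rfl
    have : L₃ * be = 0 := by simpa using d4
    exact mul_ne_zero hL3 hbe this
  have z0 : v₀ = 0 := by
    have : v₀ * (L₂ * al) = 0 := by linear_combination b3 / 4 - v₀ / 2 * f1
    exact (mul_eq_zero.mp this).resolve_right (mul_ne_zero hL2 hal)
  subst z0
  have hden : 2 * L₃ * be ≠ 0 := mul_ne_zero (mul_ne_zero two_ne_zero hL3) hbe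
  -- The degenerate block `d4` now says `(2 L₃ be)² = (L₂ B)²`, so this ratio is a sign.
  obtain ⟨ε, hε⟩ : ∃ ε, L₂ * B = ε * (2 * L₃ * be) := ⟨_, (div_mul_cancel₀ _ hden).symm⟩
  have hε1 : ε = 1 ∨ ε = -1 := by
    have h : (2 * L₃ * be) ^ 2 * ((ε - 1) * (ε + 1)) = 0 := by
      linear_combination -(L₂ * B + ε * (2 * L₃ * be)) * hε - d4
    rcases mul_eq_zero.mp ((mul_eq_zero.mp h).resolve_left (pow_ne_zero 2 hden)) with h | h
    · exact Or.inl (sub_eq_zero.mp h)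
    · exact Or.inr (eq_neg_of_add_eq_zero_left h)
  have hv3 : v₃ = ε * v₁ := by
    refine mul_left_cancel₀ hden ?_
    linear_combination b4' + v₁ * hε
  have hu3 : u₃ = -ε * u₁ := by
    refine mul_left_cancel₀ (mul_ne_zero hden hal) ?_
    linear_combination be * b2' - B * u₁ * f1 - al * u₁ * hε
  refine ⟨rfl, hv2, ε, hε1, hv3, hu3, ?_, ?_⟩
  · subst hu3
    linear_combination g1
  · subst hv3
    linear_combination -g2

end SingularPoints

/-! ### Singular points of the complete intersection over an extension field -/

noncomputable section SingularOrbit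

/-- The polar form of `qf`. -/
def pol {R : Type*} [CommRing R] (A B C : R) (t : ZMod 8) (x w : ZMod 8 → R) : R :=
  A * (2 * x t * w t + 2 * x (t + 4) * w (t + 4)) +
    B * (x (t + 1) * w (t + 7) + w (t + 1) * x (t + 7) +
      (x (t + 3) * w (t + 5) + w (t + 3) * x (t + 5))) +
    C * (x (t + 2) * w (t + 6) + w (t + 2) * x (t + 6))

lemma pol_eq {R : Type*} [CommRing R] (A B C : R) (t : ZMod 8) (x w : ZMod 8 → R) :
    pol A B C t x w = qf A B C t (x + w) - qf A B C t x - qf A B C t w := by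
  simp only [pol, qf, Pi.add_apply]
  ring

variable {K : Type*} [Field K] [Algebra ℂ K]

lemma heis_add (a b : ZMod 8) (x w : ZMod 8 → K) :
    heis a b (x + w) = heis a b x + heis a b w := by
  funext i
  simp only [heis_apply, Pi.add_apply]
  ring

lemma pol_heis (A B C : K) (t a b : ZMod 8) (x w : ZMod 8 → K) :
    pol A B C t (heis a b x) (heis a b w) =
      algebraMap ℂ K (chi (b * (2 * t))) * pol A B C (t - a) x w := by
  rw [pol_eq, ← heis_add, qf_heis, qf_heis, qf_heis, pol_eq]
  ring

lemma exists_heis_eq (a b : ZMod 8) (w : ZMod 8 → K) : ∃ w', w = heis a b w' := by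
  have h : algebraMap ℂ K (chi (-(-b * a))) ≠ 0 := (map_ne_zero _).mpr (chi_ne_zero _)
  refine ⟨(algebraMap ℂ K (chi (-(-b * a))))⁻¹ • heis (-a) (-b) w, ?_⟩
  rw [heis_smul, heis_heis, smul_smul, inv_mul_cancel₀ h, one_smul, add_neg_cancel,
    add_neg_cancel, heis_zero_zero]

/-- The condition that a member of the net of quadrics is singular at `x`. -/
def IsSing (A B C : K) (x : ZMod 8 → K) : Prop :=
  (∀ t, qf A B C t x = 0) ∧ ∃ lam : ZMod 8 → K, (∀ t, lam (t + 4) = lam t) ∧ lam ≠ 0 ∧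
    ∀ w, ∑ t, lam t * pol A B C t x w = 0

/-- The Heisenberg group permutes the quadrics up to characters, so the coefficients of the singular
member are shifted by `a` and rescaled by the inverse character. -/
lemma IsSing.translate {A B C : K} {x : ZMod 8 → K} (h : IsSing A B C x) (a b : ZMod 8) :
    IsSing A B C (heis a b x) := by
  obtain ⟨h0, lam, h4, hlam, hw⟩ := h
  have hne : ∀ i, algebraMap ℂ K (chi i) ≠ 0 := fun i => (map_ne_zero _).mpr (chi_ne_zero _)
  refine ⟨fun t => by rw [qf_heis, h0, mul_zero],
    fun t => (algebraMap ℂ K (chi (b * (2 * t))))⁻¹ * lam (t - a), fun t => ?_, fun h => ?_,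
    fun w => ?_⟩
  · simp only
    rw [show t + 4 - a = t - a + 4 by ring, h4,
      show b * (2 * (t + 4)) = b * (2 * t) by clear * -; revert t b; decide]
  · apply hlam
    funext t
    have := congrFun h (t + a)
    simpa [hne] using this
  · obtain ⟨w, rfl⟩ := exists_heis_eq a b w
    rw [← hw w, ← Equiv.sum_comp (Equiv.subRight a) fun t => lam t * _]
    refine Finset.sum_congr rfl fun t _ => ?_
    rw [pol_heis, Equiv.subRight_apply]
    have := hne (b * (2 * t))
    field_simp

/-- The multiples of the translates of `y`. -/
def InOrbit (y : Vec) (x : ZMod 8 → K) : Prop :=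
  ∃ (c : K) (a b : ZMod 8), x = c • heis a b (fun i => algebraMap ℂ K (y i))

lemma InOrbit.of_heis {y : Vec} {x : ZMod 8 → K} (a b : ZMod 8) (h : InOrbit y (heis a b x)) :
    InOrbit y x := by
  obtain ⟨c, a', b', h⟩ := h
  have h1 := heis_heis (-a) (-b) a b x
  have hne : algebraMap ℂ K (chi (-(b * -a))) ≠ 0 := (map_ne_zero _).mpr (chi_ne_zero _)
  rw [neg_add_cancel, neg_add_cancel, heis_zero_zero, h, heis_smul, heis_heis, smul_smul] at h1
  refine ⟨(algebraMap ℂ K (chi (-(b * -a))))⁻¹ * (c * algebraMap ℂ K (chi (-(b' * -a)))), -a + a',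
    -b + b', ?_⟩
  rw [mul_smul, h1, smul_smul, inv_mul_cancel₀ hne, one_smul]

/-- Genericity conditions on the parameters `m = (y₁ + y₃) / 2`, `n = (y₁ - y₃) / 2`, `k = y₂`. -/
structure Generic (m n k : K) : Prop where
  m_ne : m ≠ 0
  n_ne : n ≠ 0
  k_ne : k ≠ 0
  ne₁ : 16 * m ^ 8 ≠ k ^ 8
  ne₂ : m ^ 8 ≠ n ^ 8
  ne₃ : 16 * n ^ 8 + k ^ 8 ≠ 0
  ne₄ : 16 * m ^ 8 ≠ 16 * n ^ 8 + k ^ 8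

lemma qf_zero {R : Type*} [CommRing R] (A B C : R) (x : ZMod 8 → R) : qf A B C 0 x =
    A * (x 0 ^ 2 + x 4 ^ 2) + B * (x 1 * x 7 + x 3 * x 5) + C * (x 2 * x 6) := by
  simp only [qf, zero_add]

lemma qf_one {R : Type*} [CommRing R] (A B C : R) (x : ZMod 8 → R) : qf A B C 1 x =
    A * (x 1 ^ 2 + x 5 ^ 2) + B * (x 2 * x 0 + x 4 * x 6) + C * (x 3 * x 7) := rfl

lemma qf_two {R : Type*} [CommRing R] (A B C : R) (x : ZMod 8 → R) : qf A B C 2 x =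
    A * (x 2 ^ 2 + x 6 ^ 2) + B * (x 3 * x 1 + x 5 * x 7) + C * (x 4 * x 0) := rfl

lemma qf_three {R : Type*} [CommRing R] (A B C : R) (x : ZMod 8 → R) : qf A B C 3 x =
    A * (x 3 ^ 2 + x 7 ^ 2) + B * (x 4 * x 2 + x 6 * x 0) + C * (x 5 * x 1) := rfl

lemma pol_add_four {R : Type*} [CommRing R] (A B C : R) (t : ZMod 8) (x w : ZMod 8 → R) :
    pol A B C (t + 4) x w = pol A B C t x w := by
  simp only [pol_eq, qf_add_four]

variable {m n k : K} {x : ZMod 8 → K}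

section Blocks

variable {R : Type*} [CommRing R] (m n k : R) (x : ZMod 8 → R)

/-- In the coordinates `x_i ± x_{i+4}` this form and its three companions below only couple the
index 0 with 2 and 1 with 3, and never a sum with a difference: hence the binary blocks. -/
lemma qf_zero_add_qf_two :
    qf (m ^ 2 - n ^ 2) (-k ^ 2) (2 * m ^ 2 + 2 * n ^ 2) 0 x +
      qf (m ^ 2 - n ^ 2) (-k ^ 2) (2 * m ^ 2 + 2 * n ^ 2) 2 x =
    m ^ 2 * ((x 0 + x 4) ^ 2 + (x 2 + x 6) ^ 2) + -k ^ 2 * ((x 1 + x 5) * (x 3 + x 7)) +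
      -n ^ 2 * ((x 0 - x 4) ^ 2 + (x 2 - x 6) ^ 2) := by
  rw [qf_zero, qf_two]
  ring

lemma qf_zero_sub_qf_two :
    qf (m ^ 2 - n ^ 2) (-k ^ 2) (2 * m ^ 2 + 2 * n ^ 2) 0 x -
      qf (m ^ 2 - n ^ 2) (-k ^ 2) (2 * m ^ 2 + 2 * n ^ 2) 2 x =
    -n ^ 2 * ((x 0 + x 4) ^ 2 - (x 2 + x 6) ^ 2) + m ^ 2 * ((x 0 - x 4) ^ 2 - (x 2 - x 6) ^ 2) -
      -k ^ 2 * ((x 1 - x 5) * (x 3 - x 7)) := by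
  rw [qf_zero, qf_two]
  ring

lemma qf_one_add_qf_three :
    qf (m ^ 2 - n ^ 2) (-k ^ 2) (2 * m ^ 2 + 2 * n ^ 2) 1 x +
      qf (m ^ 2 - n ^ 2) (-k ^ 2) (2 * m ^ 2 + 2 * n ^ 2) 3 x =
    m ^ 2 * ((x 1 + x 5) ^ 2 + (x 3 + x 7) ^ 2) + -k ^ 2 * ((x 0 + x 4) * (x 2 + x 6)) +
      -n ^ 2 * ((x 1 - x 5) ^ 2 + (x 3 - x 7) ^ 2) := by
  rw [qf_one, qf_three]
  ring

lemma qf_one_sub_qf_three :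
    qf (m ^ 2 - n ^ 2) (-k ^ 2) (2 * m ^ 2 + 2 * n ^ 2) 1 x -
      qf (m ^ 2 - n ^ 2) (-k ^ 2) (2 * m ^ 2 + 2 * n ^ 2) 3 x =
    -n ^ 2 * ((x 1 + x 5) ^ 2 - (x 3 + x 7) ^ 2) + m ^ 2 * ((x 1 - x 5) ^ 2 - (x 3 - x 7) ^ 2) +
      -k ^ 2 * ((x 0 - x 4) * (x 2 - x 6)) := by
  rw [qf_one, qf_three]
  ring

end Blocks

/-- The gradient of a singular quadric in the coordinates `x_i ± x_{i+4}`. -/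
lemma IsSing.exists_blocks
    (h : IsSing (m ^ 2 - n ^ 2) (-k ^ 2) (2 * m ^ 2 + 2 * n ^ 2) x) :
    ∃ L₁ L₂ L₃ L₄ : K, ¬(L₁ = 0 ∧ L₂ = 0 ∧ L₃ = 0 ∧ L₄ = 0) ∧
      2 * (x 0 + x 4) * (L₁ * m ^ 2 + L₂ * -n ^ 2) + L₃ * -k ^ 2 * (x 2 + x 6) = 0 ∧
      2 * (x 2 + x 6) * (L₁ * m ^ 2 - L₂ * -n ^ 2) + L₃ * -k ^ 2 * (x 0 + x 4) = 0 ∧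
      2 * (x 1 + x 5) * (L₃ * m ^ 2 + L₄ * -n ^ 2) + L₁ * -k ^ 2 * (x 3 + x 7) = 0 ∧
      2 * (x 3 + x 7) * (L₃ * m ^ 2 - L₄ * -n ^ 2) + L₁ * -k ^ 2 * (x 1 + x 5) = 0 ∧
      2 * (x 0 - x 4) * (L₁ * -n ^ 2 + L₂ * m ^ 2) + L₄ * -k ^ 2 * (x 2 - x 6) = 0 ∧
      2 * (x 2 - x 6) * (L₁ * -n ^ 2 - L₂ * m ^ 2) + L₄ * -k ^ 2 * (x 0 - x 4) = 0 ∧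
      2 * (x 1 - x 5) * (L₃ * -n ^ 2 + L₄ * m ^ 2) + -(L₂ * -k ^ 2) * (x 3 - x 7) = 0 ∧
      2 * (x 3 - x 7) * (L₃ * -n ^ 2 - L₄ * m ^ 2) + -(L₂ * -k ^ 2) * (x 1 - x 5) = 0 := by
  have : CharZero K := charZero_of_injective_algebraMap (algebraMap ℂ K).injective
  obtain ⟨-, lam, h4, hlam, hw⟩ := h
  have l4 : lam 4 = lam 0 := h4 0
  have l5 : lam 5 = lam 1 := h4 1
  have l6 : lam 6 = lam 2 := h4 2
  have l7 : lam 7 = lam 3 := h4 3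
  have key : ∀ w : ZMod 8 → K,
      lam 0 * pol (m ^ 2 - n ^ 2) (-k ^ 2) (2 * m ^ 2 + 2 * n ^ 2) 0 x w +
      lam 1 * pol (m ^ 2 - n ^ 2) (-k ^ 2) (2 * m ^ 2 + 2 * n ^ 2) 1 x w +
      lam 2 * pol (m ^ 2 - n ^ 2) (-k ^ 2) (2 * m ^ 2 + 2 * n ^ 2) 2 x w +
      lam 3 * pol (m ^ 2 - n ^ 2) (-k ^ 2) (2 * m ^ 2 + 2 * n ^ 2) 3 x w = 0 := by
    intro w
    have e := hw w
    rw [sum_zmod_eight, l4, l5, l6, l7,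
      show pol _ _ _ 4 x w = _ from pol_add_four _ _ _ 0 x w,
      show pol _ _ _ 5 x w = _ from pol_add_four _ _ _ 1 x w,
      show pol _ _ _ 6 x w = _ from pol_add_four _ _ _ 2 x w,
      show pol _ _ _ 7 x w = _ from pol_add_four _ _ _ 3 x w] at e
    -- Each quadric occurs twice in the sum over `ℤ/8`, at `t` and at `t + 4`.
    linear_combination e / 2
  have key' : ∀ w₀ w₁ w₂ w₃ w₄ w₅ w₆ w₇ : K,
      lam 0 * ((m ^ 2 - n ^ 2) * (2 * x 0 * w₀ + 2 * x 4 * w₄) +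
        -k ^ 2 * (x 1 * w₇ + w₁ * x 7 + (x 3 * w₅ + w₃ * x 5)) +
        (2 * m ^ 2 + 2 * n ^ 2) * (x 2 * w₆ + w₂ * x 6)) +
      lam 1 * ((m ^ 2 - n ^ 2) * (2 * x 1 * w₁ + 2 * x 5 * w₅) +
        -k ^ 2 * (x 2 * w₀ + w₂ * x 0 + (x 4 * w₆ + w₄ * x 6)) +
        (2 * m ^ 2 + 2 * n ^ 2) * (x 3 * w₇ + w₃ * x 7)) +
      lam 2 * ((m ^ 2 - n ^ 2) * (2 * x 2 * w₂ + 2 * x 6 * w₆) +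
        -k ^ 2 * (x 3 * w₁ + w₃ * x 1 + (x 5 * w₇ + w₅ * x 7)) +
        (2 * m ^ 2 + 2 * n ^ 2) * (x 4 * w₀ + w₄ * x 0)) +
      lam 3 * ((m ^ 2 - n ^ 2) * (2 * x 3 * w₃ + 2 * x 7 * w₇) +
        -k ^ 2 * (x 4 * w₂ + w₄ * x 2 + (x 6 * w₀ + w₆ * x 0)) +
        (2 * m ^ 2 + 2 * n ^ 2) * (x 5 * w₁ + w₅ * x 1)) = 0 := by
    intro w₀ w₁ w₂ w₃ w₄ w₅ w₆ w₇
    exact key (![w₀, w₁, w₂, w₃, w₄, w₅, w₆, w₇] : Fin 8 → K)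
  -- These are twice the coefficients of the singular member with respect to `f_0 + f_2`, `f_0 -
  -- f_2`, `f_1 + f_3`, `f_1 - f_3`.
  refine ⟨lam 0 + lam 2, lam 0 - lam 2, lam 1 + lam 3, lam 1 - lam 3, ?_, ?_, ?_, ?_, ?_, ?_, ?_, ?_,
    ?_⟩
  · rintro ⟨e1, e2, e3, e4⟩
    have z0 : lam 0 = 0 := by linear_combination (e1 + e2) / 2
    have z2 : lam 2 = 0 := by linear_combination (e1 - e2) / 2
    have z1 : lam 1 = 0 := by linear_combination (e3 + e4) / 2
    have z3 : lam 3 = 0 := by linear_combination (e3 - e4) / 2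
    apply hlam
    funext i
    fin_cases i
    · exact z0
    · exact z1
    · exact z2
    · exact z3
    · exact l4.trans z0
    · exact l5.trans z1
    · exact l6.trans z2
    · exact l7.trans z3
  -- The test vectors `e_i ± e_{i+4}` are the directions of the block coordinates.
  · linear_combination key' 1 0 0 0 1 0 0 0
  · linear_combination key' 0 0 1 0 0 0 1 0
  · linear_combination key' 0 1 0 0 0 1 0 0
  · linear_combination key' 0 0 0 1 0 0 0 1
  · linear_combination key' 1 0 0 0 (-1) 0 0 0
  · linear_combination key' 0 0 1 0 0 0 (-1) 0
  · linear_combination key' 0 1 0 0 0 (-1) 0 0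
  · linear_combination key' 0 0 0 1 0 0 0 (-1)

lemma chi_mul_eq_pow (b i : ZMod 8) : chi (b * i) = chi b ^ i.val := by
  have h : b * i = ((b.val * i.val : ℕ) : ZMod 8) := by simp
  rw [h, chi_natCast, pow_mul, chi]

variable {y : Vec}

lemma inOrbit_of_eq (hodd : ∀ i, y (-i) = -y i) (hy1 : algebraMap ℂ K (y 1) = m + n)
    (hy2 : algebraMap ℂ K (y 2) = k) (hy3 : algebraMap ℂ K (y 3) = m - n) (b : ZMod 8) (c χ : K)
    (hχ : algebraMap ℂ K (chi b) = χ) (x0 : x 0 = 0) (x1 : x 1 = c * (χ * (m + n)))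
    (x2 : x 2 = c * (χ ^ 2 * k)) (x3 : x 3 = c * (χ ^ 3 * (m - n))) (x4 : x 4 = 0)
    (x5 : x 5 = c * (χ ^ 5 * -(m - n))) (x6 : x 6 = c * (χ ^ 6 * -k))
    (x7 : x 7 = c * (χ ^ 7 * -(m + n))) : InOrbit y x := by
  have z0 := odd_apply_zero hodd
  have z4 := odd_apply_four hodd
  have z5 := odd_apply_five hodd
  have z6 := odd_apply_six hodd
  have z7 := odd_apply_seven hodd
  refine ⟨c, 0, b, funext fun i => ?_⟩
  rw [Pi.smul_apply, heis_apply, chi_mul_eq_pow, map_pow, hχ, sub_zero, smul_eq_mul]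
  fin_cases i
  · change x 0 = c * (χ ^ 0 * algebraMap ℂ K (y 0))
    rw [x0, z0, map_zero]
    ring
  · change x 1 = c * (χ ^ 1 * algebraMap ℂ K (y 1))
    rw [x1, hy1]
    ring
  · change x 2 = c * (χ ^ 2 * algebraMap ℂ K (y 2))
    rw [x2, hy2]
  · change x 3 = c * (χ ^ 3 * algebraMap ℂ K (y 3))
    rw [x3, hy3]
  · change x 4 = c * (χ ^ 4 * algebraMap ℂ K (y 4))
    rw [x4, z4, map_zero]
    ring
  · change x 5 = c * (χ ^ 5 * algebraMap ℂ K (y 5))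
    rw [x5, z5, map_neg, hy3]
  · change x 6 = c * (χ ^ 6 * algebraMap ℂ K (y 6))
    rw [x6, z6, map_neg, hy2]
  · change x 7 = c * (χ ^ 7 * algebraMap ℂ K (y 7))
    rw [x7, z7, map_neg, hy1]

lemma inOrbit_of_eq_shift (hodd : ∀ i, y (-i) = -y i) (hy1 : algebraMap ℂ K (y 1) = m + n)
    (hy2 : algebraMap ℂ K (y 2) = k) (hy3 : algebraMap ℂ K (y 3) = m - n) (b : ZMod 8) (c χ : K)
    (hχ : algebraMap ℂ K (chi b) = χ) (x0 : x 0 = 0) (x1 : x 1 = c * (χ * -(m - n)))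
    (x2 : x 2 = c * (χ ^ 2 * -k)) (x3 : x 3 = c * (χ ^ 3 * -(m + n))) (x4 : x 4 = 0)
    (x5 : x 5 = c * (χ ^ 5 * (m + n))) (x6 : x 6 = c * (χ ^ 6 * k))
    (x7 : x 7 = c * (χ ^ 7 * (m - n))) : InOrbit y x := by
  have z0 := odd_apply_zero hodd
  have z4 := odd_apply_four hodd
  have z5 := odd_apply_five hodd
  have z6 := odd_apply_six hodd
  have z7 := odd_apply_seven hodd
  refine ⟨c, 4, b, funext fun i => ?_⟩
  rw [Pi.smul_apply, heis_apply, chi_mul_eq_pow, map_pow, hχ, smul_eq_mul]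
  fin_cases i
  · change x 0 = c * (χ ^ 0 * algebraMap ℂ K (y 4))
    rw [x0, z4, map_zero]
    ring
  · change x 1 = c * (χ ^ 1 * algebraMap ℂ K (y 5))
    rw [x1, z5, map_neg, hy3]
    ring
  · change x 2 = c * (χ ^ 2 * algebraMap ℂ K (y 6))
    rw [x2, z6, map_neg, hy2]
  · change x 3 = c * (χ ^ 3 * algebraMap ℂ K (y 7))
    rw [x3, z7, map_neg, hy1]
  · change x 4 = c * (χ ^ 4 * algebraMap ℂ K (y 0))
    rw [x4, z0, map_zero]
    ring
  · change x 5 = c * (χ ^ 5 * algebraMap ℂ K (y 1))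
    rw [x5, hy1]
  · change x 6 = c * (χ ^ 6 * algebraMap ℂ K (y 2))
    rw [x6, hy2]
  · change x 7 = c * (χ ^ 7 * algebraMap ℂ K (y 3))
    rw [x7, hy3]

/-- Points with vanishing `x_0`, `x_4` and `x_2 + x_6` that satisfy the equations of a singular
point lie in the orbit. -/
lemma inOrbit_of_relations (hk : k ≠ 0) (hodd : ∀ i, y (-i) = -y i)
    (hy1 : algebraMap ℂ K (y 1) = m + n) (hy2 : algebraMap ℂ K (y 2) = k)
    (hy3 : algebraMap ℂ K (y 3) = m - n) (x0 : x 0 = 0) (x4 : x 4 = 0) (x6 : x 6 = -x 2) {ε : K}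
    (hε : ε = 1 ∨ ε = -1) (hv : x 3 - x 7 = ε * (x 1 - x 5)) (hu : x 3 + x 7 = -ε * (x 1 + x 5))
    (hn : -n ^ 2 * (x 2 - x 6) ^ 2 = ε * -k ^ 2 * (x 1 + x 5) ^ 2)
    (hm : m ^ 2 * (x 2 - x 6) ^ 2 = -ε * -k ^ 2 * (x 1 - x 5) ^ 2) : InOrbit y x := by
  have : CharZero K := charZero_of_injective_algebraMap (algebraMap ℂ K).injective
  have h2 : (2 : K) ≠ 0 := two_ne_zero
  obtain ⟨c, hc⟩ : ∃ c, x 2 = k * c := ⟨x 2 / k, by field_simp⟩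
  rw [x6, hc] at hn hm
  rw [hc] at x6
  have hI : algebraMap ℂ K Complex.I ^ 2 = -1 := by
    rw [← map_pow, Complex.I_sq, map_neg, map_one]
  have c0 : algebraMap ℂ K (chi 0) = 1 := by rw [chi_zero, map_one]
  have c4 : algebraMap ℂ K (chi 4) = -1 := by rw [chi_four, map_neg, map_one]
  have c2 : algebraMap ℂ K (chi 2) = -algebraMap ℂ K Complex.I := by rw [chi_two, map_neg]
  have c6 : algebraMap ℂ K (chi 6) = algebraMap ℂ K Complex.I := by
    rw [show (6 : ZMod 8) = 4 + 2 by decide, chi_add, chi_four, chi_two]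
    simp
  set I := algebraMap ℂ K Complex.I
  -- The value of `ε` and the signs of the two square roots leave eight points: the translates with
  -- `a` in `{0, 4}` and `b` even, where `ε = 1` gives `b` in `{0, 4}` and `ε = -1` gives `b` in
  -- `{2, 6}`.
  rcases hε with rfl | rfl
  · have hu1 : (x 1 + x 5) ^ 2 = (2 * n * c) ^ 2 :=
      mul_left_cancel₀ (pow_ne_zero 2 hk) (by linear_combination hn)
    have hv1 : (x 1 - x 5) ^ 2 = (2 * m * c) ^ 2 :=
      mul_left_cancel₀ (pow_ne_zero 2 hk) (by linear_combination -hm)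
    rcases sq_eq_sq_iff_eq_or_eq_neg.mp hu1 with u1 | u1 <;>
    rcases sq_eq_sq_iff_eq_or_eq_neg.mp hv1 with v1 | v1 <;>
    rw [u1] at hu <;> rw [v1] at hv
    · refine inOrbit_of_eq hodd hy1 hy2 hy3 0 c 1 c0 x0 ?_ ?_ ?_ x4 ?_ ?_ ?_
      · linear_combination (u1 + v1) / 2
      · linear_combination hc
      · linear_combination (hu + hv) / 2
      · linear_combination (u1 - v1) / 2
      · linear_combination x6
      · linear_combination (hu - hv) / 2
    · refine inOrbit_of_eq_shift hodd hy1 hy2 hy3 4 (-c) (-1) c4 x0 ?_ ?_ ?_ x4 ?_ ?_ ?_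
      · linear_combination (u1 + v1) / 2
      · linear_combination hc
      · linear_combination (hu + hv) / 2
      · linear_combination (u1 - v1) / 2
      · linear_combination x6
      · linear_combination (hu - hv) / 2
    · refine inOrbit_of_eq_shift hodd hy1 hy2 hy3 0 (-c) 1 c0 x0 ?_ ?_ ?_ x4 ?_ ?_ ?_
      · linear_combination (u1 + v1) / 2
      · linear_combination hc
      · linear_combination (hu + hv) / 2
      · linear_combination (u1 - v1) / 2
      · linear_combination x6
      · linear_combination (hu - hv) / 2
    · refine inOrbit_of_eq hodd hy1 hy2 hy3 4 c (-1) c4 x0 ?_ ?_ ?_ x4 ?_ ?_ ?_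
      · linear_combination (u1 + v1) / 2
      · linear_combination hc
      · linear_combination (hu + hv) / 2
      · linear_combination (u1 - v1) / 2
      · linear_combination x6
      · linear_combination (hu - hv) / 2
  · have hu1 : (x 1 + x 5) ^ 2 = (2 * I * n * c) ^ 2 :=
      mul_left_cancel₀ (pow_ne_zero 2 hk)
        (by linear_combination -hn - k ^ 2 * (2 * n * c) ^ 2 * hI)
    have hv1 : (x 1 - x 5) ^ 2 = (2 * I * m * c) ^ 2 :=
      mul_left_cancel₀ (pow_ne_zero 2 hk)
        (by linear_combination hm - k ^ 2 * (2 * m * c) ^ 2 * hI)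
    have I3 : I ^ 3 = -I := by linear_combination I * hI
    have I5 : I ^ 5 = I := by linear_combination (I ^ 3 - I) * hI
    have I6 : I ^ 6 = -1 := by linear_combination (I ^ 4 - I ^ 2 + 1) * hI
    have I7 : I ^ 7 = -I := by linear_combination (I ^ 5 - I ^ 3 + I) * hI
    rcases sq_eq_sq_iff_eq_or_eq_neg.mp hu1 with u1 | u1 <;>
    rcases sq_eq_sq_iff_eq_or_eq_neg.mp hv1 with v1 | v1 <;>
    rw [u1] at hu <;> rw [v1] at hv
    · refine inOrbit_of_eq hodd hy1 hy2 hy3 2 (-c) (-I) c2 x0 ?_ ?_ ?_ x4 ?_ ?_ ?_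
      · linear_combination (u1 + v1) / 2
      · linear_combination hc + c * k * hI
      · linear_combination (hu + hv) / 2 - c * (m - n) * I3
      · linear_combination (u1 - v1) / 2 + c * (m - n) * I5
      · linear_combination x6 - c * k * I6
      · linear_combination (hu - hv) / 2 + c * (m + n) * I7
    · refine inOrbit_of_eq_shift hodd hy1 hy2 hy3 6 c I c6 x0 ?_ ?_ ?_ x4 ?_ ?_ ?_
      · linear_combination (u1 + v1) / 2
      · linear_combination hc + c * k * hI
      · linear_combination (hu + hv) / 2 + c * (m + n) * I3
      · linear_combination (u1 - v1) / 2 - c * (m + n) * I5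
      · linear_combination x6 - c * k * I6
      · linear_combination (hu - hv) / 2 - c * (m - n) * I7
    · refine inOrbit_of_eq_shift hodd hy1 hy2 hy3 2 c (-I) c2 x0 ?_ ?_ ?_ x4 ?_ ?_ ?_
      · linear_combination (u1 + v1) / 2
      · linear_combination hc + c * k * hI
      · linear_combination (hu + hv) / 2 - c * (m + n) * I3
      · linear_combination (u1 - v1) / 2 + c * (m + n) * I5
      · linear_combination x6 - c * k * I6
      · linear_combination (hu - hv) / 2 + c * (m - n) * I7
    · refine inOrbit_of_eq hodd hy1 hy2 hy3 6 (-c) I c6 x0 ?_ ?_ ?_ x4 ?_ ?_ ?_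
      · linear_combination (u1 + v1) / 2
      · linear_combination hc + c * k * hI
      · linear_combination (hu + hv) / 2 + c * (m - n) * I3
      · linear_combination (u1 - v1) / 2 - c * (m - n) * I5
      · linear_combination x6 - c * k * I6
      · linear_combination (hu - hv) / 2 - c * (m + n) * I7

lemma IsSing.inOrbit_of_block (hg : Generic m n k) (hodd : ∀ i, y (-i) = -y i)
    (hy1 : algebraMap ℂ K (y 1) = m + n) (hy2 : algebraMap ℂ K (y 2) = k)
    (hy3 : algebraMap ℂ K (y 3) = m - n)
    (h : IsSing (m ^ 2 - n ^ 2) (-k ^ 2) (2 * m ^ 2 + 2 * n ^ 2) x) (hx : x ≠ 0)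
    (hu0 : x 0 + x 4 = 0) (hu2 : x 2 + x 6 = 0) : InOrbit y x := by
  have : CharZero K := charZero_of_injective_algebraMap (algebraMap ℂ K).injective
  have main : ∀ x : ZMod 8 → K, IsSing (m ^ 2 - n ^ 2) (-k ^ 2) (2 * m ^ 2 + 2 * n ^ 2) x →
      x ≠ 0 → x 0 + x 4 = 0 → x 2 + x 6 = 0 →
      (x 2 - x 6 = 0 ∧ x 0 - x 4 ≠ 0) ∨ InOrbit y x := by
    intro x h hx hu0 hu2
    have g1 := qf_zero_add_qf_two m n k x
    have g2 := qf_zero_sub_qf_two m n k x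
    have g3 := qf_one_add_qf_three m n k x
    have g4 := qf_one_sub_qf_three m n k x
    simp only [h.1, add_zero, sub_zero] at g1 g2 g3 g4
    obtain ⟨L₁, L₂, L₃, L₄, hL, -, -, b2, b2', b3, b3', b4, b4'⟩ := h.exists_blocks
    rw [hu0, hu2] at g1 g2 g3
    have hx' : ¬(x 1 + x 5 = 0 ∧ x 3 + x 7 = 0 ∧ x 0 - x 4 = 0 ∧ x 1 - x 5 = 0 ∧ x 2 - x 6 = 0 ∧
        x 3 - x 7 = 0) := by
      rintro ⟨e1, e2, e3, e4, e5, e6⟩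
      apply hx
      funext i
      fin_cases i
      · change x 0 = 0
        linear_combination (hu0 + e3) / 2
      · change x 1 = 0
        linear_combination (e1 + e4) / 2
      · change x 2 = 0
        linear_combination (hu2 + e5) / 2
      · change x 3 = 0
        linear_combination (e2 + e6) / 2
      · change x 4 = 0
        linear_combination (hu0 - e3) / 2
      · change x 5 = 0
        linear_combination (e1 - e4) / 2
      · change x 6 = 0
        linear_combination (hu2 - e5) / 2
      · change x 7 = 0
        linear_combination (e2 - e6) / 2
    rcases singular_of_block_eq_zero (al := m ^ 2) (be := -n ^ 2) (B := -k ^ 2)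
      (pow_ne_zero 2 hg.m_ne) (neg_ne_zero.mpr (pow_ne_zero 2 hg.n_ne))
      (neg_ne_zero.mpr (pow_ne_zero 2 hg.k_ne))
      (fun e => hg.ne₁ (by linear_combination e)) (fun e => hg.ne₂ (by linear_combination e))
      (fun e => hg.ne₃ (by linear_combination e)) (fun e => hg.ne₄ (by linear_combination e))
      (by linear_combination -g1) (by linear_combination -g2) (by linear_combination -g3)
      (by linear_combination -g4) hx' hL b2 b2' b3 b3' b4 b4' with horb | ⟨e0, -, ε, hε, hv, hu, hn, hm⟩
    · exact Or.inl horb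
    · refine Or.inr (inOrbit_of_relations hg.k_ne hodd hy1 hy2 hy3 ?_ ?_ ?_ hε hv hu hn hm)
      · linear_combination (hu0 + e0) / 2
      · linear_combination (hu0 - e0) / 2
      · linear_combination hu2
  -- Translation by `σ²` interchanges `x 0 - x 4` and `x 2 - x 6` up to sign, so a point in the
  -- first alternative is moved out of it.
  rcases main x h hx hu0 hu2 with ⟨e2, e0⟩ | horb
  · have val : ∀ i, heis 2 0 x i = x (i - 2) := fun i => by
      rw [heis_apply, zero_mul, chi_zero, map_one, one_mul]
    have v0 : heis 2 0 x 0 = x 6 := val 0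
    have v2 : heis 2 0 x 2 = x 0 := val 2
    have v4 : heis 2 0 x 4 = x 2 := val 4
    have v6 : heis 2 0 x 6 = x 4 := val 6
    rcases main _ (h.translate 2 0) (heis_ne_zero 2 0 hx) (by rw [v0, v4]; linear_combination hu2)
      (by rw [v2, v6, hu0]) with ⟨e2', -⟩ | horb
    · rw [v2, v6] at e2'
      exact absurd e2' e0
    · exact horb.of_heis 2 0
  · exact horb

/-- The singular points of the complete intersection form the orbit. -/
theorem IsSing.inOrbit (hg : Generic m n k) (hodd : ∀ i, y (-i) = -y i)
    (hy1 : algebraMap ℂ K (y 1) = m + n) (hy2 : algebraMap ℂ K (y 2) = k)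
    (hy3 : algebraMap ℂ K (y 3) = m - n)
    (h : IsSing (m ^ 2 - n ^ 2) (-k ^ 2) (2 * m ^ 2 + 2 * n ^ 2) x) (hx : x ≠ 0) : InOrbit y x := by
  have hne : ∀ i, algebraMap ℂ K (chi i) ≠ 0 := fun i => (map_ne_zero _).mpr (chi_ne_zero _)
  obtain ⟨L₁, L₂, L₃, L₄, hL, b1, b1', b2, b2', b3, b3', b4, b4'⟩ := h.exists_blocks
  -- A shift by 1 exchanges even and odd indices, and `τ` exchanges sums and differences, so
  -- whichever component vanishes can be moved to the first block.
  have aux : ∀ a b, heis a b x 0 + heis a b x 4 = 0 → heis a b x 2 + heis a b x 6 = 0 →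
      InOrbit y x := fun a b e0 e2 =>
    ((h.translate a b).inOrbit_of_block hg hodd hy1 hy2 hy3 (heis_ne_zero a b hx) e0 e2).of_heis a b
  by_cases n1 : x 0 + x 4 = 0 ∧ x 2 + x 6 = 0
  · exact h.inOrbit_of_block hg hodd hy1 hy2 hy3 hx n1.1 n1.2
  by_cases n2 : x 1 + x 5 = 0 ∧ x 3 + x 7 = 0
  · have val : ∀ i, heis 1 0 x i = x (i - 1) := fun i => by
      rw [heis_apply, zero_mul, chi_zero, map_one, one_mul]
    refine aux 1 0 ?_ ?_
    · rw [val, val]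
      change x 7 + x 3 = 0
      linear_combination n2.2
    · rw [val, val]
      exact n2.1
  by_cases n3 : x 0 - x 4 = 0 ∧ x 2 - x 6 = 0
  · refine aux 0 1 ?_ ?_
    · simp only [heis_apply, one_mul, sub_zero, chi_zero, chi_four, map_one, map_neg]
      linear_combination n3.1
    · simp only [heis_apply, one_mul, sub_zero, show (6 : ZMod 8) = 2 + 4 by decide, chi_add,
        chi_four, map_mul, map_one, map_neg]
      rw [show (2 + 4 : ZMod 8) = 6 by decide]
      linear_combination algebraMap ℂ K (chi 2) * n3.2
  by_cases n4 : x 1 - x 5 = 0 ∧ x 3 - x 7 = 0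
  · refine aux 1 1 ?_ ?_
    · simp only [heis_apply, one_mul, chi_zero, chi_four, map_one, map_neg]
      change x 7 + -1 * x 3 = 0
      linear_combination -n4.2
    · simp only [heis_apply, one_mul]
      rw [show chi 6 = chi 2 * chi 4 by rw [← chi_add]; rfl, chi_four, map_mul, map_neg, map_one]
      change algebraMap ℂ K (chi 2) * x 1 + algebraMap ℂ K (chi 2) * -1 * x 5 = 0
      linear_combination algebraMap ℂ K (chi 2) * n4.1
  -- No component vanishes, hence all four blocks have a kernel.
  exfalso
  have d1 := four_mul_eq_sq_of_kernel b1 b1' n1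
  have d2 := four_mul_eq_sq_of_kernel b2 b2' n2
  have d3 := four_mul_eq_sq_of_kernel b3 b3' n3
  have d4 := four_mul_eq_sq_of_kernel b4 b4' n4
  exact false_of_blocks_degenerate (neg_ne_zero.mpr (pow_ne_zero 2 hg.k_ne))
    (fun e => hg.ne₄ (by linear_combination e)) hL d1 d2 d3 (by rw [d4]; ring)

end SingularOrbit

end HeisenbergEight

namespace HeisenbergEight

open MvPolynomial AlgebraicGeometry

/-! ### Local equation at a point of the orbit -/

section LocalNode

open IsLocalRing

universe u_1 u_2

variable {T : Type u_1} {R : Type u_2} [CommRing T] [IsLocalRing T] [IsNoetherianRing T]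
  [CommRing R] [IsLocalRing R] [IsNoetherianRing R] [Algebra ℂ T]

/-- The local structure of the complete intersection at a point of the orbit, in coordinates
`Z_i` that take the values `(0, m + n, k, m - n, 0, n - m, -k, -m - n)`. -/
theorem node_of_coordinates (π : T →+* R) (hπ : Function.Surjective π) {m n k : ℂ}
    (hg : Generic m n k) (Z : ZMod 8 → T) (y : Vec) (hodd : ∀ i, y (-i) = -y i)
    (hy1 : y 1 = m + n) (hy2 : y 2 = k) (hy3 : y 3 = m - n)
    (hZm : ∀ i, Z i - algebraMap ℂ T (y i) ∈ maximalIdeal T)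
    (hmZ : ∀ J : Ideal T, (∀ i, Z i - algebraMap ℂ T (y i) ∈ J) → maximalIdeal T ≤ J)
    (hdim : (4 : ℕ) ≤ ringKrullDim T) (hres : Function.Surjective (algebraMap ℂ (ResidueField T)))
    {M N k' : T} (hM : M = algebraMap ℂ T m) (hN : N = algebraMap ℂ T n)
    (hk' : k' = algebraMap ℂ T k)
    (hV2 : Z 2 - Z 6 = 2 * k')
    (g1 : M ^ 2 * ((Z 0 + Z 4) ^ 2 + (Z 2 + Z 6) ^ 2) + -k' ^ 2 * ((Z 1 + Z 5) * (Z 3 + Z 7)) +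
      -N ^ 2 * ((Z 0 - Z 4) ^ 2 + (Z 2 - Z 6) ^ 2) = 0)
    (g2 : -N ^ 2 * ((Z 0 + Z 4) ^ 2 - (Z 2 + Z 6) ^ 2) +
      M ^ 2 * ((Z 0 - Z 4) ^ 2 - (Z 2 - Z 6) ^ 2) - -k' ^ 2 * ((Z 1 - Z 5) * (Z 3 - Z 7)) = 0)
    (g4 : -N ^ 2 * ((Z 1 + Z 5) ^ 2 - (Z 3 + Z 7) ^ 2) +
      M ^ 2 * ((Z 1 - Z 5) ^ 2 - (Z 3 - Z 7) ^ 2) + -k' ^ 2 * ((Z 0 - Z 4) * (Z 2 - Z 6)) = 0)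
    (hker : RingHom.ker π = Ideal.span {M ^ 2 * ((Z 1 + Z 5) ^ 2 + (Z 3 + Z 7) ^ 2) +
      -k' ^ 2 * ((Z 0 + Z 4) * (Z 2 + Z 6)) + -N ^ 2 * ((Z 1 - Z 5) ^ 2 + (Z 3 - Z 7) ^ 2)}) :
    Nonempty (AdicCompletion (maximalIdeal R) R ≃+* (MvPowerSeries (Fin (3 + 1)) ℂ ⧸
      Ideal.span {∑ i, (MvPowerSeries.X i : MvPowerSeries (Fin (3 + 1)) ℂ) ^ 2})) ∧
    ¬ IsRegularLocalRing R := by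
  have hk0 := hg.k_ne
  obtain ⟨κ, hκ⟩ : ∃ κ : T, κ = algebraMap ℂ T k⁻¹ := ⟨_, rfl⟩
  have hκk : κ * k' = 1 := by
    rw [hκ, hk', ← map_mul, inv_mul_cancel₀ hk0, map_one]
  have hκ2 : κ ^ 2 * k' ^ 2 = 1 := by rw [← mul_pow, hκk, one_pow]
  have hκ3 : κ ^ 3 * k' ^ 3 = 1 := by rw [← mul_pow, hκk, one_pow]
  obtain ⟨U0, hU0⟩ : ∃ U, U = Z 0 + Z 4 := ⟨_, rfl⟩
  obtain ⟨U2, hU2⟩ : ∃ U, U = Z 2 + Z 6 := ⟨_, rfl⟩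
  obtain ⟨U1, hU1⟩ : ∃ U, U = Z 1 + Z 5 := ⟨_, rfl⟩
  obtain ⟨U3, hU3⟩ : ∃ U, U = Z 3 + Z 7 := ⟨_, rfl⟩
  obtain ⟨V0, hV0⟩ : ∃ U, U = Z 0 - Z 4 := ⟨_, rfl⟩
  obtain ⟨V1, hV1⟩ : ∃ U, U = Z 1 - Z 5 := ⟨_, rfl⟩
  obtain ⟨V3, hV3⟩ : ∃ U, U = Z 3 - Z 7 := ⟨_, rfl⟩
  rw [← hU0, ← hU1, ← hU2, ← hU3, ← hV0, hV2] at g1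
  rw [← hU0, ← hU2, ← hV0, ← hV1, ← hV3, hV2] at g2
  rw [← hU1, ← hU3, ← hV0, ← hV1, ← hV3, hV2] at g4
  rw [← hU0, ← hU1, ← hU2, ← hU3, ← hV1, ← hV3] at hker
  -- The normalisation makes `Z 2 - Z 6` the unit `2 k'`, so `g4` can be solved for `V0`.
  have hw : 2 * V0 = κ ^ 3 * (-N ^ 2 * ((U1 + U3) * (U1 - U3)) +
      M ^ 2 * ((V1 + V3) * (V1 - V3))) := by
    linear_combination -κ ^ 3 * g4 - 2 * V0 * hκ3
  have v0 := odd_apply_zero hodd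
  have v4 := odd_apply_four hodd
  have v5 := odd_apply_five hodd
  have v6 := odd_apply_six hodd
  have v7 := odd_apply_seven hodd
  have hρ : ∀ i, residue T (Z i) = algebraMap ℂ (ResidueField T) (y i) := by
    intro i
    have := (residue_eq_zero_iff _).mpr (hZm i)
    rw [map_sub, sub_eq_zero] at this
    exact this
  have hρc : ∀ c : ℂ, residue T (algebraMap ℂ T c) = algebraMap ℂ (ResidueField T) c := fun c => rfl
  have hunit : ∀ c : ℂ, c ≠ 0 → IsUnit (algebraMap ℂ T c) := fun c hc =>
    (isUnit_iff_ne_zero.mpr hc).map _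
  have hunit' : ∀ (t : T) (c : ℂ), c ≠ 0 → residue T t = algebraMap ℂ (ResidueField T) c →
      IsUnit t := by
    intro t c hc h
    rw [← residue_ne_zero_iff_isUnit, h]
    exact (map_ne_zero _).mpr hc
  have h2 : IsUnit (2 : T) := by
    have := hunit 2 two_ne_zero
    rwa [map_ofNat] at this
  have rU0 : residue T U0 = 0 := by rw [hU0, map_add, hρ, hρ, v0, v4]; simp
  have rU2 : residue T U2 = 0 := by rw [hU2, map_add, hρ, hρ, v6]; simp
  have rU1 : residue T U1 = algebraMap ℂ _ (2 * n) := by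
    rw [hU1, map_add, hρ, hρ, v5, ← map_add, hy1, hy3]
    congr 1
    ring
  have rU3 : residue T U3 = algebraMap ℂ _ (-(2 * n)) := by
    rw [hU3, map_add, hρ, hρ, v7, ← map_add, hy1, hy3]
    congr 1
    ring
  have rV1 : residue T V1 = algebraMap ℂ _ (2 * m) := by
    rw [hV1, map_sub, hρ, hρ, v5, ← map_sub, hy1, hy3]
    congr 1
    ring
  have rV3 : residue T V3 = algebraMap ℂ _ (2 * m) := by
    rw [hV3, map_sub, hρ, hρ, v7, ← map_sub, hy1, hy3]
    congr 1
    ring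
  -- In `f_1 + f_3` write `U1² + U3² = (U1 + U3)² - 2 U1 U3` and `V1² + V3² = (V1 - V3)² + 2 V1 V3`,
  -- and take `U1 U3` and `V1 V3` from `g1` and `g2`. The contributions of `V2²` cancel, and those
  -- of `V0²` add up to `M² N² κ² (2 V0)²`, which `hw` turns into a binary form in `U1 + U3` and `V1
  -- - V3`.
  refine nonempty_adicCompletion_ringEquiv_node π hπ _ hker hdim hres
    (-2 * κ ^ 2 * (M ^ 4 + N ^ 4)) (-k' ^ 2) (-2 * κ ^ 2 * (M ^ 4 - N ^ 4))
    (M ^ 2 + M ^ 2 * N ^ 2 * κ ^ 8 * N ^ 4 * (U1 - U3) ^ 2)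
    (-2 * (M ^ 2 * N ^ 2 * κ ^ 8) * N ^ 2 * M ^ 2 * (U1 - U3) * (V1 + V3))
    (-N ^ 2 + M ^ 2 * N ^ 2 * κ ^ 8 * M ^ 4 * (V1 + V3) ^ 2)
    U0 U2 (U1 + U3) (V1 - V3) ?_ ?_ ?_ ?_ ?_ ?_
  · apply le_antisymm
    · refine hmZ _ ?_
      -- Modulo the four elements all coordinates become constant: `hw` gives `V0 = 0`, then `g1`
      -- and `g2` give `U1² = 4 N²` and `V1² = 4 M²`, and the residues at the point select the roots
      -- `2 N` and `2 M`.
      generalize h𝔞 : Ideal.span {U0, U2, U1 + U3, V1 - V3} = 𝔞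
      have hm : ∀ t ∈ ({U0, U2, U1 + U3, V1 - V3} : Set T), Ideal.Quotient.mk 𝔞 t = 0 := fun t ht =>
        Ideal.Quotient.eq_zero_iff_mem.mpr (h𝔞 ▸ Ideal.subset_span ht)
      intro i
      rw [← Ideal.Quotient.eq_zero_iff_mem]
      generalize Ideal.Quotient.mk 𝔞 = q at hm ⊢
      have e0 : q U0 = 0 := hm _ (by simp)
      have e2 : q U2 = 0 := hm _ (by simp)
      have e3 : q U1 + q U3 = 0 := by rw [← map_add]; exact hm _ (by simp)
      have e4 : q V1 - q V3 = 0 := by rw [← map_sub]; exact hm _ (by simp)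
      have q2 : IsUnit (2 : T ⧸ 𝔞) := by rw [← map_ofNat q]; exact h2.map q
      have eκ : q κ * q k' = 1 := by rw [← map_mul, hκk, map_one]
      have eκ2 : q κ ^ 2 * q k' ^ 2 = 1 := by rw [← mul_pow, eκ, one_pow]
      have w := congrArg q hw
      simp only [map_mul, map_add, map_sub, map_neg, map_pow, map_ofNat, e3, e4, mul_zero, zero_mul,
        add_zero] at w
      have eV0 : q V0 = 0 := q2.mul_right_eq_zero.mp w
      have w1 := congrArg q g1
      have w2 := congrArg q g2
      simp only [map_mul, map_add, map_sub, map_neg, map_pow, map_ofNat, map_zero, e0, e2, eV0] at w1 w2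
      have uU : IsUnit (q U1 + 2 * q N) := by
        have : IsUnit (U1 + 2 * N) := by
          refine hunit' _ (4 * n) (mul_ne_zero (by norm_num) hg.n_ne) ?_
          rw [map_add, rU1, map_mul, map_mul, hN, hρc]
          simp only [map_ofNat, map_mul]
          ring
        have := this.map q
        rwa [map_add, map_mul, map_ofNat] at this
      have uV : IsUnit (q V1 + 2 * q M) := by
        have : IsUnit (V1 + 2 * M) := by
          refine hunit' _ (4 * m) (mul_ne_zero (by norm_num) hg.m_ne) ?_
          rw [map_add, rV1, map_mul, map_mul, hM, hρc]
          simp only [map_ofNat, map_mul]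
          ring
        have := this.map q
        rwa [map_add, map_mul, map_ofNat] at this
      have eU1 : q U1 - 2 * q N = 0 := by
        refine uU.mul_left_eq_zero.mp ?_
        linear_combination q κ ^ 2 * w1 + (q κ ^ 2 * q k' ^ 2 * q U1) * e3 -
          (q U1 ^ 2 - 4 * q N ^ 2) * eκ2
      have eV1 : q V1 - 2 * q M = 0 := by
        refine uV.mul_left_eq_zero.mp ?_
        linear_combination q κ ^ 2 * w2 + (q κ ^ 2 * q k' ^ 2 * q V1) * e4 -
          (q V1 ^ 2 - 4 * q M ^ 2) * eκ2
      have f0 := congrArg q hU0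
      have f1 := congrArg q hU1
      have f2 := congrArg q hU2
      have f3 := congrArg q hU3
      have d0 := congrArg q hV0
      have d1 := congrArg q hV1
      have d2 := congrArg q hV2
      have d3 := congrArg q hV3
      simp only [map_mul, map_add, map_sub, map_ofNat] at f0 f1 f2 f3 d0 d1 d2 d3
      refine q2.mul_right_eq_zero.mp ?_
      rw [map_sub]
      fin_cases i
      · change 2 * (q (Z 0) - q (algebraMap ℂ T (y 0))) = 0
        rw [v0, map_zero, map_zero]
        linear_combination e0 + eV0 - f0 - d0
      · change 2 * (q (Z 1) - q (algebraMap ℂ T (y 1))) = 0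
        rw [hy1, map_add, ← hM, ← hN, map_add]
        linear_combination eU1 + eV1 - f1 - d1
      · change 2 * (q (Z 2) - q (algebraMap ℂ T (y 2))) = 0
        rw [hy2, ← hk']
        linear_combination e2 - f2 + d2
      · change 2 * (q (Z 3) - q (algebraMap ℂ T (y 3))) = 0
        rw [hy3, map_sub, ← hM, ← hN, map_sub]
        linear_combination -eU1 + eV1 - f3 - d3 + e3 - e4
      · change 2 * (q (Z 4) - q (algebraMap ℂ T (y 4))) = 0
        rw [v4, map_zero, map_zero]
        linear_combination e0 - eV0 - f0 + d0
      · change 2 * (q (Z 5) - q (algebraMap ℂ T (y 5))) = 0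
        rw [v5, hy3, map_neg, map_sub, ← hM, ← hN, map_neg, map_sub]
        linear_combination eU1 - eV1 - f1 + d1
      · change 2 * (q (Z 6) - q (algebraMap ℂ T (y 6))) = 0
        rw [v6, hy2, map_neg, ← hk', map_neg]
        linear_combination e2 - f2 - d2
      · change 2 * (q (Z 7) - q (algebraMap ℂ T (y 7))) = 0
        rw [v7, hy1, map_neg, map_add, ← hM, ← hN, map_neg, map_add]
        linear_combination -eU1 - eV1 - f3 + d3 + e3 + e4
    · rw [Ideal.span_le]
      rintro t (rfl | rfl | rfl | rfl) <;> rw [SetLike.mem_coe, ← residue_eq_zero_iff]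
      · exact rU0
      · exact rU2
      · rw [map_add, rU1, rU3, ← map_add, add_neg_cancel, map_zero]
      · rw [map_sub, rV1, rV3, sub_self]
  -- The four unit conditions are checked on values at the point. They follow in turn from `ne₂` (as
  -- `m⁴ + n⁴` divides `m⁸ - n⁸`), `ne₄`, `ne₃` and again `ne₄`, besides `m`, `n`, `k` being
  -- non-zero.
  · have : (-2 * κ ^ 2 * (M ^ 4 + N ^ 4)) = algebraMap ℂ T (-2 * k⁻¹ ^ 2 * (m ^ 4 + n ^ 4)) := by
      rw [hκ, hM, hN]
      simp only [map_mul, map_add, map_pow, map_neg, map_ofNat]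
    rw [this]
    refine hunit _ (mul_ne_zero (mul_ne_zero (by norm_num) (pow_ne_zero _ (inv_ne_zero hk0))) ?_)
    exact fun h => hg.ne₂ (by linear_combination (m ^ 4 - n ^ 4) * h)
  · have : 4 * (-2 * κ ^ 2 * (M ^ 4 + N ^ 4)) * (-2 * κ ^ 2 * (M ^ 4 - N ^ 4)) - (-k' ^ 2) ^ 2 =
        algebraMap ℂ T (16 * k⁻¹ ^ 4 * (m ^ 8 - n ^ 8) - k ^ 4) := by
      rw [hκ, hM, hN, hk']
      simp only [map_mul, map_sub, map_pow, map_ofNat]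
      ring
    rw [this]
    refine hunit _ fun h => hg.ne₄ ?_
    field_simp at h
    linear_combination h
  · refine hunit' _ (m ^ 2 + m ^ 2 * n ^ 2 * k⁻¹ ^ 8 * n ^ 4 * (2 * n - -(2 * n)) ^ 2) ?_ ?_
    · intro h
      have h3 := hg.ne₃
      have hm0 := hg.m_ne
      field_simp at h
      exact h3 ((mul_eq_zero.mp (by linear_combination h : m ^ 2 * (16 * n ^ 8 + k ^ 8) = 0)).resolve_left
        (pow_ne_zero 2 hm0))
    · simp only [map_add, map_mul, map_pow, map_sub, rU1, rU3, hκ, hM, hN, hρc]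
  · refine hunit' _ (4 * (m ^ 2 + m ^ 2 * n ^ 2 * k⁻¹ ^ 8 * n ^ 4 * (2 * n - -(2 * n)) ^ 2) *
      (-n ^ 2 + m ^ 2 * n ^ 2 * k⁻¹ ^ 8 * m ^ 4 * (2 * m + 2 * m) ^ 2) -
      (-2 * (m ^ 2 * n ^ 2 * k⁻¹ ^ 8) * n ^ 2 * m ^ 2 * (2 * n - -(2 * n)) *
        (2 * m + 2 * m)) ^ 2) ?_ ?_
    · have e : (4 * (m ^ 2 + m ^ 2 * n ^ 2 * k⁻¹ ^ 8 * n ^ 4 * (2 * n - -(2 * n)) ^ 2) *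
          (-n ^ 2 + m ^ 2 * n ^ 2 * k⁻¹ ^ 8 * m ^ 4 * (2 * m + 2 * m) ^ 2) -
          (-2 * (m ^ 2 * n ^ 2 * k⁻¹ ^ 8) * n ^ 2 * m ^ 2 * (2 * n - -(2 * n)) *
            (2 * m + 2 * m)) ^ 2) =
          -4 * m ^ 2 * n ^ 2 * (k ^ 8 + 16 * n ^ 8 - 16 * m ^ 8) * k⁻¹ ^ 8 := by
        field_simp
        ring
      rw [e]
      refine mul_ne_zero (mul_ne_zero (mul_ne_zero (mul_ne_zero (by norm_num)
        (pow_ne_zero _ hg.m_ne)) (pow_ne_zero _ hg.n_ne)) ?_) (pow_ne_zero _ (inv_ne_zero hk0))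
      exact fun h => hg.ne₄ (by linear_combination -h)
    · simp only [map_add, map_mul, map_pow, map_sub, map_neg, map_ofNat, rU1, rU3, rV1, rV3, hκ, hM,
        hN, hρc]
  · linear_combination 2 * M ^ 2 * κ ^ 2 * g1 - 2 * N ^ 2 * κ ^ 2 * g2 +
      (2 * M ^ 2 * U1 * U3 + 2 * N ^ 2 * V1 * V3) * hκ2 + M ^ 2 * N ^ 2 * κ ^ 2 *
      (2 * V0 + κ ^ 3 * (-N ^ 2 * ((U1 + U3) * (U1 - U3)) +
      M ^ 2 * ((V1 + V3) * (V1 - V3)))) * hw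

end LocalNode

end HeisenbergEight

namespace HeisenbergEight

open MvPolynomial AlgebraicGeometry

/-! ### Regularity away from the orbit -/

noncomputable section SmoothPoints

lemma P7.ext_of_forall_mem_deg {p q : P7}
    (h : ∀ n, ∀ f ∈ deg n, f ∈ p.asHomogeneousIdeal ↔ f ∈ q.asHomogeneousIdeal) : p = q := by
  exact ProjectiveSpectrum.ext (HomogeneousIdeal.ext' h)

/-- The differential of a quadratic form in the direction `w` is its polar form; this translates the
Jacobian condition into `IsSing`. -/
lemma sum_mul_pderiv_quadric {K : Type*} [CommRing K] (φ : Ring8 →+* K) (v : Vec) (t : ZMod 8)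
    (w : ZMod 8 → K) :
    ∑ j, w j * φ (pderiv j (quadric v t)) =
      pol (φ (C (v 1 * v 3))) (φ (C (-v 2 ^ 2))) (φ (C (v 1 ^ 2 + v 3 ^ 2))) t
        (fun i => φ (X i)) w := by
  have hadd : ∀ f g : Ring8, ∑ j, w j * φ (pderiv j (f + g)) =
      ∑ j, w j * φ (pderiv j f) + ∑ j, w j * φ (pderiv j g) := fun f g => by
    simp only [map_add, mul_add, Finset.sum_add_distrib]
  have hC : ∀ (c : ℂ) (f : Ring8), ∑ j, w j * φ (pderiv j (C c * f)) =
      φ (C c) * ∑ j, w j * φ (pderiv j f) := fun c f => by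
    rw [Finset.mul_sum]
    refine Finset.sum_congr rfl fun j _ => ?_
    rw [pderiv_C_mul, map_mul]
    ring
  have hX : ∀ a b : ZMod 8, ∑ j, w j * φ (pderiv j (X a * X b : Ring8)) =
      w a * φ (X b) + φ (X a) * w b := fun a b => by
    have : ∀ j, w j * φ (pderiv j (X a * X b : Ring8)) =
        (if a = j then w j * φ (X b) else 0) + (if b = j then φ (X a) * w j else 0) := fun j => by
      rw [pderiv_mul, pderiv_X, pderiv_X, Pi.single_apply, Pi.single_apply]
      split_ifs <;> simp_all [mul_comm, mul_add]
    simp only [this, Finset.sum_add_distrib, Finset.sum_ite_eq, Finset.mem_univ, if_true]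
  simp only [quadric, qf, hadd, hC, sq (X _ : Ring8), hX, pol]
  ring

lemma Generic.map {K : Type*} [Field K] [Algebra ℂ K] {m n k : ℂ} (h : Generic m n k) :
    Generic (algebraMap ℂ K m) (algebraMap ℂ K n) (algebraMap ℂ K k) := by
  have hinj := (algebraMap ℂ K).injective
  refine ⟨(map_ne_zero _).mpr h.m_ne, (map_ne_zero _).mpr h.n_ne, (map_ne_zero _).mpr h.k_ne,
    fun e => h.ne₁ (hinj ?_), fun e => h.ne₂ (hinj ?_), fun e => h.ne₃ (hinj ?_),
    fun e => h.ne₄ (hinj ?_)⟩ <;>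
    simpa only [map_mul, map_pow, map_ofNat, map_add, map_zero] using e

/-- A point of the plane `P^2_-` in general position. -/
structure Admissible (v : Vec) : Prop where
  odd : ∀ i, v (-i) = -v i
  one_ne : v 1 ≠ 0
  three_ne : v 3 ≠ 0
  pow_ne : v 1 ^ 8 ≠ v 3 ^ 8
  generic : Generic ((v 1 + v 3) / 2) ((v 1 - v 3) / 2) (v 2)

lemma Admissible.ne_zero {v : Vec} (h : Admissible v) : v ≠ 0 := fun h0 =>
  h.one_ne (congrFun h0 1)

/-- The residue field at `P` turns an arbitrary prime into a point with coordinates in an extension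
of `ℂ`, so closed and non-closed points are handled alike. -/
lemma exists_algHom_ker_eq (P : Ideal Ring8) [P.IsPrime] :
    ∃ (K : Type) (_ : Field K) (_ : Algebra ℂ K) (φ : Ring8 →ₐ[ℂ] K), ∀ f, φ f = 0 ↔ f ∈ P := by
  refine ⟨FractionRing (Ring8 ⧸ P), inferInstance, inferInstance,
    (IsScalarTower.toAlgHom ℂ (Ring8 ⧸ P) (FractionRing (Ring8 ⧸ P))).comp
      (Ideal.Quotient.mkₐ ℂ P), fun f => ?_⟩
  rw [AlgHom.comp_apply, IsScalarTower.coe_toAlgHom',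
    FaithfulSMul.algebraMap_eq_zero_iff]
  exact Ideal.Quotient.eq_zero_iff_mem

/-- Failure of the Jacobian criterion forces a prime ideal to be that of a point of the orbit. -/
lemma Admissible.exists_of_not_jacobian {v : Vec} (h : Admissible v) {P : Ideal Ring8}
    [P.IsPrime] {i₀ : ZMod 8} (hi₀ : X i₀ - 1 ∈ P) (hq : ∀ t, quadric v t ∈ P)
    (b : Fin 5 → Ring8)
    (hb : ∀ j, ∑ i, b i * pderiv j
      ((Fin.cons (X i₀ - 1) fun k : Fin 4 => quadric v (k.val : ZMod 8) : Fin 5 → Ring8) i) ∈ P)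
    (hbP : ∃ i, b i ∉ P) :
    ∃ a c, ∀ n, ∀ f ∈ deg n, f ∈ P ↔
      f ∈ pointIdeal (Projectivization.mk ℂ (heis a c v) (heis_ne_zero a c h.ne_zero)) := by
  obtain ⟨K, _, _, φ, hφ⟩ := exists_algHom_ker_eq P
  have hφC : ∀ c, φ (C c) = algebraMap ℂ K c := fun c => φ.commutes c
  let x : ZMod 8 → K := fun i => φ (X i)
  have hx0 : x i₀ = 1 := by
    have := (hφ _).mpr hi₀
    rwa [map_sub, map_one, sub_eq_zero] at this
  obtain ⟨A, hA⟩ : ∃ A, A = algebraMap ℂ K (v 1 * v 3) := ⟨_, rfl⟩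
  obtain ⟨B, hB⟩ : ∃ B, B = algebraMap ℂ K (-v 2 ^ 2) := ⟨_, rfl⟩
  obtain ⟨D, hD⟩ : ∃ D, D = algebraMap ℂ K (v 1 ^ 2 + v 3 ^ 2) := ⟨_, rfl⟩
  have hqf : ∀ t, qf A B D t x = 0 := fun t => by
    have := (hφ _).mpr (hq t)
    rw [quadric, ← AlgHom.coe_toRingHom, map_qf] at this
    simpa only [AlgHom.coe_toRingHom, hφC, ← hA, ← hB, ← hD] using this
  have hpol : ∀ t (w : ZMod 8 → K), ∑ j, w j * φ (pderiv j (quadric v t)) = pol A B D t x w :=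
    fun t w => by
      have := sum_mul_pderiv_quadric φ.toRingHom v t w
      simpa only [AlgHom.toRingHom_eq_coe, AlgHom.coe_toRingHom, hφC, ← hA, ← hB, ← hD] using this
  have hrel : ∀ w : ZMod 8 → K, φ (b 0) * w i₀ +
      ∑ k : Fin 4, φ (b k.succ) * pol A B D (k.val : ZMod 8) x w = 0 := by
    intro w
    have h1 : ∀ j, ∑ i, φ (b i) * φ (pderiv j
      ((Fin.cons (X i₀ - 1) fun k : Fin 4 => quadric v (k.val : ZMod 8) : Fin 5 → Ring8) i)) = 0 :=
      fun j => by
        have := (hφ _).mpr (hb j)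
        simpa only [map_sum, map_mul] using this
    have h2 : ∑ j, w j * ∑ i, φ (b i) * φ (pderiv j
      ((Fin.cons (X i₀ - 1) fun k : Fin 4 => quadric v (k.val : ZMod 8) : Fin 5 → Ring8) i)) = 0 :=
      Finset.sum_eq_zero fun j _ => by rw [h1, mul_zero]
    simp only [Fin.sum_univ_succ (n := 4), Fin.cons_zero, Fin.cons_succ, mul_add,
      Finset.sum_add_distrib, Finset.mul_sum] at h2
    rw [Finset.sum_comm] at h2
    simp only [← hpol, Finset.mul_sum]
    rw [← h2]
    congr 1
    · have : ∀ j, w j * (φ (b 0) * φ (pderiv j (X i₀ - 1 : Ring8))) =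
          if i₀ = j then φ (b 0) * w j else 0 := fun j => by
        rw [map_sub, pderiv_X, pderiv_one, sub_zero, Pi.single_apply]
        split_ifs <;> simp_all [mul_comm]
      simp only [this, Finset.sum_ite_eq, Finset.mem_univ, if_true]
    · refine Finset.sum_congr rfl fun k _ => Finset.sum_congr rfl fun j _ => by ring
  have hpolx : ∀ t, pol A B D t x x = 0 := fun t => by
    have : pol A B D t x x = 2 * qf A B D t x := by
      simp only [pol, qf]
      ring
    rw [this, hqf, mul_zero]
  -- Euler's relation: in the direction `x` the polar forms vanish while `x i₀ = 1`, so the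
  -- dehomogenising equation does not take part in the dependence.
  have hb0 : φ (b 0) = 0 := by
    simpa [hpolx, hx0] using hrel x
  have hsing : IsSing A B D x := by
    -- The four coefficients are extended 4-periodically to `ℤ/8`.
    refine ⟨hqf, fun t => φ (b (Fin.succ ⟨t.val % 4, Nat.mod_lt _ (by norm_num)⟩)), fun t => ?_,
      fun h0 => ?_, fun w => ?_⟩
    · have : ∀ t : ZMod 8, (t + 4).val % 4 = t.val % 4 := by decide
      simp only [this]
    · obtain ⟨i, hi⟩ := hbP
      apply hi
      rw [← hφ]
      induction i using Fin.cases with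
      | zero => exact hb0
      | succ k =>
        have h1 := congrFun h0 (k.val : ZMod 8)
        have h2 : ∀ k : Fin 4, ((k.val : ZMod 8)).val % 4 = k.val := by decide
        simp only [h2] at h1
        exact h1
    · have h1 := hrel w
      rw [hb0, zero_mul, zero_add, Fin.sum_univ_four] at h1
      rw [sum_zmod_eight]
      have p4 := pol_add_four A B D 0 x w
      have p5 := pol_add_four A B D 1 x w
      have p6 := pol_add_four A B D 2 x w
      have p7 := pol_add_four A B D 3 x w
      rw [show (0 + 4 : ZMod 8) = 4 by decide] at p4
      rw [show (1 + 4 : ZMod 8) = 5 by decide] at p5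
      rw [show (2 + 4 : ZMod 8) = 6 by decide] at p6
      rw [show (3 + 4 : ZMod 8) = 7 by decide] at p7
      rw [p4, p5, p6, p7]
      have e0 : φ (b (Fin.succ 0)) * pol A B D 0 x w + φ (b (Fin.succ 1)) * pol A B D 1 x w +
        φ (b (Fin.succ 2)) * pol A B D 2 x w + φ (b (Fin.succ 3)) * pol A B D 3 x w = 0 := h1
      change φ (b (Fin.succ 0)) * pol A B D 0 x w + φ (b (Fin.succ 1)) * pol A B D 1 x w +
        φ (b (Fin.succ 2)) * pol A B D 2 x w + φ (b (Fin.succ 3)) * pol A B D 3 x w +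
        φ (b (Fin.succ 0)) * pol A B D 0 x w + φ (b (Fin.succ 1)) * pol A B D 1 x w +
        φ (b (Fin.succ 2)) * pol A B D 2 x w + φ (b (Fin.succ 3)) * pol A B D 3 x w = 0
      linear_combination 2 * e0
  obtain ⟨c, a, d, hc⟩ := IsSing.inOrbit (y := v) h.generic.map h.odd
    (by rw [← map_add]; congr 1; ring) rfl (by rw [← map_sub]; congr 1; ring)
    (x := x) (by
      convert hsing using 1
      · rw [hA, ← map_pow, ← map_pow, ← map_sub]
        congr 1
        ring
      · rw [hB, map_neg, map_pow]
      · rw [hD, ← map_pow, ← map_pow, ← map_ofNat (algebraMap ℂ K) 2, ← map_mul, ← map_mul,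
          ← map_add]
        congr 1
        ring)
    (fun h0 => one_ne_zero (hx0.symm.trans (congrFun h0 i₀)))
  have hxi : ∀ i, φ (X i) = c * algebraMap ℂ K (heis a d v i) := fun i => by
    have := congrFun hc i
    simpa [heis_apply, x] using this
  have hc0 : c ≠ 0 := by
    rintro rfl
    have := hxi i₀
    rw [zero_mul] at this
    exact one_ne_zero (hx0.symm.trans this)
  -- The coordinates of the point are proportional to a complex vector, so a form lies in `P`
  -- exactly when it vanishes at that vector: `P` comes from a closed point.
  refine ⟨a, d, fun n f hf => ?_⟩
  rw [mem_pointIdeal_mk_iff hf, ← hφ]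
  have h1 : φ f = aeval (fun i => c * algebraMap ℂ K (heis a d v i)) f := by
    conv_lhs => rw [MvPolynomial.aeval_unique φ]
    simp only [Function.comp_def, hxi]
  rw [h1, aeval_mul_of_mem_deg _ _ hf, mul_eq_zero, or_iff_right (pow_ne_zero _ hc0)]
  have h2 : aeval (fun i => algebraMap ℂ K (heis a d v i)) f = algebraMap ℂ K (eval (heis a d v) f) := by
    exact MvPolynomial.aeval_algebraMap_apply K (heis a d v) f
  rw [h2, map_eq_zero]

lemma Admissible.toIdeal_eq {v : Vec} (h : Admissible v) :
    (idealV8 (Projectivization.mk ℂ v h.ne_zero)).toIdeal =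
      Ideal.span (Set.range fun k : Fin 4 => quadric v (k.val : ZMod 8)) :=
  toIdeal_idealV8 h.ne_zero h.odd h.one_ne h.three_ne

lemma Admissible.quadric_mem {v : Vec} (h : Admissible v) (t : ZMod 8) :
    quadric v t ∈ (idealV8 (Projectivization.mk ℂ v h.ne_zero)).toIdeal :=
  Ideal.subset_span (quadric_mem_orbitQuadrics h.ne_zero h.odd t)

lemma P7.exists_X_notMem (p : P7) : ∃ i, (X i : Ring8) ∉ p.asHomogeneousIdeal := by
  by_contra! hX
  refine p.not_irrelevant_le ?_
  rw [HomogeneousIdeal.irrelevant_le]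
  intro n hn f hf
  refine mem_ker_constantCoeff f p.asHomogeneousIdeal.toIdeal hX ?_
  exact IsHomogeneous.coeff_eq_zero hf (by simpa using hn.ne)

/-- Away from the orbit the complete intersection is regular. -/
theorem Admissible.isRegularLocalRing_or {v : Vec} (h : Admissible v)
    (x : V8 (Projectivization.mk ℂ v h.ne_zero)) :
    IsRegularLocalRing ((V8 (Projectivization.mk ℂ v h.ne_zero)).presheaf.stalk x) ∨
    ∃ a b, (immersion (idealV8 (Projectivization.mk ℂ v h.ne_zero))).base x =
      toP7 (Projectivization.mk ℂ (heis a b v) (heis_ne_zero a b h.ne_zero)) := by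
  obtain ⟨i₀, hi₀⟩ := P7.exists_X_notMem ((immersion _).base x)
  obtain ⟨P, hP, π, hπ, hker, hIP, hℓ, hdeg⟩ :=
    exists_stalk_presentation _ x (X i₀) (isHomogeneous_X ℂ i₀) hi₀
  let F : Fin 5 → Ring8 := Fin.cons (X i₀ - 1) fun k : Fin 4 => quadric v (k.val : ZMod 8)
  have hFP : ∀ i, F i ∈ P := Fin.cases hℓ fun k => hIP (h.quadric_mem _)
  by_cases hJ : ∀ b : Fin 5 → Ring8, (∀ j, ∑ i, b i * pderiv j (F i) ∈ P) → ∀ i, b i ∈ P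
  · left
    refine IsRegularLocalRing.of_surjective_of_independent π hπ
      (fun i => algebraMap _ (Localization.AtPrime P) (F i)) (fun i => ?_) ?_ ?_
    · rw [← Localization.AtPrime.map_eq_maximalIdeal]
      exact Ideal.mem_map_of_mem _ (hFP i)
    · rw [hker, h.toIdeal_eq, sup_comm, ← Ideal.span_insert, ← Fin.range_cons, Ideal.map_span,
        ← Set.range_comp]
      rfl
    · exact MvPolynomial.independent_of_jacobian P F hJ hFP
  · right
    push Not at hJ
    obtain ⟨b, hb, hbP⟩ := hJ
    obtain ⟨a, c, hac⟩ := h.exists_of_not_jacobian hℓ (fun t => hIP (h.quadric_mem t)) b hb hbP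
    exact ⟨a, c, P7.ext_of_forall_mem_deg fun n f hf => (hdeg n f hf).symm.trans (hac n f hf)⟩

end SmoothPoints

end HeisenbergEight

namespace HeisenbergEight

open MvPolynomial AlgebraicGeometry

/-! ### From affine 8-space to a four-dimensional local ring -/

section NodeOfSystem

open IsLocalRing

lemma natCast_le_of_le_add_natCast {a b c : ℕ} {d : WithBot ℕ∞}
    (h : ((a + b : ℕ) : WithBot ℕ∞) ≤ d + c) (hc : c ≤ b) : (a : WithBot ℕ∞) ≤ d := by
  induction d with
  | bot => simp at h
  | coe d =>
    induction d with
    | top => exact le_of_le_of_eq (WithBot.coe_le_coe.mpr le_top) rfl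
    | coe d =>
      have h' : ((a + b : ℕ) : WithBot ℕ∞) ≤ ((d + c : ℕ) : WithBot ℕ∞) := by exact_mod_cast h
      have h2 : a + b ≤ d + c := by exact_mod_cast h'
      have h3 : a ≤ d := by omega
      exact_mod_cast h3

/-- The quadratic forms `f_0 + f_2`, `f_0 - f_2`, `f_1 - f_3` and `f_1 + f_3`. -/
def blockForm {R : Type*} [CommRing R] (m n k : R) (Z : ZMod 8 → R) : Fin 4 → R :=
  ![m ^ 2 * ((Z 0 + Z 4) ^ 2 + (Z 2 + Z 6) ^ 2) + -k ^ 2 * ((Z 1 + Z 5) * (Z 3 + Z 7)) +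
      -n ^ 2 * ((Z 0 - Z 4) ^ 2 + (Z 2 - Z 6) ^ 2),
    -n ^ 2 * ((Z 0 + Z 4) ^ 2 - (Z 2 + Z 6) ^ 2) + m ^ 2 * ((Z 0 - Z 4) ^ 2 - (Z 2 - Z 6) ^ 2) -
      -k ^ 2 * ((Z 1 - Z 5) * (Z 3 - Z 7)),
    -n ^ 2 * ((Z 1 + Z 5) ^ 2 - (Z 3 + Z 7) ^ 2) + m ^ 2 * ((Z 1 - Z 5) ^ 2 - (Z 3 - Z 7) ^ 2) +
      -k ^ 2 * ((Z 0 - Z 4) * (Z 2 - Z 6)),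
    m ^ 2 * ((Z 1 + Z 5) ^ 2 + (Z 3 + Z 7) ^ 2) + -k ^ 2 * ((Z 0 + Z 4) * (Z 2 + Z 6)) +
      -n ^ 2 * ((Z 1 - Z 5) ^ 2 + (Z 3 - Z 7) ^ 2)]

lemma map_blockForm {R R' : Type*} [CommRing R] [CommRing R'] (φ : R →+* R') (m n k : R)
    (Z : ZMod 8 → R) (i : Fin 4) :
    φ (blockForm m n k Z i) = blockForm (φ m) (φ n) (φ k) (fun i => φ (Z i)) i := by
  fin_cases i <;> simp [blockForm]

variable {O : Type*} {R : Type*} [CommRing O] [IsLocalRing O] [IsNoetherianRing O]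
  [CommRing R] [IsLocalRing R] [Algebra ℂ O]

/-- A quotient of an eight-dimensional local ring by the equations of the complete intersection. -/
theorem node_of_blockForm (π : O →+* R) (hπ : Function.Surjective π) {m n k : ℂ}
    (hg : Generic m n k) (Z : ZMod 8 → O) (y : Vec) (hodd : ∀ i, y (-i) = -y i)
    (hy1 : y 1 = m + n) (hy2 : y 2 = k) (hy3 : y 3 = m - n)
    (hZm : ∀ i, Z i - algebraMap ℂ O (y i) ∈ maximalIdeal O)
    (hmZ : ∀ J : Ideal O, (∀ i, Z i - algebraMap ℂ O (y i) ∈ J) → maximalIdeal O ≤ J)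
    (hdim : (8 : ℕ) ≤ ringKrullDim O) (hres : ∀ o : O, ∃ c, o - algebraMap ℂ O c ∈ maximalIdeal O)
    (hker : RingHom.ker π = Ideal.span (Set.range (blockForm (algebraMap ℂ O m) (algebraMap ℂ O n)
      (algebraMap ℂ O k) Z) ∪ {Z 2 - Z 6 - 2 * algebraMap ℂ O k})) :
    Nonempty (AdicCompletion (maximalIdeal R) R ≃+* (MvPowerSeries (Fin (3 + 1)) ℂ ⧸
      Ideal.span {∑ i, (MvPowerSeries.X i : MvPowerSeries (Fin (3 + 1)) ℂ) ^ 2})) ∧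
    ¬ IsRegularLocalRing R := by
  classical
  generalize hG : blockForm (algebraMap ℂ O m) (algebraMap ℂ O n) (algebraMap ℂ O k) Z = G at hker
  -- Three of the block forms and the normalisation cut `O` down to a ring of dimension at least 4;
  -- the fourth block form remains as the equation of the hypersurface.
  let s : Finset O := {G 0, G 1, G 2, Z 2 - Z 6 - 2 * algebraMap ℂ O k}
  have hs : (s : Set O) = {G 0, G 1, G 2, Z 2 - Z 6 - 2 * algebraMap ℂ O k} := by
    simp [s]
  have hsk : (s : Set O) ⊆ RingHom.ker π := by
    rw [hker, hs]
    refine Set.Subset.trans ?_ Ideal.subset_span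
    rintro _ (rfl | rfl | rfl | rfl) <;> simp
  have hle : RingHom.ker π ≤ maximalIdeal O := le_maximalIdeal (RingHom.ker_ne_top π)
  have hsm : (s : Set O) ⊆ maximalIdeal O := hsk.trans hle
  have hnt : Nontrivial (O ⧸ Ideal.span (s : Set O)) :=
    Ideal.Quotient.nontrivial_iff.mpr fun h => (maximalIdeal.isMaximal O).ne_top
      (top_le_iff.mp (h ▸ Ideal.span_le.mpr hsm))
  have hT : IsLocalRing (O ⧸ Ideal.span (s : Set O)) :=
    IsLocalRing.of_surjective' (Ideal.Quotient.mk _) Ideal.Quotient.mk_surjective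
  have hRn : IsNoetherianRing R := isNoetherianRing_of_surjective O R π hπ
  let mk := Ideal.Quotient.mk (Ideal.span (s : Set O))
  have hloc : IsLocalHom mk := IsLocalHom.of_surjective _ Ideal.Quotient.mk_surjective
  have hmk : ∀ o, mk o ∈ maximalIdeal (O ⧸ Ideal.span (s : Set O)) ↔ o ∈ maximalIdeal O := fun o => by
    rw [mem_maximalIdeal, mem_maximalIdeal, mem_nonunits_iff, mem_nonunits_iff, isUnit_map_iff]
  have hmkc : ∀ c, mk (algebraMap ℂ O c) = algebraMap ℂ (O ⧸ Ideal.span (s : Set O)) c := fun c => rfl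
  have hmks : ∀ o ∈ (s : Set O), mk o = 0 := fun o ho =>
    Ideal.Quotient.eq_zero_iff_mem.mpr (Ideal.subset_span ho)
  have hGT : ∀ i, mk (G i) = blockForm (algebraMap ℂ _ m) (algebraMap ℂ _ n) (algebraMap ℂ _ k)
      (fun i => mk (Z i)) i := fun i => by rw [← hG, map_blockForm]; rfl
  let πT : O ⧸ Ideal.span (s : Set O) →+* R :=
    Ideal.Quotient.lift _ π fun o ho => (Ideal.span_le.mpr hsk) ho
  refine node_of_coordinates πT (Ideal.Quotient.lift_surjective_of_surjective _ _ hπ) hg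
    (fun i => mk (Z i)) y hodd hy1 hy2 hy3 ?_ ?_ ?_ ?_ rfl rfl rfl ?_ ?_ ?_ ?_ ?_
  · intro i
    rw [← hmkc, ← map_sub, hmk]
    exact hZm i
  · intro J hJ t ht
    obtain ⟨o, rfl⟩ := Ideal.Quotient.mk_surjective t
    refine hmZ (J.comap mk) (fun i => ?_) ((hmk o).mp ht)
    rw [Ideal.mem_comap, map_sub]
    exact hJ i
  · have h1 := ringKrullDim_le_ringKrullDim_quotient_add_card s
      (by rw [IsLocalRing.ringJacobson_eq_maximalIdeal]; exact hsm)
    exact natCast_le_of_le_add_natCast (a := 4) (b := 4) (hdim.trans h1) Finset.card_le_four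
  · intro t
    obtain ⟨t, rfl⟩ := residue_surjective t
    obtain ⟨o, rfl⟩ := Ideal.Quotient.mk_surjective t
    obtain ⟨c, hc⟩ := hres o
    refine ⟨c, ?_⟩
    have := (residue_eq_zero_iff _).mpr ((hmk _).mpr hc)
    rw [map_sub, map_sub, sub_eq_zero] at this
    exact this.symm
  · have := hmks (Z 2 - Z 6 - 2 * algebraMap ℂ O k) (by simp [hs])
    rw [map_sub, sub_eq_zero, map_sub, map_mul, map_ofNat] at this
    exact this
  · exact (hGT 0).symm.trans (hmks _ (by simp [hs]))
  · exact (hGT 1).symm.trans (hmks _ (by simp [hs]))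
  · exact (hGT 2).symm.trans (hmks _ (by simp [hs]))
  · change _ = Ideal.span {blockForm (algebraMap ℂ _ m) (algebraMap ℂ _ n) (algebraMap ℂ _ k)
      (fun i => mk (Z i)) 3}
    rw [← hGT 3, Ideal.ker_quotient_lift, hker, Ideal.map_span]
    refine le_antisymm (Ideal.span_le.mpr ?_) (Ideal.span_mono ?_)
    · rintro _ ⟨o, (⟨i, rfl⟩ | rfl), rfl⟩
      · fin_cases i
        · exact (hmks (G 0) (by simp [hs])).symm ▸ zero_mem _
        · exact (hmks (G 1) (by simp [hs])).symm ▸ zero_mem _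
        · exact (hmks (G 2) (by simp [hs])).symm ▸ zero_mem _
        · exact Ideal.subset_span rfl
      · rw [SetLike.mem_coe]
        exact (hmks (Z 2 - Z 6 - 2 * algebraMap ℂ O k) (by simp [hs])).symm ▸ zero_mem _
    · rintro _ rfl
      exact ⟨G 3, Or.inl ⟨3, rfl⟩, rfl⟩

end NodeOfSystem

end HeisenbergEight

namespace HeisenbergEight

open MvPolynomial AlgebraicGeometry

/-! ### The orbit points are nodes -/

noncomputable section OrbitPoints

open IsLocalRing

/-- The linear forms that take at `heis a b v` the values of the coordinates of `v`. -/
def frame (a b i : ZMod 8) : Ring8 := C (chi (-(b * (i + a)))) * X (i + a)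

lemma eval_frame (a b i : ZMod 8) (v : Vec) : eval (heis a b v) (frame a b i) = v i := by
  rw [frame, map_mul, eval_C, eval_X, heis_apply_complex, ← mul_assoc, ← chi_add, neg_add_cancel,
    chi_zero, one_mul, add_sub_cancel_right]

lemma X_eq_frame (a b j : ZMod 8) : (X j : Ring8) = C (chi (b * j)) * frame a b (j - a) := by
  rw [frame, sub_add_cancel, ← mul_assoc, ← C_mul, ← chi_add, add_neg_cancel, chi_zero, C_1,
    one_mul]

lemma frame_mem_deg (a b i : ZMod 8) : frame a b i ∈ deg 1 := by
  rw [frame, ← smul_eq_C_mul]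
  exact Submodule.smul_mem _ _ (isHomogeneous_X ℂ _)

/-- In the translated coordinates the quadrics are again the same forms up to units and a shift of
the index, so every orbit point can be treated as if it were `v`. -/
lemma qf_frame (v : Vec) (a b t : ZMod 8) :
    qf (C (v 1 * v 3)) (C (-v 2 ^ 2)) (C (v 1 ^ 2 + v 3 ^ 2)) t (frame a b) =
      C (chi (-(b * (2 * t + 2 * a)))) * quadric v (t + a) := by
  rw [quadric, ← sub_neg_eq_add t a, ← qf_mul_shift _ _ _ _ t (-a) X
    (fun i => C (chi (-(b * (i + a)))))]
  · simp only [sub_neg_eq_add]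
    rfl
  · intro i j hij
    rw [← C_mul, ← chi_add]
    congr 2
    linear_combination -b * hij

lemma forall_qf_mem {R : Type*} [CommRing R] {A B D : R} {x : ZMod 8 → R} {J : Ideal R}
    (h : ∀ k : Fin 4, qf A B D (k.val : ZMod 8) x ∈ J) (t : ZMod 8) : qf A B D t x ∈ J := by
  have ht : ∀ t : ZMod 8, ∃ k : Fin 4, t = (k.val : ZMod 8) ∨ t = (k.val : ZMod 8) + 4 := by decide
  obtain ⟨k, rfl | rfl⟩ := ht t
  · exact h k
  · exact (qf_add_four A B D _ x).symm ▸ h k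

/-- Passing to sums and differences loses nothing because 2 is invertible, and the characters
introduced by `frame` are units. -/
lemma span_quadric_eq_span_blockForm {v : Vec} {m n : ℂ} (h1 : v 1 = m + n) (h3 : v 3 = m - n)
    (a b : ZMod 8) :
    Ideal.span (Set.range fun k : Fin 4 => quadric v (k.val : ZMod 8)) =
      Ideal.span (Set.range (blockForm (C m) (C n) (C (v 2)) (frame a b))) := by
  have hA : (C (v 1 * v 3) : Ring8) = C m ^ 2 - C n ^ 2 := by
    rw [h1, h3, ← C_pow, ← C_pow, ← C_sub]
    congr 1
    ring
  have hB : (C (-v 2 ^ 2) : Ring8) = -C (v 2) ^ 2 := by rw [C_neg, C_pow]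
  have hD : (C (v 1 ^ 2 + v 3 ^ 2) : Ring8) = 2 * C m ^ 2 + 2 * C n ^ 2 := by
    rw [h1, h3, ← map_ofNat (C : ℂ →+* Ring8) 2, ← C_pow, ← C_pow, ← C_mul, ← C_mul, ← C_add]
    congr 1
    ring
  have hq := qf_frame v a b
  rw [hA, hB, hD] at hq
  have b0 : _ = blockForm (C m) (C n) (C (v 2)) (frame a b) 0 :=
    qf_zero_add_qf_two (C m) (C n) (C (v 2)) (frame a b)
  have b1 : _ = blockForm (C m) (C n) (C (v 2)) (frame a b) 1 :=
    qf_zero_sub_qf_two (C m) (C n) (C (v 2)) (frame a b)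
  have b2 : _ = blockForm (C m) (C n) (C (v 2)) (frame a b) 2 :=
    qf_one_sub_qf_three (C m) (C n) (C (v 2)) (frame a b)
  have b3 : _ = blockForm (C m) (C n) (C (v 2)) (frame a b) 3 :=
    qf_one_add_qf_three (C m) (C n) (C (v 2)) (frame a b)
  refine le_antisymm (Ideal.span_le.mpr ?_) (Ideal.span_le.mpr ?_)
  · have hb : ∀ i, blockForm (C m) (C n) (C (v 2)) (frame a b) i ∈
        Ideal.span (Set.range (blockForm (C m) (C n) (C (v 2)) (frame a b))) := fun i =>
      Ideal.subset_span ⟨i, rfl⟩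
    generalize Ideal.span (Set.range (blockForm (C m) (C n) (C (v 2)) (frame a b))) = J at hb
    have h0 := b0 ▸ hb 0
    have h1 := b1 ▸ hb 1
    have h2 := b2 ▸ hb 2
    have h3 := b3 ▸ hb 3
    have two : ∀ f : Ring8, 2 * f ∈ J → f ∈ J := fun f hf => by
      have e : f = C 2⁻¹ * (2 * f) := by
        rw [← mul_assoc, ← map_ofNat (C : ℂ →+* Ring8) 2, ← C_mul, inv_mul_cancel₀ two_ne_zero, C_1,
          one_mul]
      rw [e]
      exact J.mul_mem_left _ hf
    have key := forall_qf_mem (J := J) (A := C m ^ 2 - C n ^ 2) (B := -C (v 2) ^ 2)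
      (D := 2 * C m ^ 2 + 2 * C n ^ 2) (x := frame a b) (fun k => two _ (by
        fin_cases k
        · convert J.add_mem h0 h1 using 1
          simp only [Nat.cast_zero]
          ring
        · convert J.add_mem h3 h2 using 1
          simp only [Nat.cast_one]
          ring
        · convert J.sub_mem h0 h1 using 1
          simp only [Nat.cast_ofNat]
          ring
        · convert J.sub_mem h3 h2 using 1
          simp only [Nat.cast_ofNat]
          ring))
    rintro _ ⟨k, rfl⟩
    have h := J.mul_mem_left (C (chi (b * (2 * (k.val : ZMod 8))))) (key ((k.val : ZMod 8) - a))
    rw [hq, ← mul_assoc, ← C_mul, ← chi_add, sub_add_cancel] at h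
    rw [show b * (2 * (k.val : ZMod 8)) + -(b * (2 * ((k.val : ZMod 8) - a) + 2 * a)) = 0 by ring,
      chi_zero, C_1, one_mul] at h
    exact h
  · have hk : ∀ t, quadric v t ∈ Ideal.span (Set.range fun k : Fin 4 => quadric v (k.val : ZMod 8)) :=
      forall_qf_mem fun k => Ideal.subset_span ⟨k, rfl⟩
    generalize Ideal.span (Set.range fun k : Fin 4 => quadric v (k.val : ZMod 8)) = J at hk
    have h : ∀ t, qf (C m ^ 2 - C n ^ 2) (-C (v 2) ^ 2) (2 * C m ^ 2 + 2 * C n ^ 2) t (frame a b) ∈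
        J := fun t => (hq t).symm ▸ J.mul_mem_left _ (hk _)
    rintro _ ⟨i, rfl⟩
    fin_cases i
    · exact (show blockForm (C m) (C n) (C (v 2)) (frame a b) 0 ∈ J from b0 ▸ J.add_mem (h 0) (h 2))
    · exact (show blockForm (C m) (C n) (C (v 2)) (frame a b) 1 ∈ J from b1 ▸ J.sub_mem (h 0) (h 2))
    · exact (show blockForm (C m) (C n) (C (v 2)) (frame a b) 2 ∈ J from b2 ▸ J.sub_mem (h 1) (h 3))
    · exact (show blockForm (C m) (C n) (C (v 2)) (frame a b) 3 ∈ J from b3 ▸ J.add_mem (h 1) (h 3))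

/-- The prime ideal of the stalk presentation at a closed point. -/
lemma mem_iff_eval_eq_zero {P : Ideal Ring8} [P.IsPrime] {w : Vec} {ℓ : Ring8} (hℓ : ℓ ∈ deg 1)
    (hℓw : eval w ℓ = 1) (hℓP : ℓ - 1 ∈ P) (hP : ∀ f ∈ deg 1, eval w f = 0 → f ∈ P) (f : Ring8) :
    f ∈ P ↔ eval w f = 0 := by
  have hX : ∀ i, X i - C (w i) ∈ P := fun i => by
    -- This linear form vanishes at `w`, so homogeneity suffices; then `ℓ` is replaced by 1 modulo
    -- `P`.
    have h1 : X i - C (w i) * ℓ ∈ P := by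
      refine hP _ (Submodule.sub_mem _ (isHomogeneous_X ℂ i) ?_) ?_
      · rw [← smul_eq_C_mul]
        exact Submodule.smul_mem _ _ hℓ
      · rw [map_sub, map_mul, hℓw, eval_X, eval_C, mul_one, sub_self]
    have h2 := P.add_mem h1 (P.mul_mem_left (C (w i)) hℓP)
    convert h2 using 1
    ring
  have key : ∀ f : Ring8, f - C (eval w f) ∈ P := fun f => by
    have : (Ideal.Quotient.mk P) = ((Ideal.Quotient.mk P).comp C).comp (eval w) := by
      refine MvPolynomial.ringHom_ext (fun c => by simp) fun i => ?_
      simpa using Ideal.Quotient.eq.mpr (hX i)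
    exact Ideal.Quotient.eq.mp (RingHom.congr_fun this f)
  constructor
  · intro hf
    by_contra h0
    have h1 : C (eval w f) ∈ P := by
      convert P.sub_mem hf (key f) using 1
      ring
    exact ‹P.IsPrime›.ne_top (Ideal.eq_top_of_isUnit_mem _ h1
      ((isUnit_iff_ne_zero.mpr h0).map (C : ℂ →+* Ring8)))
  · intro hf
    simpa [hf] using key f

lemma exists_sub_algebraMap_mem (w : Vec) (P : Ideal Ring8) [P.IsPrime]
    (hP : ∀ f, f ∈ P ↔ eval w f = 0) (o : Localization.AtPrime P) :
    ∃ c, o - algebraMap ℂ (Localization.AtPrime P) c ∈ maximalIdeal (Localization.AtPrime P) := by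
  obtain ⟨f, s, rfl⟩ := IsLocalization.exists_mk'_eq P.primeCompl o
  have hs : eval w s ≠ 0 := fun h => s.2 ((hP _).mpr h)
  refine ⟨eval w f / eval w s, ?_⟩
  have hu : IsUnit (algebraMap _ (Localization.AtPrime P) (s : Ring8)) :=
    IsLocalization.map_units _ s
  rw [← (maximalIdeal _).unit_mul_mem_iff_mem hu, mul_sub, IsLocalization.mk'_spec',
    IsScalarTower.algebraMap_apply ℂ Ring8, ← map_mul, ← map_sub,
    ← Localization.AtPrime.map_eq_maximalIdeal]
  refine Ideal.mem_map_of_mem _ ((hP _).mpr ?_)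
  simp only [algebraMap_eq, map_sub, map_mul, eval_C]
  field_simp
  ring

/-- Each of the `r + 1` equations lowers the dimension by at most one. With `r = 4` in dimension 8
this is the lower bound 3 at orbit points. -/
lemma le_ringKrullDim_of_ker_eq_span {O R : Type*} [CommRing O] [IsLocalRing O]
    [IsNoetherianRing O] [CommRing R] [Nontrivial R] (π : O →+* R) (hπ : Function.Surjective π)
    {r a : ℕ} (F : Fin r → O) (e : O) (hker : RingHom.ker π = Ideal.span (Set.range F ∪ {e}))
    (hdim : ((a + (r + 1) : ℕ) : WithBot ℕ∞) ≤ ringKrullDim O) :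
    (a : WithBot ℕ∞) ≤ ringKrullDim R := by
  classical
  let s : Finset O := Finset.univ.image F ∪ {e}
  have hs : (s : Set O) = Set.range F ∪ {e} := by simp [s]
  have hcard : s.card ≤ r + 1 :=
    (Finset.card_union_le _ _).trans
      (Nat.add_le_add (Finset.card_image_le.trans (Finset.card_fin r).le) le_rfl)
  have h1 := ringKrullDim_le_ringKrullDim_quotient_add_card s (by
    rw [IsLocalRing.ringJacobson_eq_maximalIdeal]
    refine Ideal.span_le.mp ?_
    rw [hs, ← hker]
    exact le_maximalIdeal (RingHom.ker_ne_top π))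
  rw [hs, ← hker, ringKrullDim_eq_of_ringEquiv (RingHom.quotientKerEquivOfSurjective hπ)] at h1
  exact natCast_le_of_le_add_natCast (hdim.trans h1) hcard

/-- The points of the orbit are ordinary double points. -/
theorem Admissible.isOrdinaryDoublePoint {v : Vec} (h : Admissible v)
    (x : V8 (Projectivization.mk ℂ v h.ne_zero)) (a b : ZMod 8)
    (hx : (immersion (idealV8 (Projectivization.mk ℂ v h.ne_zero))).base x =
      toP7 (Projectivization.mk ℂ (heis a b v) (heis_ne_zero a b h.ne_zero))) :
    IsOrdinaryDoublePoint 3 x ∧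
      ¬ IsRegularLocalRing ((V8 (Projectivization.mk ℂ v h.ne_zero)).presheaf.stalk x) ∧
      (3 : ℕ) ≤ ringKrullDim ((V8 (Projectivization.mk ℂ v h.ne_zero)).presheaf.stalk x) := by
  have hk := h.generic.k_ne
  have v6 := odd_apply_six h.odd
  -- With this choice `ℓ = 1` is the condition `V_2 = 2 k` in the translated coordinates, the
  -- normalisation used for the local equation.
  obtain ⟨ℓ, hℓ⟩ : ∃ ℓ : Ring8, ℓ = C (2 * v 2)⁻¹ * (frame a b 2 - frame a b 6) := ⟨_, rfl⟩
  have hℓd : ℓ ∈ deg 1 := by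
    rw [hℓ, ← smul_eq_C_mul]
    exact Submodule.smul_mem _ _ (Submodule.sub_mem _ (frame_mem_deg _ _ _) (frame_mem_deg _ _ _))
  have hℓw : eval (heis a b v) ℓ = 1 := by
    rw [hℓ, map_mul, eval_C, map_sub, eval_frame, eval_frame, v6]
    field_simp
    ring
  have hmem : ∀ n, ∀ f ∈ deg n, (f ∈ ((immersion (idealV8
      (Projectivization.mk ℂ v h.ne_zero))).base x).asHomogeneousIdeal ↔
      eval (heis a b v) f = 0) := fun n f hf => by
    rw [hx]
    exact mem_pointIdeal_mk_iff hf _ _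
  obtain ⟨P, hP, π, hπ, hker, hIP, hℓP, hdeg⟩ := exists_stalk_presentation _ x ℓ hℓd
    (fun h0 => by rw [hmem 1 ℓ hℓd, hℓw] at h0; exact one_ne_zero h0)
  have hPe := mem_iff_eval_eq_zero hℓd hℓw hℓP fun f hf h0 =>
    (hdeg 1 f hf).mpr ((hmem 1 f hf).mpr h0)
  let ι := algebraMap Ring8 (Localization.AtPrime P)
  have hιC : ∀ c, ι (C c) = algebraMap ℂ (Localization.AtPrime P) c := fun c => rfl
  have hmax : ∀ f, eval (heis a b v) f = 0 → ι f ∈ maximalIdeal (Localization.AtPrime P) :=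
    fun f hf => by
      rw [← Localization.AtPrime.map_eq_maximalIdeal]
      exact Ideal.mem_map_of_mem _ ((hPe f).mpr hf)
  have hy1 : v 1 = (v 1 + v 3) / 2 + (v 1 - v 3) / 2 := by ring
  have hy3 : v 3 = (v 1 + v 3) / 2 - (v 1 - v 3) / 2 := by ring
  have hdim : (8 : ℕ) ≤ ringKrullDim (Localization.AtPrime P) := by
    have := MvPolynomial.card_le_ringKrullDim_localization (heis a b v) P
      (Ideal.ext fun f => by rw [hPe, RingHom.mem_ker])
    rwa [ZMod.card] at this
  have hker' : RingHom.ker π = Ideal.span (Set.range (blockForm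
      (algebraMap ℂ (Localization.AtPrime P) ((v 1 + v 3) / 2))
      (algebraMap ℂ (Localization.AtPrime P) ((v 1 - v 3) / 2))
      (algebraMap ℂ (Localization.AtPrime P) (v 2)) fun i => ι (frame a b i)) ∪
      {ι (frame a b 2) - ι (frame a b 6) - 2 * algebraMap ℂ (Localization.AtPrime P) (v 2)}) := by
    rw [hker, h.toIdeal_eq, span_quadric_eq_span_blockForm hy1 hy3 a b, Ideal.map_sup,
      Ideal.map_span, ← Set.range_comp, Ideal.span_union]
    congr 1
    · congr 2
      funext i
      exact map_blockForm ι _ _ _ _ i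
    · have e : ι (frame a b 2) - ι (frame a b 6) - 2 * algebraMap ℂ (Localization.AtPrime P) (v 2) =
          ι (C (2 * v 2)) * ι (ℓ - 1) := by
        rw [← hιC, ← map_mul, hℓ, mul_sub, ← mul_assoc, ← C_mul, mul_inv_cancel₀ (by simpa using hk),
          C_1, one_mul, mul_one, map_sub, map_sub, C_mul, map_mul]
        congr 2
        exact (map_ofNat (ι.comp C) 2).symm
      rw [e, Ideal.map_span, Set.image_singleton]
      exact (Ideal.span_singleton_mul_left_unit
        ((isUnit_iff_ne_zero.mpr (by simpa using hk)).map (ι.comp C)) _).symm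
  rw [← and_assoc]
  refine ⟨?_, le_ringKrullDim_of_ker_eq_span π hπ _ _ hker' hdim⟩
  refine node_of_blockForm π hπ h.generic (fun i => ι (frame a b i)) v h.odd hy1 rfl hy3
    (fun i => ?_) (fun J hJ => ?_) hdim (exists_sub_algebraMap_mem _ P hPe) hker'
  · rw [← hιC, ← map_sub]
    refine hmax _ ?_
    rw [map_sub, eval_frame, eval_C, sub_self]
  · rw [← Localization.AtPrime.map_eq_maximalIdeal, Ideal.map_le_iff_le_comap]
    intro f hf
    -- Modulo `J` the coordinates are constants, so reduction factors through evaluation at the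
    -- point and kills every polynomial of `P`.
    have e : (Ideal.Quotient.mk J).comp ι =
        ((Ideal.Quotient.mk J).comp (ι.comp C)).comp (eval (heis a b v)) := by
      refine MvPolynomial.ringHom_ext (fun c => by simp) fun j => ?_
      have h1 : Ideal.Quotient.mk J (ι (frame a b (j - a))) =
          Ideal.Quotient.mk J (ι (C (v (j - a)))) := Ideal.Quotient.eq.mpr (hJ (j - a))
      simp only [RingHom.comp_apply, eval_X]
      conv_lhs => rw [X_eq_frame a b j, map_mul, map_mul, h1]
      rw [heis_apply_complex, C_mul, map_mul, map_mul]
    have h2 := RingHom.congr_fun e f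
    simp only [RingHom.comp_apply, (hPe f).mp hf, map_zero] at h2
    exact Ideal.mem_comap.mpr (Ideal.Quotient.eq_zero_iff_mem.mp h2)

end OrbitPoints

end HeisenbergEight

namespace HeisenbergEight

open MvPolynomial AlgebraicGeometry

/-! ### Dimension of the scheme, general position and conclusion -/

noncomputable section Assembly

/-- The points of the subscheme defined by `I` are the homogeneous primes that contain `I`. -/
lemma exists_immersion_eq (I : HomogeneousIdeal deg) (p : P7)
    (hp : I.toIdeal ≤ p.asHomogeneousIdeal.toIdeal) :
    ∃ x : subscheme I, (immersion I).base x = p := by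
  have hsurj : Function.Surjective (quotMap I) := Ideal.Quotient.mk_surjective
  have hprime : p.asHomogeneousIdeal.toIdeal.IsPrime := p.isPrime
  have hker : RingHom.ker (Ideal.Quotient.mk I.toIdeal) ≤ p.asHomogeneousIdeal.toIdeal := by
    rwa [Ideal.mk_ker]
  have hmap : (p.asHomogeneousIdeal.map (quotMap I)).toIdeal =
      p.asHomogeneousIdeal.toIdeal.map (Ideal.Quotient.mk I.toIdeal) := rfl
  have hcomap : ∀ f, Ideal.Quotient.mk I.toIdeal f ∈ p.asHomogeneousIdeal.map (quotMap I) ↔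
      f ∈ p.asHomogeneousIdeal := fun f => by
    change f ∈ (p.asHomogeneousIdeal.toIdeal.map (Ideal.Quotient.mk I.toIdeal)).comap _ ↔ _
    rw [Ideal.comap_map_of_surjective' _ Ideal.Quotient.mk_surjective, sup_eq_left.mpr hker]
    rfl
  refine ⟨⟨p.asHomogeneousIdeal.map (quotMap I),
    Ideal.map_isPrime_of_surjective Ideal.Quotient.mk_surjective hker, fun hle => ?_⟩, ?_⟩
  · refine p.not_irrelevant_le ?_
    rw [HomogeneousIdeal.irrelevant_le]
    intro n hn f hf
    refine (hcomap f).mp (hle ?_)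
    exact HomogeneousIdeal.mem_irrelevant_of_mem (quotDeg I) hn (Submodule.mem_map_of_mem hf)
  · exact P7.ext_of_forall_mem_deg fun n f _ => hcomap f

lemma Admissible.toIdeal_le {v : Vec} (h : Admissible v) (a b : ZMod 8) :
    (idealV8 (Projectivization.mk ℂ v h.ne_zero)).toIdeal ≤
      pointIdeal (Projectivization.mk ℂ (heis a b v) (heis_ne_zero a b h.ne_zero)) :=
  Ideal.span_le.mpr fun _ hf => hf.2.2 _ ((mem_orbit_iff v h.ne_zero _).mpr ⟨a, b, rfl⟩)

lemma Admissible.exists_point {v : Vec} (h : Admissible v) (a b : ZMod 8) :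
    ∃ x : V8 (Projectivization.mk ℂ v h.ne_zero),
      (immersion (idealV8 (Projectivization.mk ℂ v h.ne_zero))).base x =
        toP7 (Projectivization.mk ℂ (heis a b v) (heis_ne_zero a b h.ne_zero)) :=
  exists_immersion_eq _ _ (h.toIdeal_le a b)

/-- The points of the complete intersection with `x_{i+4} = x_i`. -/
lemma eq_zero_of_qf_eq_zero {K : Type*} [Field K] [CharZero K] {m n k : K} {x : ZMod 8 → K}
    (hn : n ≠ 0) (hmk : 16 * m ^ 8 ≠ k ^ 8)
    (h : ∀ t, qf (m ^ 2 - n ^ 2) (-k ^ 2) (2 * m ^ 2 + 2 * n ^ 2) t x = 0)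
    (h0 : x 0 - x 4 = 0) (h1 : x 1 - x 5 = 0) (h2 : x 2 - x 6 = 0) (h3 : x 3 - x 7 = 0) :
    ∀ i, x i = 0 := by
  have b0 := qf_zero_add_qf_two m n k x
  have b1 := qf_zero_sub_qf_two m n k x
  have b2 := qf_one_sub_qf_three m n k x
  have b3 := qf_one_add_qf_three m n k x
  have e4 : x 4 = x 0 := (sub_eq_zero.mp h0).symm
  have e5 : x 5 = x 1 := (sub_eq_zero.mp h1).symm
  have e6 : x 6 = x 2 := (sub_eq_zero.mp h2).symm
  have e7 : x 7 = x 3 := (sub_eq_zero.mp h3).symm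
  simp only [h, e4, e5, e6, e7] at b0 b1 b2 b3
  have hn2 : -(4 * n ^ 2) ≠ 0 := neg_ne_zero.mpr (mul_ne_zero (by norm_num) (pow_ne_zero 2 hn))
  have c02 : x 0 ^ 2 - x 2 ^ 2 = 0 :=
    (mul_eq_zero.mp (by linear_combination -b1 : -(4 * n ^ 2) * (x 0 ^ 2 - x 2 ^ 2) = 0)).resolve_left hn2
  have c13 : x 1 ^ 2 - x 3 ^ 2 = 0 :=
    (mul_eq_zero.mp (by linear_combination -b2 : -(4 * n ^ 2) * (x 1 ^ 2 - x 3 ^ 2) = 0)).resolve_left hn2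
  have d0 : 2 * m ^ 2 * x 0 ^ 2 = k ^ 2 * (x 1 * x 3) := by
    linear_combination -b0 / 4 + m ^ 2 * c02
  have d1 : 2 * m ^ 2 * x 1 ^ 2 = k ^ 2 * (x 0 * x 2) := by
    linear_combination -b3 / 4 + m ^ 2 * c13
  -- Squaring `d0` and `d1`, and using `x 0² = x 2²` and `x 1² = x 3²`, gives two linear relations
  -- between `x 0⁴` and `x 1⁴` whose determinant is `16 m⁸ - k⁸` up to sign.
  have f0 : 4 * m ^ 4 * x 0 ^ 4 = k ^ 4 * x 1 ^ 4 := by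
    linear_combination (2 * m ^ 2 * x 0 ^ 2 + k ^ 2 * (x 1 * x 3)) * d0 - k ^ 4 * x 1 ^ 2 * c13
  have f1 : 4 * m ^ 4 * x 1 ^ 4 = k ^ 4 * x 0 ^ 4 := by
    linear_combination (2 * m ^ 2 * x 1 ^ 2 + k ^ 2 * (x 0 * x 2)) * d1 - k ^ 4 * x 0 ^ 2 * c02
  have hmk' : 16 * m ^ 8 - k ^ 8 ≠ 0 := sub_ne_zero.mpr hmk
  have z0 : x 0 = 0 := by
    have : (16 * m ^ 8 - k ^ 8) * x 0 ^ 4 = 0 := by linear_combination 4 * m ^ 4 * f0 + k ^ 4 * f1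
    exact pow_eq_zero_iff (by norm_num) |>.mp ((mul_eq_zero.mp this).resolve_left hmk')
  have z1 : x 1 = 0 := by
    have : (16 * m ^ 8 - k ^ 8) * x 1 ^ 4 = 0 := by linear_combination 4 * m ^ 4 * f1 + k ^ 4 * f0
    exact pow_eq_zero_iff (by norm_num) |>.mp ((mul_eq_zero.mp this).resolve_left hmk')
  have z2 : x 2 = 0 := by simpa [z0] using c02
  have z3 : x 3 = 0 := by simpa [z1] using c13
  intro i
  fin_cases i
  exacts [z0, z1, z2, z3, e4.trans z0, e5.trans z1, e6.trans z2, e7.trans z3]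

lemma constantCoeff_eq_zero_of_mem_deg {n : ℕ} (hn : n ≠ 0) {f : Ring8} (hf : f ∈ deg n) :
    constantCoeff f = 0 :=
  IsHomogeneous.coeff_eq_zero hf (by simpa using hn.symm)

lemma Admissible.topologicalKrullDim_le {v : Vec} (h : Admissible v) :
    topologicalKrullDim (V8 (Projectivization.mk ℂ v h.ne_zero)) ≤ (3 : ℕ) := by
  classical
  -- Setting `x_{i+4} = x_i` leaves only the vertex of the cone, so these four forms bound the
  -- dimension by `4 - 1 = 3`.
  let s : Finset Ring8 := {X 0 - X 4, X 1 - X 5, X 2 - X 6, X 3 - X 7}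
  have hs : (s : Set Ring8) = {X 0 - X 4, X 1 - X 5, X 2 - X 6, X 3 - X 7} := by simp [s]
  refine topologicalKrullDim_subscheme_le _ 3 s Finset.card_le_four (fun f hf => ?_)
    (fun f hf => ?_) fun Q hQ hI hsQ i => ?_
  · have : (idealV8 (Projectivization.mk ℂ v h.ne_zero)).toIdeal ≤
        RingHom.ker (constantCoeff : Ring8 →+* ℂ) :=
      Ideal.span_le.mpr fun g hg => constantCoeff_eq_zero_of_mem_deg two_ne_zero hg.1
    exact this hf
  · simp only [s, Finset.mem_insert, Finset.mem_singleton] at hf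
    rcases hf with rfl | rfl | rfl | rfl <;> simp
  · obtain ⟨K, _, _, φ, hφ⟩ := exists_algHom_ker_eq Q
    have : CharZero K := charZero_of_injective_algebraMap (algebraMap ℂ K).injective
    have hg := h.generic.map (K := K)
    have hsub : ∀ i j : ZMod 8, X i - X j ∈ (s : Set Ring8) → φ (X i) - φ (X j) = 0 :=
      fun i j hij => by rw [← map_sub, hφ]; exact hsQ hij
    rw [← hφ]
    refine eq_zero_of_qf_eq_zero hg.n_ne hg.ne₁ (x := fun i => φ (X i)) (fun t => ?_)
      (hsub 0 4 (by simp [hs])) (hsub 1 5 (by simp [hs])) (hsub 2 6 (by simp [hs]))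
      (hsub 3 7 (by simp [hs])) i
    have hq := (hφ _).mpr (hI (h.quadric_mem t))
    have hφC : ∀ c, φ (C c) = algebraMap ℂ K c := fun c => φ.commutes c
    rw [quadric, ← AlgHom.coe_toRingHom, map_qf] at hq
    simp only [AlgHom.coe_toRingHom, hφC] at hq
    convert hq using 2
    · rw [← map_pow, ← map_pow, ← map_sub]
      congr 1
      ring
    · rw [map_neg, map_pow]
    · rw [← map_pow, ← map_pow, ← map_ofNat (algebraMap ℂ K) 2, ← map_mul, ← map_mul, ← map_add]
      congr 1
      ring

/-- The lower bound comes from the local ring at `y` itself. -/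
lemma Admissible.topologicalKrullDim_eq {v : Vec} (h : Admissible v) :
    topologicalKrullDim (V8 (Projectivization.mk ℂ v h.ne_zero)) = (3 : ℕ) := by
  obtain ⟨x, hx⟩ := h.exists_point 0 0
  exact le_antisymm h.topologicalKrullDim_le
    ((h.isOrdinaryDoublePoint x 0 0 hx).2.2.trans (le_ringKrullDim_stalk_le _ x))

/-- The polynomial whose non-vanishing expresses general position. -/
def discr : Ring8 :=
  X 1 * X 3 * X 2 * (X 1 ^ 8 - X 3 ^ 8) * (X 1 + X 3) * (X 1 - X 3) *
    ((X 1 + X 3) ^ 8 - 16 * X 2 ^ 8) * ((X 1 + X 3) ^ 8 - (X 1 - X 3) ^ 8) *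
    ((X 1 - X 3) ^ 8 + 16 * X 2 ^ 8) * ((X 1 + X 3) ^ 8 - (X 1 - X 3) ^ 8 - 16 * X 2 ^ 8)

lemma Admissible.of_eval_discr_ne_zero {v : Vec} (hodd : ∀ i, v (-i) = -v i)
    (h : eval v discr ≠ 0) : Admissible v := by
  simp only [discr, map_mul, map_sub, map_add, map_pow, eval_X, map_ofNat, mul_ne_zero_iff] at h
  obtain ⟨⟨⟨⟨⟨⟨⟨⟨⟨h1, h3⟩, h2⟩, h13⟩, hm⟩, hn⟩, e1⟩, e2⟩, e3⟩, e4⟩ := h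
  refine ⟨hodd, h1, h3, sub_ne_zero.mp h13, div_ne_zero hm two_ne_zero, div_ne_zero hn two_ne_zero, h2,
    fun h => e1 ?_, fun h => e2 ?_, fun h => e3 ?_, fun h => e4 ?_⟩
  -- The factors of `discr` are written in `v 1 ± v 3`, that is `2 m` and `2 n`; the powers of two
  -- clear these denominators.
  · linear_combination 16 * h
  · linear_combination 256 * h
  · linear_combination 16 * h
  · linear_combination 16 * h

/-- A point of the plane in general position. -/
def generalVec : Vec := fun i => ((![0, 3, 1, 1, 0, -1, -1, -3] : Fin 8 → ℤ) i : ℤ)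

lemma generalVec_neg (i : ZMod 8) : generalVec (-i) = -generalVec i := by
  have h : ∀ i : ZMod 8, (![0, 3, 1, 1, 0, -1, -1, -3] : Fin 8 → ℤ) (-i) =
    -(![0, 3, 1, 1, 0, -1, -1, -3] : Fin 8 → ℤ) i := by decide
  rw [generalVec, generalVec, h, Int.cast_neg]

lemma eval_generalVec_discr : eval generalVec discr ≠ 0 := by
  have h1 : generalVec 1 = 3 := Int.cast_ofNat 3
  have h2 : generalVec 2 = 1 := Int.cast_one
  have h3 : generalVec 3 = 1 := Int.cast_one
  -- Here `m = 2`, `n = 1` and `k = 1`.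
  simp only [discr, map_mul, map_sub, map_add, map_pow, eval_X, map_ofNat, h1, h2, h3]
  norm_num

lemma exists_eq_mk_of_notMem_pointIdeal {y : ℙ ℂ Vec} (hy : y ∈ P2minus)
    (h : discr ∉ pointIdeal y) :
    ∃ (v : Vec) (hv : Admissible v), y = Projectivization.mk ℂ v hv.ne_zero := by
  obtain ⟨v, hvy, hv⟩ : ∃ v ∈ y.submodule, eval v discr ≠ 0 := by
    by_contra! h0
    exact h h0
  have hadm := Admissible.of_eval_discr_ne_zero (hy v hvy) hv
  refine ⟨v, hadm, ?_⟩
  rw [Projectivization.submodule_eq, Submodule.mem_span_singleton] at hvy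
  obtain ⟨c, hc⟩ := hvy
  rw [← Projectivization.mk_rep y, eq_comm, Projectivization.mk_eq_mk_iff']
  exact ⟨c, hc⟩

lemma generalVec_mem_P2minus (h : generalVec ≠ 0) :
    Projectivization.mk ℂ generalVec h ∈ P2minus := by
  intro w hw i
  rw [Projectivization.submodule_mk, Submodule.mem_span_singleton] at hw
  obtain ⟨c, rfl⟩ := hw
  rw [Pi.smul_apply, Pi.smul_apply, generalVec_neg, smul_neg]

end Assembly

end HeisenbergEight

open HeisenbergEight in
theorem theorem6p5 :
    ∃ U : Set P7, IsOpen U ∧ (∃ y ∈ P2minus, toP7 y ∈ U) ∧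
      ∀ y ∈ P2minus, toP7 y ∈ U →
        IsCompleteIntersection (idealV8 y) ![2, 2, 2, 2] ∧
        immersion (idealV8 y) '' singularLocus (V8 y) = toP7 '' orbit y ∧
        (orbit y).ncard = 64 ∧
        ∀ x ∈ singularLocus (V8 y), IsOrdinaryDoublePoint 3 x := by
  -- The open set is the locus where `discr` does not vanish; `generalVec` shows that it meets the
  -- plane.
  refine ⟨(ProjectiveSpectrum.basicOpen deg discr : Set (ProjectiveSpectrum deg)),
    (ProjectiveSpectrum.basicOpen deg discr).isOpen, ?_, fun y hy hyU => ?_⟩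
  · have hne := (Admissible.of_eval_discr_ne_zero generalVec_neg eval_generalVec_discr).ne_zero
    refine ⟨_, generalVec_mem_P2minus hne, fun h => eval_generalVec_discr (h generalVec ?_)⟩
    rw [Projectivization.submodule_mk]
    exact Submodule.mem_span_singleton_self _
  · obtain ⟨v, hv, rfl⟩ := exists_eq_mk_of_notMem_pointIdeal hy hyU
    refine ⟨⟨⟨fun k => quadric v (k.val : ZMod 8), fun k => ?_, hv.toIdeal_eq⟩, ?_⟩, ?_, ?_, ?_⟩
    · have : (![2, 2, 2, 2] : Fin 4 → ℕ) k = 2 := by fin_cases k <;> rfl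
      rw [this]
      exact quadric_mem_deg v _
    · rw [hv.topologicalKrullDim_eq]
      norm_num
    · apply Set.Subset.antisymm
      · rintro _ ⟨x, hx, rfl⟩
        obtain ⟨a, b, hab⟩ := (hv.isRegularLocalRing_or x).resolve_left hx
        exact ⟨_, (mem_orbit_iff v hv.ne_zero _).mpr ⟨a, b, rfl⟩, hab.symm⟩
      · rintro _ ⟨p, hp, rfl⟩
        obtain ⟨a, b, rfl⟩ := (mem_orbit_iff v hv.ne_zero _).mp hp
        obtain ⟨x, hx⟩ := hv.exists_point a b
        exact ⟨x, (hv.isOrdinaryDoublePoint x a b hx).2.1, hx⟩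
    · exact ncard_orbit v hv.ne_zero hv.odd hv.one_ne hv.generic.k_ne hv.three_ne hv.pow_ne
    · intro x hx
      obtain ⟨a, b, hab⟩ := (hv.isRegularLocalRing_or x).resolve_left hx
      exact (hv.isOrdinaryDoublePoint x a b hab).1
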